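/- Work with Kan complexes as spaces and Kan fibrations as fibrations. Let $p\colon E\to B$ be a fibration of connected spaces, let $b$ be a vertex of $B$, and let $F=p^{-1}(b)$ be the fibre; assume that $F$ is connected and that $F\simeq F[n]$ for some $n\ge 0$, i.e. $\pi_kF=0$ for all $k>n$. (1) Suppose that $B$ is $n$-connected. Then $E\simeq B\times F$ as fibrations over $B$ (i.e. there is a fibre homotopy equivalence $E\to B\times F$ over $B$) if and only if, for any base point $e$ of $F$, the connecting morphism $\pi_{n+1}(B,b)\to\pi_n(F,e)$ of the fibration is trivial. (2) Suppose that the fibration has a section $s\colon B\to E$ and that $B$ is $(n-1)$-connected (connected, if $n=0$), and let $e=s(b)$ be the base point of $F$. Let $B\operatorname{aut}_*(F)$ be the classifying space of the monoid $\operatorname{aut}_*(F)$ of pointed self-equivalences of $(F,e)$, that is, the connected base space of a universal fibration with section: a fibration with section such that the space of all pointed homotopy equivalences from $(F,e)$ to its fibres (the total space of the associated principal $\operatorname{aut}_*(F)$-fibration) is contractible. Such a space exists, and $(E,s)$ is classified by a map $f\colon B\to B\operatorname{aut}_*(F)$, that is, some map from $E$ to the universal fibration covers $f$, preserves the sections and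 is a homotopy equivalence on each fibre. For every choice of $B\operatorname{aut}_*(F)$ and of a classifying map $f$ of $(E,s)$, the following holds: $E\simeq B\times F$ as fibrations with section over $B$ (i.e. there is a fibre homotopy equivalence $\varphi\colon E\to B\times F$ over $B$ with $\varphi\circ s=(\mathrm{id}_B,e)$) if and only if the morphism $\pi_n(f)\colon\pi_n(B)\to\pi_n(B\operatorname{aut}_*(F))$ is trivial. -/

import Mathlib

open CategoryTheory MonoidalCategory CartesianMonoidalCategory Simplicial
open scoped HomotopicalAlgebra SSet.modelCategoryQuillen

universe u

noncomputable section

namespace SplitFib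

/-! Spaces are Kan complexes; fibrations are Kan fibrations. -/

/-! ### Homotopy groups -/

/-- The pointed set underlying `π_n(X, x)` for a Kan complex `X`: homotopy classes relative to
`∂Δ[n]` of the maps `Δ[n] ⟶ X` that are constant equal to `x` on `∂Δ[n]`. -/
abbrev Pi (n : ℕ) (X : SSet.{u}) (x : X _⦋0⦌) : Type u :=
  SSet.RelativeMorphism.HomotopyClass (SSet.boundary n) (SSet.Subcomplex.ofSimplex x)
    (SSet.const ⟨x, SSet.Subcomplex.mem_ofSimplex_obj x⟩)

/-- The neutral element of `π_n(X, x)`: the class of the constant simplex. -/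
def Pi.base (n : ℕ) (X : SSet.{u}) (x : X _⦋0⦌) : Pi n X x :=
  SSet.RelativeMorphism.homotopyClass SSet.RelativeMorphism.const

/-- The map `π_n(X, x) → π_n(Y, f x)` induced by `f : X ⟶ Y`. -/
def Pi.map (n : ℕ) {X Y : SSet.{u}} (f : X ⟶ Y) (x : X _⦋0⦌) (a : Pi n X x) :
    Pi n Y (f.app _ x) :=
  SSet.RelativeMorphism.HomotopyClass.postcomp a
    (SSet.RelativeMorphism.ofSimplex₀ f x (f.app _ x) rfl) rfl

/-- `π_k(X, x)` is trivial for all `k < m` and all base points `x`. For a connected Kan complex,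
`ConnectedBelow (n + 1) X` says that `X` is `n`-connected and `ConnectedBelow n X` says that
`X` is `(n - 1)`-connected. -/
def ConnectedBelow (m : ℕ) (X : SSet.{u}) : Prop :=
  ∀ k : ℕ, k < m → ∀ (x : X _⦋0⦌) (a : Pi k X x), a = Pi.base k X x

/-- `π_k(X, x)` is trivial for all `k > n` and all base points `x`, that is, the `n`-th
Postnikov section `X → X[n]` of the Kan complex `X` is a homotopy equivalence. -/
def Truncated (n : ℕ) (X : SSet.{u}) : Prop :=
  ∀ k : ℕ, n < k → ∀ (x : X _⦋0⦌) (a : Pi k X x), a = Pi.base k X x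

/-! ### Homotopy equivalences -/

/-- `f` is a simplicial homotopy equivalence. -/
def IsHomotopyEquiv {X Y : SSet.{u}} (f : X ⟶ Y) : Prop :=
  ∃ g : Y ⟶ X, Nonempty (SSet.Homotopy (f ≫ g) (𝟙 X)) ∧ Nonempty (SSet.Homotopy (g ≫ f) (𝟙 Y))

/-- `φ` is a map over `B` and a homotopy equivalence over `B`: it has a homotopy inverse over `B`
and both homotopies are over `B`. -/
def IsEquivOver {B E E' : SSet.{u}} (p : E ⟶ B) (p' : E' ⟶ B) (φ : E ⟶ E') : Prop :=
  φ ≫ p' = p ∧ ∃ ψ : E' ⟶ E, ψ ≫ p = p' ∧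
    (∃ H : SSet.Homotopy (φ ≫ ψ) (𝟙 E), H.h ≫ p = fst _ _ ≫ p) ∧
    (∃ H : SSet.Homotopy (ψ ≫ φ) (𝟙 E'), H.h ≫ p' = fst _ _ ≫ p')

/-! ### Fibres and the connecting morphism -/

/-- The fibre `p⁻¹(b)`, as a simplicial set. -/
abbrev Fib {E B : SSet.{u}} (p : E ⟶ B) (b : B _⦋0⦌) : SSet.{u} :=
  ((SSet.Subcomplex.ofSimplex b).preimage p : E.Subcomplex)

/-- The inclusion of the fibre `p⁻¹(b)` in the total space. -/
abbrev Fib.incl {E B : SSet.{u}} (p : E ⟶ B) (b : B _⦋0⦌) : Fib p b ⟶ E :=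
  ((SSet.Subcomplex.ofSimplex b).preimage p).ι

/-- The vertex of `p⁻¹(b)` given by a vertex `e` of `E` such that `p e = b`. -/
def Fib.mk {E B : SSet.{u}} (p : E ⟶ B) (b : B _⦋0⦌) (e : E _⦋0⦌) (he : p.app _ e = b) :
    (Fib p b) _⦋0⦌ :=
  ⟨e, by
    change p.app _ e ∈ (SSet.Subcomplex.ofSimplex b).obj _
    rw [he]
    exact SSet.Subcomplex.mem_ofSimplex_obj b⟩

/-- The graph of the connecting morphism `∂ : π_{n+1}(B, b) → π_n(F, e)` of the Kan fibration `p`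
with fibre `F = p⁻¹(b)`. One has `∂ x = y` if and only if `x` is represented by some `γ` having
a lift `σ : Δ[n + 1] ⟶ E` along `p` whose faces other than the `0`-th one are constant equal
to `e`, and whose `0`-th face, which lies in `F`, represents `y`. -/
def IsConnecting {E B : SSet.{u}} (p : E ⟶ B) (b : B _⦋0⦌) (e : (Fib p b) _⦋0⦌) (n : ℕ)
    (x : Pi (n + 1) B b) (y : Pi n (Fib p b) e) : Prop :=
  ∃ (γ : B.PtSimplex (n + 1) b) (δ : (Fib p b).PtSimplex n e) (σ : Δ[n + 1] ⟶ E),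
    γ.homotopyClass = x ∧ δ.homotopyClass = y ∧ σ ≫ p = γ.map ∧
    SSet.stdSimplex.δ 0 ≫ σ = δ.map ≫ Fib.incl p b ∧
    ∀ i : Fin (n + 2), i ≠ 0 →
      SSet.stdSimplex.δ i ≫ σ = SSet.const ((Fib.incl p b).app _ e)

/-! ### Splittings -/

/-- `E ≃ B × F` as fibrations over `B`, where `F = p⁻¹(b)`. -/
def Splits {E B : SSet.{u}} (p : E ⟶ B) (b : B _⦋0⦌) : Prop :=
  ∃ φ : E ⟶ B ⊗ Fib p b, IsEquivOver p (fst B (Fib p b)) φ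

/-! ### Fibrations with a section -/

/-- A Kan fibration over `B` with a section. -/
structure SecFib (B : SSet.{u}) where
  /-- the total space -/
  total : SSet.{u}
  /-- the projection -/
  proj : total ⟶ B
  /-- the section -/
  sec : B ⟶ total
  sec_proj : sec ≫ proj = 𝟙 B
  fibration : HomotopicalAlgebra.Fibration proj

/-- The base point `s(b)` of the fibre over `b`. -/
def SecFib.pt {B : SSet.{u}} (P : SecFib B) (b : B _⦋0⦌) : (Fib P.proj b) _⦋0⦌ :=
  Fib.mk P.proj b (P.sec.app _ b) (by
    change (P.sec ≫ P.proj).app _ b = b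
    rw [P.sec_proj]
    rfl)

/-- `E ≃ B × F` as fibrations with a section over `B`, where `F` is the fibre over `b`, pointed
by `s(b)`, and `B × F` has the constant section. -/
def SecFib.Splits {B : SSet.{u}} (P : SecFib B) (b : B _⦋0⦌) : Prop :=
  ∃ φ : P.total ⟶ B ⊗ Fib P.proj b, IsEquivOver P.proj (fst B (Fib P.proj b)) φ ∧
    P.sec ≫ φ = lift (𝟙 B) (SSet.const (P.pt b))

/-- The map `g : F ⟶ E` factors as a homotopy equivalence `F ⟶ p⁻¹(b)` followed by the
inclusion of the fibre. -/
def IsEquivOntoFibre {F E B : SSet.{u}} (g : F ⟶ E) (p : E ⟶ B) (b : B _⦋0⦌) : Prop :=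
  ∃ g' : F ⟶ Fib p b, g' ≫ Fib.incl p b = g ∧ IsHomotopyEquiv g'

/-- `α : K × F ⟶ E` covers `β : K ⟶ B`, sends `K × {e}` to the section, and restricts to
a homotopy equivalence from `{v} × F` to the fibre over `β v` for every vertex `v` of `K`:
a family of pointed homotopy equivalences from `(F, e)` to the fibres, parametrized by `K`. -/
structure IsEquivFamily {F B K : SSet.{u}} (e : F _⦋0⦌) (P : SecFib B)
    (β : K ⟶ B) (α : K ⊗ F ⟶ P.total) : Prop where
  proj : α ≫ P.proj = fst K F ≫ β
  sec : lift (𝟙 K) (SSet.const e) ≫ α = β ≫ P.sec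
  equiv (v : K _⦋0⦌) :
    IsEquivOntoFibre (lift (SSet.const v) (𝟙 F) ≫ α) P.proj (β.app _ v)

lemma IsEquivFamily.precomp {F B K L : SSet.{u}} {e : F _⦋0⦌} {P : SecFib B}
    {β : K ⟶ B} {α : K ⊗ F ⟶ P.total} (h : IsEquivFamily e P β α) (θ : L ⟶ K) :
    IsEquivFamily e P (θ ≫ β) (θ ▷ F ≫ α) where
  proj := by rw [Category.assoc, h.proj, whiskerRight_fst_assoc]
  sec := by
    have h1 : lift (𝟙 L) (SSet.const e) ≫ θ ▷ F = θ ≫ lift (𝟙 K) (SSet.const e) := by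
      ext : 1 <;> simp
    rw [← Category.assoc, h1, Category.assoc, h.sec, Category.assoc]
  equiv v := by
    have h1 : lift (SSet.const v) (𝟙 F) ≫ θ ▷ F = lift (SSet.const (θ.app _ v)) (𝟙 F) := by
      ext : 1 <;> simp
    rw [← Category.assoc, h1]
    exact h.equiv (θ.app _ v)

/-- The associated principal fibration of a fibration with a section: the space of pointed homotopy
equivalences from `(F, e)` to the fibres. Its `k`-simplices are the families parametrized
by `Δ[k]`. The monoid `aut_*(F)` of pointed self-equivalences acts on it on the right by
composition; over a point, with total space `F`, it is the space `aut_*(F)` itself. -/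
def principal {B : SSet.{u}} (F : SSet.{u}) (e : F _⦋0⦌) (P : SecFib B) : SSet.{u} where
  obj k := { α : SSet.stdSimplex.obj k.unop ⊗ F ⟶ P.total // ∃ β, IsEquivFamily e P β α }
  map θ := TypeCat.ofHom fun α ↦ ⟨SSet.stdSimplex.map θ.unop ▷ F ≫ α.1, by
    obtain ⟨β, h⟩ := α.2
    exact ⟨_, h.precomp _⟩⟩
  map_id k := by
    ext α : 3
    apply Subtype.ext
    have h := SSet.stdSimplex.{u}.map_id k.unop
    change SSet.stdSimplex.map (𝟙 k.unop) ▷ F ≫ α.1 = α.1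
    rw [h, id_whiskerRight, Category.id_comp]
  map_comp θ η := by
    ext α : 3
    apply Subtype.ext
    have h := SSet.stdSimplex.{u}.map_comp η.unop θ.unop
    change SSet.stdSimplex.map (η.unop ≫ θ.unop) ▷ F ≫ α.1 =
      SSet.stdSimplex.map η.unop ▷ F ≫ SSet.stdSimplex.map θ.unop ▷ F ≫ α.1
    rw [h, comp_whiskerRight, Category.assoc]

/-- A contractible Kan complex: every map from `∂Δ[n]`, `n ≥ 0`, extends to `Δ[n]`. -/
def IsContractible (X : SSet.{u}) : Prop :=
  ∀ (n : ℕ) (f : (SSet.boundary.{u} n : SSet.{u}) ⟶ X),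
    ∃ g : Δ[n] ⟶ X, (SSet.boundary n).ι ≫ g = f

/-- A classifying space `B aut_*(F)` of the monoid of pointed self-equivalences of `(F, e)`:
a connected Kan complex `space` with a universal fibration with a section, universal in the sense
that the associated principal fibration `principal F e univ` has a contractible total space. -/
structure BAutPt (F : SSet.{u}) (e : F _⦋0⦌) where
  /-- the classifying space -/
  space : SSet.{u}
  kan : SSet.KanComplex space
  connected : space.IsConnected
  /-- the universal fibration with section -/
  univ : SecFib space
  contractible : IsContractible (principal F e univ)

/-- `f` classifies `P`: there is a map of fibrations from `P` to the universal one that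
covers `f`, is compatible with the sections, and is a homotopy equivalence on every fibre. -/
def Classifies {B F : SSet.{u}} {e : F _⦋0⦌} (P : SecFib B) (W : BAutPt F e)
    (f : B ⟶ W.space) : Prop :=
  ∃ φ : P.total ⟶ W.univ.total, φ ≫ W.univ.proj = P.proj ≫ f ∧ P.sec ≫ φ = f ≫ W.univ.sec ∧
    ∀ b : B _⦋0⦌, IsEquivOntoFibre (Fib.incl P.proj b ≫ φ) W.univ.proj (f.app _ b)

end SplitFib

end

noncomputable section

namespace SplitFib

open HomotopicalAlgebra SSet Limits

/-! ### Vertices of the interval and lifting of piecewise defined maps -/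

/-! Both halves are obstruction theory with a single obstruction. If `F` is connected with `π_k F =
0` for `k > n`, then `aut_*(F)` has no homotopy in degrees `≥ n`: a class in `π_k` of it is a
pointed map out of a `k`-fold suspension of `F`, which is `k`-connected. In terms of lifting, the
projection `principal.π` from the principal fibration to the classifying space lifts against `∂Δ[k]
⊂ Δ[k]` for all `k > n`. This is `BAutPt.lifting_π`, and `lifting_unionProd_ofSimplex` carries it.

For (2), a pointed splitting amounts to a family of pointed equivalences `B ⊗ F ⟶ W.univ.total` over
`f` (`SecFib.splits_of_family`, `SecFib.exists_family_of_splits`), hence to a lift of `f` to the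
principal fibration. Given a lift, `f` factors through a contractible complex, so `π_n(f)` is
trivial. Conversely `B`, being `(n - 1)`-connected, deforms into the Eilenberg subcomplex of
simplices whose faces of dimension `< n` are constant. There a lift may be taken constant below
dimension `n`; in dimension `n` it exists because `π_n(f)` is trivial; above `n` nothing obstructs
it. The common form of this argument is `exists_section_of_pointed_lifts`.

For (1), a splitting yields a map `E ⟶ F` whose restriction to the fibre is an equivalence, so a
sphere of `F` that bounds in `E` bounds in `F`, and the connecting morphism vanishes
(`eq_base_of_isConnecting`). Conversely, its vanishing lets the spherical `(n + 1)`-simplices of `B`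
lift (`exists_pointed_lift`), and the same section lemma in degree `n + 1` produces a section. Now
(2) applies, and its condition is void because `π_n(B)` is trivial.

This last step, like the existence claims in (2), needs a universal fibration. An `m`-simplex of
`classifier e S` is a fibration with section over `Δ[m]`, with fibres equivalent to `(F, e)`,
realized as a subcomplex of `Δ[m] ⊗ cofree S`. Working with subcomplexes makes base change strictly
functorial. Contractibility of the principal fibration says that families of equivalences extend
along boundary inclusions, which rests on the equivalence extension property
`exists_equivalence_extension`. For an arbitrary `W`, both `W.univ` and the given fibration are base
changes of one tautological fibration. The map from `W.space` to the classifier is an equivalence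
because both principal fibrations are contractible, so the classifying map lifts to `W.space` up to
homotopy, and `classifies_of_homotopy` transports the classification along that homotopy. -/

/-- The vertex `ε` of `Δ[1]`, as a subcomplex. -/
abbrev vtx (ε : Fin 2) : (Δ[1] : SSet.{u}).Subcomplex :=
  Subcomplex.ofSimplex (stdSimplex.obj₀Equiv.symm ε)

/-- The inclusion of `X` in the cylinder `X ⊗ Δ[1]` at the vertex `ε`. -/
abbrev cyl (ε : Fin 2) {X : SSet.{u}} : X ⟶ X ⊗ Δ[1] :=
  lift (𝟙 X) (SSet.const (stdSimplex.obj₀Equiv.symm ε))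

lemma cyl_whiskerRight (ε : Fin 2) {X Y : SSet.{u}} (f : X ⟶ Y) :
    cyl ε ≫ f ▷ Δ[1] = f ≫ cyl ε := rfl

lemma cyl_whiskerRight_assoc (ε : Fin 2) {X Y Z : SSet.{u}} (f : X ⟶ Y) (h : Y ⊗ Δ[1] ⟶ Z) :
    cyl ε ≫ f ▷ Δ[1] ≫ h = f ≫ cyl ε ≫ h := by
  rw [← Category.assoc, cyl_whiskerRight, Category.assoc]

lemma cyl_fst (ε : Fin 2) {X : SSet.{u}} : cyl ε ≫ fst X Δ[1] = 𝟙 X := rfl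

lemma cyl_fst_assoc (ε : Fin 2) {X Z : SSet.{u}} (h : X ⟶ Z) : cyl ε ≫ fst X Δ[1] ≫ h = h := by
  rw [← Category.assoc, cyl_fst, Category.id_comp]

lemma mem_vtx_iff (ε : Fin 2) {m : SimplexCategoryᵒᵖ} (t : (Δ[1] : SSet.{u}).obj m) :
    t ∈ (vtx ε).obj m ↔ t = stdSimplex.const 1 ε m := by
  constructor
  · rintro ⟨⟨f⟩, rfl⟩
    obtain rfl := Subsingleton.elim f (SimplexCategory.const _ _ 0)
    rfl
  · rintro rfl
    exact ⟨(SimplexCategory.const _ _ 0).op, rfl⟩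

lemma vtx_disjoint {m : SimplexCategoryᵒᵖ} (t : (Δ[1] : SSet.{u}).obj m)
    (h0 : t ∈ (vtx 0).obj m) (h1 : t ∈ (vtx 1).obj m) : False := by
  rw [mem_vtx_iff] at h0 h1
  have h3 := congrArg (fun s ↦ (stdSimplex.asOrderHom s) 0) (h0.symm.trans h1)
  have h4 : (0 : Fin 2) = 1 := h3
  simp at h4

lemma mem_vtx_of_cyl (ε : Fin 2) {X : SSet.{u}} {m : SimplexCategoryᵒᵖ} (x : X.obj m) :
    ((cyl ε).app m x : (X ⊗ Δ[1] : SSet).obj m).2 ∈ (vtx ε).obj m :=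
  (mem_vtx_iff _ _).2 rfl

lemma eq_cyl_of_mem_vtx {ε : Fin 2} {X : SSet.{u}} {m : SimplexCategoryᵒᵖ}
    {z : (X ⊗ Δ[1] : SSet).obj m} (hz : z.2 ∈ (vtx ε).obj m) :
    z = (cyl ε).app m z.1 := by
  rw [mem_vtx_iff] at hz
  exact Prod.ext rfl hz

lemma vtx_eq_horn (ε : Fin 2) : vtx.{u} ε = horn 1 ε := by
  ext ⟨⟨m⟩⟩ t
  rw [mem_vtx_iff, mem_horn_iff_notMem_range]
  constructor
  · rintro rfl
    refine ⟨1 - ε, ?_, ?_⟩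
    · fin_cases ε <;> simp
    · rintro ⟨i, hi⟩
      change ε = 1 - ε at hi
      fin_cases ε <;> simp at hi
  · rintro ⟨j, hj, h⟩
    apply DFunLike.ext
    intro i
    change t i = ε
    have h1 : t i ≠ j := fun hi ↦ h ⟨i, hi⟩
    generalize t i = a at *
    fin_cases ε <;> fin_cases j <;> fin_cases a <;> simp_all

lemma anodyne_vtx (ε : Fin 2) : anodyneExtensions (vtx.{u} ε).ι := by
  rw [vtx_eq_horn]
  exact .horn_ι _

lemma mem_boundary_one_iff {m : SimplexCategoryᵒᵖ} (t : (Δ[1] : SSet.{u}).obj m) :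
    t ∈ (boundary 1).obj m ↔ t ∈ (vtx 0).obj m ∨ t ∈ (vtx 1).obj m := by
  obtain ⟨⟨m⟩⟩ := m
  rw [vtx_eq_horn, vtx_eq_horn, mem_horn_iff_notMem_range, mem_horn_iff_notMem_range,
    mem_boundary_iff_notMem_range]
  constructor
  · rintro ⟨j, h⟩
    fin_cases j
    · exact .inr ⟨0, by simp, h⟩
    · exact .inl ⟨1, by simp, h⟩
  · rintro (⟨j, -, h⟩ | ⟨j, -, h⟩) <;> exact ⟨j, h⟩

/-- A piece is chosen for each simplex; `agree` makes the value independent of the choice, and this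
independence gives naturality. It replaces presenting the union as a colimit. -/
lemma exists_hom_of_pieces {Z E : SSet.{u}} {κ : Type*} (S : κ → Z.Subcomplex)
    (T : Z.Subcomplex) (hT : ∀ m (z : Z.obj m), z ∈ T.obj m → ∃ i, z ∈ (S i).obj m)
    (f : ∀ i, (S i : SSet) ⟶ E)
    (agree : ∀ i j m (z : Z.obj m) (hi : z ∈ (S i).obj m) (hj : z ∈ (S j).obj m),
      (f i).app m ⟨z, hi⟩ = (f j).app m ⟨z, hj⟩) :
    ∃ k : (T : SSet) ⟶ E, ∀ i m (z : Z.obj m) (hi : z ∈ (S i).obj m) (hz : z ∈ T.obj m),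
      k.app m ⟨z, hz⟩ = (f i).app m ⟨z, hi⟩ := by
  choose c hc using hT
  refine ⟨{ app m := ↾fun z ↦ (f (c m z.1 z.2)).app m ⟨z.1, hc m z.1 z.2⟩
            naturality m m' θ := ?_ }, fun i m z hi hz ↦ agree _ _ _ _ _ _⟩
  ext ⟨z, hz⟩
  have h1 := NatTrans.naturality_apply (f (c m z hz)) θ ⟨z, hc m z hz⟩
  exact (agree _ _ _ _ _ ((S _).map θ (hc m z hz))).trans h1

/-- Lifting of maps defined piecewise on subcomplexes whose union is `T`. -/
lemma exists_lift_of_partial {Z E B : SSet.{u}} {κ : Type*} (S : κ → Z.Subcomplex)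
    (T : Z.Subcomplex) (hT : ∀ m (z : Z.obj m), z ∈ T.obj m ↔ ∃ i, z ∈ (S i).obj m)
    (p : E ⟶ B) (hp : HasLiftingProperty T.ι p) (f : ∀ i, (S i : SSet) ⟶ E)
    (agree : ∀ i j m (z : Z.obj m) (hi : z ∈ (S i).obj m) (hj : z ∈ (S j).obj m),
      (f i).app m ⟨z, hi⟩ = (f j).app m ⟨z, hj⟩)
    (G : Z ⟶ B) (hG : ∀ i, f i ≫ p = (S i).ι ≫ G) :
    ∃ k : Z ⟶ E, k ≫ p = G ∧ ∀ i, (S i).ι ≫ k = f i := by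
  obtain ⟨k, hk⟩ := exists_hom_of_pieces S T (fun m z ↦ (hT m z).1) f agree
  have sq : CommSq k T.ι p G := ⟨by
    ext m ⟨z, hz⟩
    obtain ⟨i, hi⟩ := (hT m z).1 hz
    have h1 := ConcreteCategory.congr_hom (congr_app (hG i) m) ⟨z, hi⟩
    exact (congrArg (p.app m) (hk i m z hi hz)).trans h1⟩
  refine ⟨sq.lift, sq.fac_right, fun i ↦ ?_⟩
  ext m ⟨z, hi⟩
  have hz := (hT m z).2 ⟨i, hi⟩
  have h1 := ConcreteCategory.congr_hom (congr_app sq.fac_left m) ⟨z, hz⟩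
  exact h1.trans (hk i m z hi hz)

lemma exists_lift_of_pieces {Z E B : SSet.{u}} {κ : Type*} (S : κ → Z.Subcomplex)
    (T : Z.Subcomplex) (hT : ∀ m (z : Z.obj m), z ∈ T.obj m ↔ ∃ i, z ∈ (S i).obj m)
    (p : E ⟶ B) (hp : HasLiftingProperty T.ι p) (f : κ → (Z ⟶ E))
    (agree : ∀ i j m (z : Z.obj m), z ∈ (S i).obj m → z ∈ (S j).obj m →
      (f i).app m z = (f j).app m z)
    (G : Z ⟶ B)
    (hG : ∀ i m (z : Z.obj m), z ∈ (S i).obj m → p.app m ((f i).app m z) = G.app m z) :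
    ∃ k : Z ⟶ E, k ≫ p = G ∧ ∀ i m (z : Z.obj m), z ∈ (S i).obj m →
      k.app m z = (f i).app m z := by
  obtain ⟨k, h1, h2⟩ := exists_lift_of_partial S T hT p hp (fun i ↦ (S i).ι ≫ f i)
    (fun i j m z hi hj ↦ agree i j m z hi hj) G (fun i ↦ by
      ext m ⟨z, hz⟩
      exact hG i m z hz)
  exact ⟨k, h1, fun i m z hz ↦ ConcreteCategory.congr_hom (congr_app (h2 i) m) ⟨z, hz⟩⟩

lemma hom_eq_of_app {X Y : SSet.{u}} {f g : X ⟶ Y}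
    (h : ∀ m (x : X.obj m), f.app m x = g.app m x) : f = g := by
  ext m x
  exact h m x

lemma app_eq_of_eq {X Y : SSet.{u}} {f g : X ⟶ Y} (h : f = g) {m} (x : X.obj m) :
    f.app m x = g.app m x := by rw [h]

/-! ### Lifting homotopies -/

lemma anodyne_of_llp {A X : SSet.{u}} {i : A ⟶ X} (h : anodyneExtensions i)
    {E B : SSet.{u}} (p : E ⟶ B) [Fibration p] : HasLiftingProperty i p :=
  h p (by rwa [← HomotopicalAlgebra.fibration_iff])

/-- Lifting of a pair of maps on `X ⊗ C` and `A ⊗ Y`. -/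
lemma exists_lift_prod {A X Y : SSet.{u}} (i : A ⟶ X) [Mono i] (C : Y.Subcomplex)
    (hC : anodyneExtensions C.ι) {E B : SSet.{u}} (p : E ⟶ B) [Fibration p]
    (u : X ⊗ (C : SSet) ⟶ E) (h : A ⊗ Y ⟶ E) (G : X ⊗ Y ⟶ B)
    (huh : i ▷ (C : SSet) ≫ u = A ◁ C.ι ≫ h)
    (hu : u ≫ p = X ◁ C.ι ≫ G) (hh : h ≫ p = i ▷ Y ≫ G) :
    ∃ H : X ⊗ Y ⟶ E, X ◁ C.ι ≫ H = u ∧ i ▷ Y ≫ H = h ∧ H ≫ p = G := by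
  let sq := Functor.PushoutObjObj.ofHasPushout (curriedTensor SSet.{u}) i C.ι
  have := anodyne_of_llp (anodyneExtensions_pushoutObjObjι sq hC) p
  have hl : sq.inl ≫ sq.ι = X ◁ C.ι := sq.inl_ι
  have hr : sq.inr ≫ sq.ι = i ▷ Y := sq.inr_ι
  have hil : sq.inl ≫ sq.isPushout.desc u h huh = u := sq.isPushout.inl_desc u h huh
  have hir : sq.inr ≫ sq.isPushout.desc u h huh = h := sq.isPushout.inr_desc u h huh
  have w : CommSq (sq.isPushout.desc u h huh) sq.ι p G := ⟨by
    apply sq.isPushout.hom_ext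
    · rw [reassoc_of% hil, hu, reassoc_of% hl]
    · rw [reassoc_of% hir, hh, reassoc_of% hr]⟩
  refine ⟨w.lift, ?_, ?_, w.fac_right⟩
  · rw [← hl, Category.assoc, w.fac_left, hil]
  · rw [← hr, Category.assoc, w.fac_left, hir]

/-- The vertex of the subcomplex `vtx ε`. -/
abbrev vtxPt (ε : Fin 2) : (vtx.{u} ε : SSet) _⦋0⦌ :=
  ⟨stdSimplex.obj₀Equiv.symm ε, Subcomplex.mem_ofSimplex_obj _⟩

lemma mem_unionProd {X Y : SSet.{u}} (S : X.Subcomplex) (T : Y.Subcomplex)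
    {m : SimplexCategoryᵒᵖ} (x : (X ⊗ Y : SSet).obj m) :
    x ∈ (S.unionProd T).obj m ↔ x.2 ∈ T.obj m ∨ x.1 ∈ S.obj m :=
  Subcomplex.mem_unionProd_iff S T x

lemma whiskerLeft_vtx_ι (ε : Fin 2) (X : SSet.{u}) :
    X ◁ (vtx ε).ι = fst X (vtx ε : SSet) ≫ cyl ε := by
  refine hom_eq_of_app fun m x ↦ Prod.ext rfl ?_
  exact (mem_vtx_iff _ _).1 x.2.2

/-- The homotopy lifting property of a fibration, relatively to a monomorphism. -/
lemma hlp (ε : Fin 2) {A X : SSet.{u}} (i : A ⟶ X) [Mono i] {E B : SSet.{u}} (p : E ⟶ B)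
    [Fibration p] (u : X ⟶ E) (h : A ⊗ Δ[1] ⟶ E) (G : X ⊗ Δ[1] ⟶ B)
    (huh : i ≫ u = cyl ε ≫ h) (hu : u ≫ p = cyl ε ≫ G) (hh : h ≫ p = i ▷ Δ[1] ≫ G) :
    ∃ H : X ⊗ Δ[1] ⟶ E, cyl ε ≫ H = u ∧ i ▷ Δ[1] ≫ H = h ∧ H ≫ p = G := by
  obtain ⟨H, h1, h2, h3⟩ := exists_lift_prod i (vtx ε) (anodyne_vtx ε) p (fst _ _ ≫ u) h G
    (by rw [whiskerRight_fst_assoc, huh, whiskerLeft_vtx_ι, Category.assoc])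
    (by rw [Category.assoc, hu, whiskerLeft_vtx_ι, Category.assoc]) hh
  refine ⟨H, ?_, h2, h3⟩
  have h4 : cyl ε = lift (𝟙 X) (SSet.const (vtxPt ε)) ≫ X ◁ (vtx ε).ι := rfl
  rw [h4, Category.assoc, h1]
  rfl

lemma anodyne_cyl (ε : Fin 2) (X : SSet.{u}) : anodyneExtensions (cyl ε : X ⟶ X ⊗ Δ[1]) := by
  refine (anodyneExtensions.arrow_mk_iso_iff ?_).1 ((anodyne_vtx ε).whiskerLeft X)
  refine Arrow.isoMk ⟨fst _ _, lift (𝟙 X) (SSet.const (vtxPt ε)), ?_, ?_⟩ (Iso.refl _) ?_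
  · refine hom_eq_of_app fun m x ↦ Prod.ext rfl (Subtype.ext ?_)
    exact ((mem_vtx_iff _ _).1 x.2.2).symm
  · rfl
  · exact (whiskerLeft_vtx_ι ε X).symm

lemma hlp_abs (ε : Fin 2) {X E B : SSet.{u}} (p : E ⟶ B)
    [Fibration p] (u : X ⟶ E) (G : X ⊗ Δ[1] ⟶ B) (hu : u ≫ p = cyl ε ≫ G) :
    ∃ H : X ⊗ Δ[1] ⟶ E, cyl ε ≫ H = u ∧ H ≫ p = G := by
  have := anodyne_of_llp (anodyne_cyl ε X) p
  have sq : CommSq u (cyl ε) p G := ⟨hu⟩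
  exact ⟨sq.lift, sq.fac_left, sq.fac_right⟩

/-! ### Relative homotopies over a base -/

/-- `f` and `g` are homotopic relatively to `A`, by a homotopy which is constant over `B`. -/
def HtpyRel {X E B : SSet.{u}} (A : X.Subcomplex) (p : E ⟶ B) (f g : X ⟶ E) : Prop :=
  ∃ H : X ⊗ Δ[1] ⟶ E, cyl 0 ≫ H = f ∧ cyl 1 ≫ H = g ∧ H ≫ p = fst _ _ ≫ f ≫ p ∧
    A.ι ▷ Δ[1] ≫ H = fst _ _ ≫ A.ι ≫ f

/-- Two homotopies over the same homotopy of the base, which are equal on `A`, and which start at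
the ends of a homotopy over a constant homotopy end at homotopic maps. -/
lemma homotopic_ends {X E B : SSet.{u}} (A : X.Subcomplex) (p : E ⟶ B) [Fibration p]
    (ε ε' : Fin 2) (u H K : X ⊗ Δ[1] ⟶ E)
    (hH : cyl ε ≫ H = cyl 0 ≫ u) (hK : cyl ε ≫ K = cyl 1 ≫ u)
    (hu : u ≫ p = fst _ _ ≫ cyl ε ≫ H ≫ p) (hHK : H ≫ p = K ≫ p)
    (huA : A.ι ▷ Δ[1] ≫ u = fst _ _ ≫ A.ι ≫ cyl ε ≫ H)
    (hA : A.ι ▷ Δ[1] ≫ H = A.ι ▷ Δ[1] ≫ K) :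
    HtpyRel A p (cyl ε' ≫ H) (cyl ε' ≫ K) := by
  -- An open box: the first interval coordinate is the parameter of `u`, the second the direction of
  -- `H` and `K`. The floor at `ε` carries `u`, the two walls carry `H` and `K`, and over `A` both
  -- are equal. The opposite face of a filler is the required homotopy.
  have anod : anodyneExtensions ((A.unionProd (boundary 1)).unionProd (vtx.{u} ε)).ι :=
    anodyneExtensions_unionProd_ι _ _ (anodyne_vtx ε)
  have := anodyne_of_llp anod p
  let r : (X ⊗ Δ[1]) ⊗ Δ[1] ⟶ X ⊗ Δ[1] := fst _ _ ▷ Δ[1]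
  let S : Option (Fin 3) → ((X ⊗ Δ[1]) ⊗ Δ[1] : SSet.{u}).Subcomplex := fun k ↦ k.elim
    ((vtx ε).preimage (snd _ _))
    ![(vtx 0).preimage (fst _ _ ≫ snd _ _), (vtx 1).preimage (fst _ _ ≫ snd _ _),
      A.preimage (fst _ _ ≫ fst _ _)]
  let f : Option (Fin 3) → ((X ⊗ Δ[1]) ⊗ Δ[1] ⟶ E) := fun k ↦ k.elim (fst _ _ ≫ u)
    ![r ≫ H, r ≫ K, r ≫ H]
  have e0 : ∀ m (x : X.obj m), H.app m ((cyl ε).app m x) = u.app m ((cyl 0).app m x) :=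
    fun m x ↦ app_eq_of_eq hH x
  have e1 : ∀ m (x : X.obj m), K.app m ((cyl ε).app m x) = u.app m ((cyl 1).app m x) :=
    fun m x ↦ app_eq_of_eq hK x
  have eA : ∀ m (x : X.obj m) (t), x ∈ A.obj m → H.app m (x, t) = K.app m (x, t) :=
    fun m x t hx ↦ app_eq_of_eq hA ((⟨x, hx⟩, t) : ((A : SSet) ⊗ Δ[1] : SSet).obj m)
  have euA : ∀ m (x : X.obj m) (t), x ∈ A.obj m →
      u.app m (x, t) = H.app m ((cyl ε).app m x) :=
    fun m x t hx ↦ app_eq_of_eq huA ((⟨x, hx⟩, t) : ((A : SSet) ⊗ Δ[1] : SSet).obj m)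
  have eHK : ∀ m z, p.app m (H.app m z) = p.app m (K.app m z) :=
    fun m z ↦ app_eq_of_eq hHK z
  have c0 : ∀ m (z : ((X ⊗ Δ[1]) ⊗ Δ[1] : SSet.{u}).obj m), z.2 ∈ (vtx ε).obj m →
      z.1.2 ∈ (vtx 0).obj m → u.app m z.1 = H.app m (z.1.1, z.2) := fun m z h1 h2 ↦ by
    rw [eq_cyl_of_mem_vtx h2, ← e0]
    exact congrArg (H.app m) (eq_cyl_of_mem_vtx (z := ((z.1.1, z.2) : (X ⊗ Δ[1] : SSet).obj m)) h1).symm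
  have c1 : ∀ m (z : ((X ⊗ Δ[1]) ⊗ Δ[1] : SSet.{u}).obj m), z.2 ∈ (vtx ε).obj m →
      z.1.2 ∈ (vtx 1).obj m → u.app m z.1 = K.app m (z.1.1, z.2) := fun m z h1 h2 ↦ by
    rw [eq_cyl_of_mem_vtx h2, ← e1]
    exact congrArg (K.app m) (eq_cyl_of_mem_vtx (z := ((z.1.1, z.2) : (X ⊗ Δ[1] : SSet).obj m)) h1).symm
  have cA : ∀ m (z : ((X ⊗ Δ[1]) ⊗ Δ[1] : SSet.{u}).obj m), z.2 ∈ (vtx ε).obj m →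
      z.1.1 ∈ A.obj m → u.app m z.1 = H.app m (z.1.1, z.2) := fun m z h1 h2 ↦
    (euA m z.1.1 z.1.2 h2).trans (congrArg (H.app m)
      (eq_cyl_of_mem_vtx (z := ((z.1.1, z.2) : (X ⊗ Δ[1] : SSet).obj m)) h1).symm)
  obtain ⟨k, hk1, hk2⟩ := exists_lift_of_pieces S _ (by
      intro m z
      refine (mem_unionProd _ _ _).trans ((or_congr_right ((mem_unionProd _ _ _).trans
        (or_congr_left (mem_boundary_one_iff _)))).trans ?_)
      constructor
      · rintro (h | (h | h) | h)
        exacts [⟨none, h⟩, ⟨some 0, h⟩, ⟨some 1, h⟩, ⟨some 2, h⟩]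
      · rintro ⟨_ | i, h⟩
        · exact .inl h
        · fin_cases i
          exacts [.inr (.inl (.inl h)), .inr (.inl (.inr h)), .inr (.inr h)]) p this f (by
      rintro (_ | i) (_ | j) m z hi hj
      · rfl
      · fin_cases j
        exacts [c0 m z hi hj, c1 m z hi hj, cA m z hi hj]
      · fin_cases i
        exacts [(c0 m z hj hi).symm, (c1 m z hj hi).symm, (cA m z hj hi).symm]
      · fin_cases i <;> fin_cases j
        exacts [rfl, (vtx_disjoint _ hi hj).elim, rfl, (vtx_disjoint _ hj hi).elim, rfl,
          (eA m _ _ hj).symm, rfl, eA m _ _ hi, rfl]) (r ≫ H ≫ p) (by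
      rintro (_ | i) m z hi
      · refine (app_eq_of_eq hu z.1).trans ?_
        exact congrArg (fun y ↦ p.app m (H.app m y))
          (eq_cyl_of_mem_vtx (z := ((z.1.1, z.2) : (X ⊗ Δ[1] : SSet).obj m)) hi).symm
      · fin_cases i
        exacts [rfl, (eHK m _).symm, rfl])
  refine ⟨cyl ε' ≫ k, ?_, ?_, ?_, ?_⟩
  · refine hom_eq_of_app fun m x ↦ ?_
    exact hk2 (some 0) m _ (mem_vtx_of_cyl 0 x)
  · refine hom_eq_of_app fun m x ↦ ?_
    exact hk2 (some 1) m _ (mem_vtx_of_cyl 1 x)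
  · rw [Category.assoc, hk1, Category.assoc, cyl_whiskerRight_assoc]
  · refine hom_eq_of_app fun m x ↦ ?_
    exact hk2 (some 2) m _ x.1.2

namespace HtpyRel

variable {X E B : SSet.{u}} {A : X.Subcomplex} {p : E ⟶ B} {f g h : X ⟶ E}

lemma refl (A : X.Subcomplex) (p : E ⟶ B) (f : X ⟶ E) : HtpyRel A p f f :=
  ⟨fst _ _ ≫ f, rfl, rfl, rfl, rfl⟩

lemma comp_eq (H : HtpyRel A p f g) : f ≫ p = g ≫ p := by
  obtain ⟨H, h0, h1, h2, -⟩ := H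
  rw [← h1, Category.assoc, h2, cyl_fst_assoc]

/-- Two homotopies with the same start are lifts of the same constant homotopy of the base, so their
ends are homotopic. Symmetry and transitivity both follow from this form. -/
lemma euclid [Fibration p] (H : HtpyRel A p f g) (K : HtpyRel A p f h) : HtpyRel A p g h := by
  obtain ⟨H, h0, h1, h2, h3⟩ := H
  obtain ⟨K, k0, k1, k2, k3⟩ := K
  rw [← h1, ← k1]
  refine homotopic_ends A p 0 1 (fst _ _ ≫ f) H K (by rw [h0]; rfl) (by rw [k0]; rfl) ?_ ?_ ?_ ?_
  · rw [reassoc_of% h0, Category.assoc]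
  · rw [h2, k2]
  · rw [h0, whiskerRight_fst_assoc]
  · rw [h3, k3]

lemma symm [Fibration p] (H : HtpyRel A p f g) : HtpyRel A p g f := H.euclid (refl _ _ _)

lemma trans [Fibration p] (H : HtpyRel A p f g) (K : HtpyRel A p g h) : HtpyRel A p f h :=
  H.symm.euclid K

lemma mono {A' : X.Subcomplex} (H : HtpyRel A p f g) (hA : A' ≤ A) : HtpyRel A' p f g := by
  obtain ⟨H, h0, h1, h2, h3⟩ := H
  refine ⟨H, h0, h1, h2, ?_⟩
  have := congrArg (fun k ↦ Subcomplex.homOfLE hA ▷ Δ[1] ≫ k) h3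
  exact this

lemma postcomp {E' B' : SSet.{u}} (H : HtpyRel A p f g) (φ : E ⟶ E') (p' : E' ⟶ B') (β : B ⟶ B')
    (w : φ ≫ p' = p ≫ β) : HtpyRel A p' (f ≫ φ) (g ≫ φ) := by
  obtain ⟨H, h0, h1, h2, h3⟩ := H
  refine ⟨H ≫ φ, by rw [reassoc_of% h0], by rw [reassoc_of% h1], ?_, by rw [reassoc_of% h3]⟩
  rw [Category.assoc, w, reassoc_of% h2]
  simp only [Category.assoc, w]

lemma precomp {X' : SSet.{u}} {A' : X'.Subcomplex} (H : HtpyRel A p f g) (θ : X' ⟶ X)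
    (hA : A' ≤ A.preimage θ) : HtpyRel A' p (θ ≫ f) (θ ≫ g) := by
  obtain ⟨H, h0, h1, h2, h3⟩ := H
  refine ⟨θ ▷ Δ[1] ≫ H, by rw [← h0]; rfl, by rw [← h1]; rfl, by
    rw [Category.assoc, h2]; rfl, ?_⟩
  refine hom_eq_of_app fun m x ↦ ?_
  exact app_eq_of_eq h3 ((⟨θ.app m x.1.1, hA _ x.1.2⟩, x.2) : ((A : SSet) ⊗ Δ[1] : SSet).obj m)

end HtpyRel

end SplitFib

end

noncomputable section

namespace SplitFib

open HomotopicalAlgebra SSet Limits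

/-! ### Maps out of products of simplices -/

/-- The map `Δ[k] ⊗ Δ[l] ⟶ Δ[m]` given by a monotone map on vertices. -/
def ofMonotone {k l m : ℕ} (g : Fin (k + 1) × Fin (l + 1) →o Fin (m + 1)) :
    (Δ[k] : SSet.{u}) ⊗ Δ[l] ⟶ Δ[m] where
  app n := ↾fun x ↦ stdSimplex.objMk (m := n) (n := .mk m)
    (g.comp ((stdSimplex.asOrderHom x.1).prod (stdSimplex.asOrderHom x.2)))
  naturality _ _ _ := rfl

lemma asOrderHom_ext {k : ℕ} {n : SimplexCategoryᵒᵖ} {x y : (Δ[k] : SSet.{u}).obj n}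
    (h : ∀ i, stdSimplex.asOrderHom x i = stdSimplex.asOrderHom y i) : x = y :=
  DFunLike.ext (F := Δ[k] _⦋n.unop.len⦌) x y h

/-- The contraction of `Δ[k]` to its vertex `0`. -/
def contract (k : ℕ) : (Δ[k] : SSet.{u}) ⊗ Δ[1] ⟶ Δ[k] :=
  ofMonotone ⟨fun x ↦ if x.2 = 0 then 0 else x.1, by
    rintro ⟨a, s⟩ ⟨b, t⟩ ⟨h1, h2⟩
    dsimp at h1 h2 ⊢
    split_ifs with h3 h4
    · exact le_rfl
    · exact Fin.zero_le _
    · subst t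
      exact (h3 (le_antisymm h2 (Fin.zero_le _))).elim
    · exact h1⟩

lemma cyl_zero_contract (k : ℕ) :
    cyl 0 ≫ contract.{u} k = SSet.const (stdSimplex.obj₀Equiv.symm 0) :=
  hom_eq_of_app fun _ _ ↦ asOrderHom_ext fun _ ↦ rfl

lemma cyl_one_contract (k : ℕ) : cyl 1 ≫ contract.{u} k = 𝟙 _ :=
  hom_eq_of_app fun _ _ ↦ asOrderHom_ext fun _ ↦ rfl

/-! ### Equivalences over a base -/

/-- A variant of `IsEquivOver`. -/
def EqvOver {B E E' : SSet.{u}} (p : E ⟶ B) (p' : E' ⟶ B) (φ : E ⟶ E') : Prop :=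
  φ ≫ p' = p ∧ ∃ ψ : E' ⟶ E, ψ ≫ p = p' ∧
    HtpyRel ⊥ p (φ ≫ ψ) (𝟙 E) ∧ HtpyRel ⊥ p' (ψ ≫ φ) (𝟙 E')

lemma htpyRel_bot_iff {X E B : SSet.{u}} (p : E ⟶ B) (f g : X ⟶ E) (w : f ≫ p = g ≫ p) :
    HtpyRel ⊥ p f g ↔ ∃ H : SSet.Homotopy f g, H.h ≫ p = fst _ _ ≫ g ≫ p := by
  constructor
  · rintro ⟨H, h0, h1, h2, h3⟩
    refine ⟨{ h := H, h₀ := h0, h₁ := h1, rel := ?_ }, by rw [← w]; exact h2⟩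
    exact hom_eq_of_app fun m x ↦ x.1.2.elim
  · rintro ⟨H, h⟩
    refine ⟨H.h, H.h₀, H.h₁, by rw [w]; exact h, ?_⟩
    exact hom_eq_of_app fun m x ↦ x.1.2.elim

lemma eqvOver_iff {B E E' : SSet.{u}} (p : E ⟶ B) (p' : E' ⟶ B) (φ : E ⟶ E') :
    EqvOver p p' φ ↔ IsEquivOver p p' φ := by
  refine and_congr_right fun hφ ↦ exists_congr fun ψ ↦ and_congr_right fun hψ ↦ ?_
  rw [htpyRel_bot_iff _ _ _ (by rw [Category.assoc, hψ, hφ, Category.id_comp]),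
    htpyRel_bot_iff _ _ _ (by rw [Category.assoc, hφ, hψ, Category.id_comp])]
  simp only [Category.id_comp]

lemma eqvOver_terminal_iff {X Y : SSet.{u}} (f : X ⟶ Y) :
    EqvOver (terminal.from X) (terminal.from Y) f ↔ IsHomotopyEquiv f := by
  constructor
  · rintro ⟨-, g, -, h1, h2⟩
    rw [htpyRel_bot_iff _ _ _ (Subsingleton.elim _ _)] at h1 h2
    exact ⟨g, ⟨h1.choose⟩, ⟨h2.choose⟩⟩
  · rintro ⟨g, ⟨h1⟩, ⟨h2⟩⟩
    refine ⟨Subsingleton.elim _ _, g, Subsingleton.elim _ _, ?_, ?_⟩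
    · exact (htpyRel_bot_iff _ _ _ (Subsingleton.elim _ _)).2 ⟨h1, Subsingleton.elim _ _⟩
    · exact (htpyRel_bot_iff _ _ _ (Subsingleton.elim _ _)).2 ⟨h2, Subsingleton.elim _ _⟩

namespace EqvOver

variable {B E E' E'' : SSet.{u}} {p : E ⟶ B} {p' : E' ⟶ B} {p'' : E'' ⟶ B}
  {φ : E ⟶ E'} {χ : E' ⟶ E''}

lemma id (p : E ⟶ B) : EqvOver p p (𝟙 E) :=
  ⟨Category.id_comp _, 𝟙 E, Category.id_comp _, by rw [Category.id_comp]; exact .refl _ _ _,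
    by rw [Category.id_comp]; exact .refl _ _ _⟩

lemma comp [Fibration p] [Fibration p''] (hφ : EqvOver p p' φ) (hχ : EqvOver p' p'' χ) :
    EqvOver p p'' (φ ≫ χ) := by
  obtain ⟨h1, φ', h2, h3, h4⟩ := hφ
  obtain ⟨k1, χ', k2, k3, k4⟩ := hχ
  refine ⟨by rw [Category.assoc, k1, h1], χ' ≫ φ', by rw [Category.assoc, h2, k2], ?_, ?_⟩
  · have := (k3.precomp (A' := ⊥) φ bot_le).postcomp φ' p (𝟙 B) (by rw [h2, Category.comp_id])
    simp only [Category.assoc, Category.id_comp] at this ⊢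
    exact this.trans h3
  · have := (h4.precomp (A' := ⊥) χ' bot_le).postcomp χ p'' (𝟙 B) (by rw [k1, Category.comp_id])
    simp only [Category.assoc, Category.id_comp] at this ⊢
    exact this.trans k4

lemma of_htpy [Fibration p] [Fibration p'] {φ' : E ⟶ E'} (hφ : EqvOver p p' φ)
    (h : HtpyRel ⊥ p' φ φ') : EqvOver p p' φ' := by
  obtain ⟨h1, ψ, h2, h3, h4⟩ := hφ
  refine ⟨by rw [← h.comp_eq, h1], ψ, h2, ?_, ?_⟩
  · exact (h.symm.postcomp ψ p (𝟙 B) (by rw [h2, Category.comp_id])).trans h3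
  · exact (h.symm.precomp ψ bot_le).trans h4

lemma inverse (hφ : EqvOver p p' φ) : ∃ ψ : E' ⟶ E, EqvOver p' p ψ ∧
    HtpyRel ⊥ p (φ ≫ ψ) (𝟙 E) ∧ HtpyRel ⊥ p' (ψ ≫ φ) (𝟙 E') := by
  obtain ⟨h1, ψ, h2, h3, h4⟩ := hφ
  exact ⟨ψ, ⟨h2, φ, h1, h4, h3⟩, h3, h4⟩

lemma of_comp_left [Fibration p] [Fibration p'] [Fibration p''] (hφ : EqvOver p p' φ)
    (h : EqvOver p p'' (φ ≫ χ)) (hχ : χ ≫ p'' = p') : EqvOver p' p'' χ := by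
  obtain ⟨ψ, h1, h2, h3⟩ := hφ.inverse
  refine (h1.comp h).of_htpy ?_
  have := h3.postcomp χ p'' (𝟙 B) (by rw [hχ, Category.comp_id])
  simpa only [Category.assoc, Category.id_comp] using this

lemma of_comp_right [Fibration p] [Fibration p'] [Fibration p''] (hχ : EqvOver p' p'' χ)
    (h : EqvOver p p'' (φ ≫ χ)) : EqvOver p p' φ := by
  obtain ⟨ψ, h1, h2, h3⟩ := hχ.inverse
  refine (h.comp h1).of_htpy ?_
  have := h2.precomp (A' := ⊥) φ bot_le
  simpa only [Category.assoc, Category.comp_id] using this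

end EqvOver

/-! ### Trivial fibrations -/

/-- A trivial fibration: it has the right lifting property with respect to the boundary
inclusions. -/
def TrivFib {E B : SSet.{u}} (p : E ⟶ B) : Prop :=
  ∀ k : ℕ, HasLiftingProperty (boundary.{u} k).ι p

namespace TrivFib

variable {E B : SSet.{u}} {p : E ⟶ B}

lemma lifting (hp : TrivFib p) {A X : SSet.{u}} (i : A ⟶ X) [Mono i] :
    HasLiftingProperty i p := by
  have : (MorphismProperty.monomorphisms SSet.{u}).rlp p := by
    rw [rlp_monomorphisms]
    rintro _ _ _ ⟨k⟩
    exact hp k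
  exact this _ (MorphismProperty.monomorphisms.infer_property i)

lemma exists_lift (hp : TrivFib p) {A X : SSet.{u}} (i : A ⟶ X) [Mono i] (u : A ⟶ E) (v : X ⟶ B)
    (w : u ≫ p = i ≫ v) : ∃ l : X ⟶ E, i ≫ l = u ∧ l ≫ p = v := by
  have := hp.lifting i
  have sq : CommSq u i p v := ⟨w⟩
  exact ⟨sq.lift, sq.fac_left, sq.fac_right⟩

lemma fibration (hp : TrivFib p) : Fibration p := by
  rw [modelCategoryQuillen.fibration_iff]
  intro _ _ i hi
  have := modelCategoryQuillen.J_le_monomorphisms _ hi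
  have : Mono i := this
  exact hp.lifting i

lemma exists_section (hp : TrivFib p) : ∃ s : B ⟶ E, s ≫ p = 𝟙 B := by
  obtain ⟨s, -, h⟩ := hp.exists_lift (Subcomplex.ι (⊥ : B.Subcomplex))
    (Subcomplex.isInitialBot.to _) (𝟙 B) (Subsingleton.elim _ _)
  exact ⟨s, h⟩

end TrivFib

/-- A homotopy over the base and relative to `A` is a lift against the pushout-product of `A` with
`∂Δ[1]`. The hypothesis holds when `p` is a trivial fibration, and also when `p` is a fibration and
`A` is anodyne. -/
lemma htpyRel_of_lifting {X E B : SSet.{u}} (A : X.Subcomplex) (p : E ⟶ B)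
    (hp : HasLiftingProperty (A.unionProd (boundary.{u} 1)).ι p)
    (f g : X ⟶ E) (w : f ≫ p = g ≫ p) (hA : A.ι ≫ f = A.ι ≫ g) : HtpyRel A p f g := by
  let S : Fin 3 → (X ⊗ Δ[1] : SSet.{u}).Subcomplex :=
    ![(vtx 0).preimage (snd _ _), (vtx 1).preimage (snd _ _), A.preimage (fst _ _)]
  have hA' : ∀ m (x : X.obj m), x ∈ A.obj m → f.app m x = g.app m x := fun m x hx ↦
    app_eq_of_eq hA ⟨x, hx⟩
  obtain ⟨k, hk1, hk2⟩ := exists_lift_of_pieces S _ (by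
      intro m z
      refine (mem_unionProd _ _ _).trans ((or_congr_left (mem_boundary_one_iff _)).trans ?_)
      constructor
      · rintro ((h | h) | h)
        exacts [⟨0, h⟩, ⟨1, h⟩, ⟨2, h⟩]
      · rintro ⟨i, h⟩
        fin_cases i
        exacts [.inl (.inl h), .inl (.inr h), .inr h]) p hp
      ![fst _ _ ≫ f, fst _ _ ≫ g, fst _ _ ≫ f] (by
      intro i j m z hi hj
      fin_cases i <;> fin_cases j
      exacts [rfl, (vtx_disjoint _ hi hj).elim, rfl, (vtx_disjoint _ hj hi).elim, rfl, (hA' m _ hj).symm, rfl,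
        hA' m _ hi, rfl]) (fst _ _ ≫ f ≫ p) (by
      intro i m z hi
      fin_cases i
      exacts [rfl, (app_eq_of_eq w z.1).symm, rfl])
  refine ⟨k, hom_eq_of_app fun m x ↦ ?_, hom_eq_of_app fun m x ↦ ?_, hk1,
    hom_eq_of_app fun m x ↦ ?_⟩
  · exact hk2 0 m _ (mem_vtx_of_cyl 0 x)
  · exact hk2 1 m _ (mem_vtx_of_cyl 1 x)
  · exact hk2 2 m _ x.1.2

/-- Contracting `Δ[k]` to its vertex `0` drags a lifting problem into a single fibre. It is solved
there, and the solution is carried back by the homotopy lifting property relative to `∂Δ[k]`. -/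
lemma lifting_boundary_of_const {E B : SSet.{u}} {p : E ⟶ B} [Fibration p] {k : ℕ}
    (h : ∀ (b : B _⦋0⦌) (v : (boundary.{u} k : SSet) ⟶ E),
      v ≫ p = SSet.const b → ∃ l : Δ[k] ⟶ E, (boundary k).ι ≫ l = v ∧ l ≫ p = SSet.const b) :
    HasLiftingProperty (boundary.{u} k).ι p := by
  refine ⟨fun {v w} sq ↦ ?_⟩
  obtain ⟨H, h1, h2⟩ := hlp_abs 1 p v ((boundary k).ι ▷ Δ[1] ≫ contract k ≫ w) (by
    rw [cyl_whiskerRight_assoc, ← Category.assoc (cyl 1), cyl_one_contract, Category.id_comp, sq.w])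
  have e : cyl 0 ≫ contract k ≫ w = SSet.const (w.app _ (stdSimplex.obj₀Equiv.symm 0)) := by
    rw [← Category.assoc, cyl_zero_contract, const_comp]
  obtain ⟨l, hl1, hl2⟩ := h _ (cyl 0 ≫ H) (by
    rw [Category.assoc, h2, cyl_whiskerRight_assoc, e, comp_const])
  obtain ⟨K, k1, k2, k3⟩ := hlp 0 (boundary k).ι p l H (contract k ≫ w) hl1 (by rw [hl2, e]) h2
  exact ⟨⟨⟨cyl 1 ≫ K, by rw [← cyl_whiskerRight_assoc, k2, h1], by
    rw [Category.assoc, k3, ← Category.assoc, cyl_one_contract, Category.id_comp]⟩⟩⟩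

namespace TrivFib

variable {E B : SSet.{u}} {p : E ⟶ B}

lemma htpyRel (hp : TrivFib p) {X : SSet.{u}} (A : X.Subcomplex)
    (f g : X ⟶ E) (w : f ≫ p = g ≫ p) (hA : A.ι ≫ f = A.ι ≫ g) : HtpyRel A p f g :=
  htpyRel_of_lifting A p (hp.lifting _) f g w hA

lemma eqvOver (hp : TrivFib p) {B' : SSet.{u}} (p' : B ⟶ B') : EqvOver (p ≫ p') p' p := by
  obtain ⟨s, hs⟩ := hp.exists_section
  refine ⟨rfl, s, by rw [← Category.assoc, hs, Category.id_comp], ?_, ?_⟩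
  · have := (hp.htpyRel ⊥ (p ≫ s) (𝟙 E) (by rw [Category.assoc, hs, Category.id_comp,
      Category.comp_id]) (Subsingleton.elim _ _)).postcomp (𝟙 E) (p ≫ p') p' (Category.id_comp _)
    simpa only [Category.comp_id] using this
  · rw [hs]
    exact .refl _ _ _

/-- A fibration is trivial if it has the required lifting property for constant maps to the
base. -/
lemma of_const [Fibration p] (h : ∀ (k : ℕ) (b : B _⦋0⦌) (v : (boundary.{u} k : SSet) ⟶ E),
    v ≫ p = SSet.const b → ∃ l : Δ[k] ⟶ E, (boundary k).ι ≫ l = v ∧ l ≫ p = SSet.const b) :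
    TrivFib p :=
  fun k ↦ lifting_boundary_of_const (h k)

end TrivFib

/-- A fibration between Kan complexes which is a homotopy equivalence is a trivial fibration. -/
lemma trivFib_of_isHomotopyEquiv {X Y : SSet.{u}} [KanComplex X] [KanComplex Y] (q : X ⟶ Y)
    [Fibration q] (hq : IsHomotopyEquiv q) : TrivFib q := by
  rw [← eqvOver_terminal_iff] at hq
  obtain ⟨-, g, -, hg1, H, H0, H1, -, -⟩ := hq
  -- Lifting the homotopy from `g ≫ q` to the identity replaces the homotopy inverse `g` by a strict
  -- section `s`.
  obtain ⟨H', H'0, H'q⟩ := hlp_abs 0 q g H H0.symm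
  let s := cyl 1 ≫ H'
  have hs : s ≫ q = 𝟙 Y := by rw [Category.assoc, H'q, H1]
  have hgs : HtpyRel ⊥ (terminal.from X) g s :=
    ⟨H', H'0, rfl, Subsingleton.elim _ _, hom_eq_of_app fun m x ↦ x.1.2.elim⟩
  let θ := q ≫ s
  have hθ : HtpyRel ⊥ (terminal.from X) θ (𝟙 X) :=
    (hgs.symm.precomp q bot_le).trans hg1
  have hθq : θ ≫ q = q := by rw [Category.assoc, hs, Category.comp_id]
  obtain ⟨K, K0, K1, -, -⟩ := hθ
  -- The homotopy `K` from the idempotent `θ` to the identity need not lie over `Y`. Its image in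
  -- `Y` is lifted afresh, starting from the identity, to `N`. Then `K` and `N ≫ θ` have the same
  -- start and the same image, so their ends are homotopic over `Y`; composing with `θ` gives `θ ~
  -- 𝟙` over `Y`.
  obtain ⟨N, N0, Nq⟩ := hlp_abs 0 q (𝟙 X) (K ≫ q) (by rw [reassoc_of% K0, hθq, Category.id_comp])
  have h1 : HtpyRel ⊥ q (𝟙 X) (cyl 1 ≫ N ≫ θ) := by
    have := homotopic_ends ⊥ q 0 1 (fst _ _ ≫ θ) K (N ≫ θ) (by rw [K0]; rfl)
      (by rw [reassoc_of% N0]; rfl) (by rw [reassoc_of% K0, Category.assoc])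
      (by rw [Category.assoc, hθq, Nq]) (hom_eq_of_app fun m x ↦ x.1.2.elim)
      (hom_eq_of_app fun m x ↦ x.1.2.elim)
    rwa [K1] at this
  have h2 : HtpyRel ⊥ q θ (𝟙 X) := by
    have h3 := h1.postcomp θ q (𝟙 Y) (by rw [hθq, Category.comp_id])
    have h4 : θ ≫ θ = θ := by
      change (q ≫ s) ≫ q ≫ s = q ≫ s
      rw [Category.assoc, reassoc_of% hs]
    simp only [Category.assoc, h4, Category.id_comp] at h3
    exact h3.trans h1.symm
  obtain ⟨L, L0, L1, Lq, -⟩ := h2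
  refine fun k ↦ ⟨fun {v w} sq ↦ ?_⟩
  -- The simplex `w ≫ s` lies over `w` but has boundary `v ≫ θ`. The homotopy `L` over `Y` corrects
  -- this boundary to `v`.
  obtain ⟨R, R0, R1, Rq⟩ := hlp 0 (boundary k).ι q (w ≫ s) (v ▷ Δ[1] ≫ L) (fst _ _ ≫ w)
    (by rw [cyl_whiskerRight_assoc, L0, ← sq.w_assoc]) (by
      rw [Category.assoc, hs, Category.comp_id, cyl_fst_assoc]) (by
      rw [Category.assoc, Lq, whiskerRight_fst_assoc, whiskerRight_fst_assoc, hθq, sq.w])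
  exact ⟨⟨⟨cyl 1 ≫ R, by rw [← cyl_whiskerRight_assoc, R1, cyl_whiskerRight_assoc, L1,
    Category.comp_id], by rw [Category.assoc, Rq, cyl_fst_assoc]⟩⟩⟩

/-! ### Anodyne maps between fibrations -/

lemma exists_factorization {X Y : SSet.{u}} (f : X ⟶ Y) :
    ∃ (M : SSet.{u}) (i : X ⟶ M) (q : M ⟶ Y), i ≫ q = f ∧ anodyneExtensions i ∧ Fibration q := by
  let d := MorphismProperty.factorizationData modelCategoryQuillen.J.{u}.rlp.llp
    modelCategoryQuillen.J.{u}.rlp f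
  exact ⟨d.Z, d.i, d.p, d.fac, d.hi, by
    rw [modelCategoryQuillen.fibration_iff]
    exact d.hp⟩

/-- The retraction is a lift of the identity of `E` along `p`. The homotopy exists because the
pushout-product of an anodyne inclusion with `∂Δ[1]` is anodyne. -/
lemma exists_retraction {B E M : SSet.{u}} (p : E ⟶ B) (p' : M ⟶ B) [Fibration p] [Fibration p']
    (i : E ⟶ M) (hi : anodyneExtensions i) (w : i ≫ p' = p) :
    ∃ r : M ⟶ E, i ≫ r = 𝟙 E ∧ r ≫ p = p' ∧ HtpyRel (Subcomplex.range i) p' (r ≫ i) (𝟙 M) := by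
  have := anodyne_of_llp hi p
  have sq : CommSq (𝟙 E) i p p' := ⟨by rw [Category.id_comp, w]⟩
  have h1 := sq.fac_left
  have h2 := sq.fac_right
  refine ⟨sq.lift, h1, h2, ?_⟩
  have : Mono i := mono_of_mono_fac h1
  have hr : anodyneExtensions (Subcomplex.range i).ι := by
    refine (anodyneExtensions.arrow_mk_iso_iff ?_).1 hi
    exact Arrow.isoMk (asIso (Subcomplex.toRange i)) (Iso.refl _) (by simp)
  refine htpyRel_of_lifting _ p' (anodyne_of_llp (anodyneExtensions_unionProd_ι' _ _ hr) p')
    _ _ (by rw [Category.assoc, w, h2, Category.id_comp]) ?_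
  rw [← cancel_epi (Subcomplex.toRange i)]
  simp only [Subcomplex.toRange_ι_assoc, Category.comp_id, Subcomplex.toRange_ι]
  rw [reassoc_of% h1]

lemma eqvOver_of_anodyne {B E M : SSet.{u}} (p : E ⟶ B) (p' : M ⟶ B) [Fibration p] [Fibration p']
    (i : E ⟶ M) (hi : anodyneExtensions i) (w : i ≫ p' = p) : EqvOver p p' i := by
  obtain ⟨r, h1, h2, h3⟩ := exists_retraction p p' i hi w
  exact ⟨w, r, h2, by rw [h1]; exact .refl _ _ _, h3.mono bot_le⟩

end SplitFib

end

noncomputable section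

namespace SplitFib

open HomotopicalAlgebra SSet Limits

/-! ### Fibres -/

namespace Fib

variable {E B T : SSet.{u}} (p : E ⟶ B) (b : B _⦋0⦌)

lemma incl_comp : incl p b ≫ p = SSet.const b := by
  have h : (Subcomplex.ofSimplex b).fromPreimage p ≫ (Subcomplex.ofSimplex b).ι =
    incl p b ≫ p := Subcomplex.fromPreimage_ι _ _
  rw [← h, Subcomplex.ofSimplex_ι, comp_const]

variable {p b} in
lemma range_le {g : T ⟶ E} (h : g ≫ p = SSet.const b) :
    Subcomplex.range g ≤ (Subcomplex.ofSimplex b).preimage p := by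
  rintro m _ ⟨t, rfl⟩
  have := app_eq_of_eq h t
  exact (congrArg (· ∈ (Subcomplex.ofSimplex b).obj m) this).mpr
    ⟨(SimplexCategory.const _ _ 0).op, rfl⟩

variable {p b}

/-- The map to the fibre induced by a map `g` such that `g ≫ p` is constant. -/
def lift (g : T ⟶ E) (h : g ≫ p = SSet.const b) : T ⟶ Fib p b :=
  Subcomplex.lift g (range_le h)

lemma lift_incl (g : T ⟶ E) (h : g ≫ p = SSet.const b) : lift g h ≫ incl p b = g := rfl

lemma lift_incl_assoc (g : T ⟶ E) (h : g ≫ p = SSet.const b) {Z : SSet.{u}} (k : E ⟶ Z) :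
    lift g h ≫ incl p b ≫ k = g ≫ k := rfl

lemma hom_ext {f g : T ⟶ Fib p b} (h : f ≫ incl p b = g ≫ incl p b) : f = g :=
  (cancel_mono (incl p b)).1 h

instance [Fibration p] : KanComplex (Fib p b) := by
  refine (isFibrant_iff _).2 ((modelCategoryQuillen.fibration_iff _).2 ?_)
  intro _ _ i hi
  refine ⟨fun {v w} sq ↦ ?_⟩
  have : HasLiftingProperty i p := (modelCategoryQuillen.fibration_iff p).1 inferInstance _ hi
  have sq' : CommSq (v ≫ incl p b) i p (SSet.const b) :=
    ⟨by rw [Category.assoc, incl_comp, comp_const, comp_const]⟩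
  exact ⟨⟨⟨lift sq'.lift sq'.fac_right, hom_ext (by
    rw [Category.assoc, lift_incl, sq'.fac_left]), Subsingleton.elim _ _⟩⟩⟩

lemma htpyRel {A : T.Subcomplex} {f g : T ⟶ Fib p b}
    (h : HtpyRel A p (f ≫ incl p b) (g ≫ incl p b)) : HtpyRel A (terminal.from (Fib p b)) f g := by
  obtain ⟨H, h0, h1, h2, h3⟩ := h
  refine ⟨lift H (by rw [h2, Category.assoc, incl_comp, comp_const, comp_const]), hom_ext h0,
    hom_ext h1, Subsingleton.elim _ _, hom_ext h3⟩

lemma htpyRel_incl {A : T.Subcomplex} {f g : T ⟶ Fib p b}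
    (h : HtpyRel A (terminal.from (Fib p b)) f g) :
    HtpyRel A p (f ≫ incl p b) (g ≫ incl p b) := by
  obtain ⟨H, h0, h1, -, h3⟩ := h
  refine ⟨H ≫ incl p b, by rw [reassoc_of% h0], by rw [reassoc_of% h1], ?_, ?_⟩
  · simp only [Category.assoc, incl_comp, comp_const]
  · rw [reassoc_of% h3]

end Fib

/-- The map between fibres induced by a map over `B`. -/
def fibMap {B E E' : SSet.{u}} {p : E ⟶ B} {p' : E' ⟶ B} (φ : E ⟶ E') (hφ : φ ≫ p' = p)
    (b : B _⦋0⦌) : Fib p b ⟶ Fib p' b :=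
  Fib.lift (Fib.incl p b ≫ φ) (by rw [Category.assoc, hφ, Fib.incl_comp])

lemma fibMap_incl {B E E' : SSet.{u}} {p : E ⟶ B} {p' : E' ⟶ B} (φ : E ⟶ E')
    (hφ : φ ≫ p' = p) (b : B _⦋0⦌) : fibMap φ hφ b ≫ Fib.incl p' b = Fib.incl p b ≫ φ := rfl

lemma EqvOver.fibMap {B E E' : SSet.{u}} {p : E ⟶ B} {p' : E' ⟶ B} {φ : E ⟶ E'}
    (h : EqvOver p p' φ) (b : B _⦋0⦌) : IsHomotopyEquiv (fibMap φ h.1 b) := by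
  rw [← eqvOver_terminal_iff]
  obtain ⟨h1, ψ, h2, h3, h4⟩ := h
  refine ⟨Subsingleton.elim _ _, SplitFib.fibMap ψ h2 b, Subsingleton.elim _ _,
    Fib.htpyRel (h3.precomp (Fib.incl p b) bot_le), Fib.htpyRel (h4.precomp (Fib.incl p' b) bot_le)⟩

lemma fibration_fibMap {B E E' : SSet.{u}} {p : E ⟶ B} {p' : E' ⟶ B} (q : E ⟶ E')
    [Fibration q] (hq : q ≫ p' = p) (b : B _⦋0⦌) : Fibration (fibMap q hq b) := by
  rw [modelCategoryQuillen.fibration_iff]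
  intro _ _ i hi
  refine ⟨fun {v w} sq ↦ ?_⟩
  have : HasLiftingProperty i q := (modelCategoryQuillen.fibration_iff q).1 inferInstance _ hi
  have sq' : CommSq (v ≫ Fib.incl p b) i q (w ≫ Fib.incl p' b) :=
    ⟨by rw [Category.assoc, ← fibMap_incl q hq, sq.w_assoc]⟩
  exact ⟨⟨⟨Fib.lift sq'.lift (by
    refine (congrArg (sq'.lift ≫ ·) hq).symm.trans ?_
    rw [sq'.fac_right_assoc, Category.assoc, Fib.incl_comp, comp_const]),
    Fib.hom_ext (by rw [Category.assoc, Fib.lift_incl, sq'.fac_left]),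
    Fib.hom_ext (by rw [Category.assoc, fibMap_incl, Fib.lift_incl_assoc, sq'.fac_right])⟩⟩⟩

/-- A fibration between fibrations over `B`, which is a homotopy equivalence on fibres over `B`,
is a trivial fibration. -/
lemma trivFib_of_fibMap {B E E' : SSet.{u}} {p : E ⟶ B} {p' : E' ⟶ B} [Fibration p]
    [Fibration p'] (q : E ⟶ E') [Fibration q] (hq : q ≫ p' = p)
    (h : ∀ b, IsHomotopyEquiv (fibMap q hq b)) : TrivFib q := by
  refine .of_const fun k y v hv ↦ ?_
  have := fibration_fibMap q hq (p'.app _ y)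
  obtain ⟨l, h1, h2⟩ := (trivFib_of_isHomotopyEquiv _ (h (p'.app _ y))).exists_lift (boundary k).ι
    (Fib.lift v (by
      refine (congrArg (v ≫ ·) hq).symm.trans ?_
      rw [reassoc_of% hv, const_comp]))
    (Fib.lift (SSet.const y) (by rw [const_comp])) (Fib.hom_ext hv)
  refine ⟨l ≫ Fib.incl _ _, ?_, ?_⟩
  · rw [← Category.assoc, h1, Fib.lift_incl]
  · rw [Category.assoc, ← fibMap_incl q hq, ← Category.assoc, h2, Fib.lift_incl]

/-- A map between fibrations over `B` which is a homotopy equivalence on fibres is a homotopy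
equivalence over `B`. -/
lemma eqvOver_of_fibMap {B E E' : SSet.{u}} {p : E ⟶ B} {p' : E' ⟶ B} [Fibration p]
    [Fibration p'] (φ : E ⟶ E') (hφ : φ ≫ p' = p)
    (h : ∀ b, IsHomotopyEquiv (fibMap φ hφ b)) : EqvOver p p' φ := by
  -- The anodyne factor is already an equivalence over `B`. By two-out-of-three on fibres the other
  -- factor is a fibration which is an equivalence on fibres, hence a trivial fibration.
  obtain ⟨M, i, q, rfl, hi, hq⟩ := exists_factorization φ
  have hiq := eqvOver_of_anodyne p (q ≫ p') i hi (by rw [← hφ, Category.assoc])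
  refine hiq.comp (TrivFib.eqvOver (trivFib_of_fibMap (p := q ≫ p') (p' := p') q rfl fun b ↦ ?_) p')
  have h1 := hiq.fibMap b
  have h2 := h b
  rw [← eqvOver_terminal_iff] at h1 h2 ⊢
  exact EqvOver.of_comp_left h1 h2 (Subsingleton.elim _ _)

/-! ### Maps which are equivalences onto fibres -/

lemma isEquivOntoFibre_iff {F E B : SSet.{u}} (g : F ⟶ E) (p : E ⟶ B) (b : B _⦋0⦌) :
    IsEquivOntoFibre g p b ↔ ∃ h : g ≫ p = SSet.const b, IsHomotopyEquiv (Fib.lift g h) := by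
  constructor
  · rintro ⟨g', rfl, h⟩
    exact ⟨by rw [Category.assoc, Fib.incl_comp, comp_const], h⟩
  · rintro ⟨h, h'⟩
    exact ⟨_, Fib.lift_incl g h, h'⟩

namespace IsHomotopyEquiv

variable {X Y Z : SSet.{u}} [KanComplex X] [KanComplex Z] {f : X ⟶ Y} {g : Y ⟶ Z}

lemma comp (hf : IsHomotopyEquiv f) (hg : IsHomotopyEquiv g) : IsHomotopyEquiv (f ≫ g) := by
  rw [← eqvOver_terminal_iff] at *
  exact EqvOver.comp hf hg

variable [KanComplex Y]

lemma of_comp_right (hg : IsHomotopyEquiv g) (h : IsHomotopyEquiv (f ≫ g)) :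
    IsHomotopyEquiv f := by
  rw [← eqvOver_terminal_iff] at *
  exact EqvOver.of_comp_right hg h

lemma of_iso {X Y : SSet.{u}} (e : X ≅ Y) : IsHomotopyEquiv e.hom := by
  rw [← eqvOver_terminal_iff]
  refine ⟨Subsingleton.elim _ _, e.inv, Subsingleton.elim _ _, ?_, ?_⟩
  · rw [e.hom_inv_id]; exact .refl _ _ _
  · rw [e.inv_hom_id]; exact .refl _ _ _

end IsHomotopyEquiv

namespace IsEquivOntoFibre

variable {F F' E E' B B' : SSet.{u}} {p : E ⟶ B} {p' : E' ⟶ B'} {b : B _⦋0⦌} {b' : B' _⦋0⦌}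

lemma comp_eq {g : F ⟶ E} (h : IsEquivOntoFibre g p b) : g ≫ p = SSet.const b :=
  ((isEquivOntoFibre_iff _ _ _).1 h).choose

lemma comp_incl [Fibration p] [Fibration p'] [KanComplex F] {g : F ⟶ E}
    (h : IsEquivOntoFibre g p b) {φ : E ⟶ E'}
    (hφ : IsEquivOntoFibre (Fib.incl p b ≫ φ) p' b') : IsEquivOntoFibre (g ≫ φ) p' b' := by
  obtain ⟨g', rfl, h1⟩ := h
  obtain ⟨φ', h2, h3⟩ := hφ
  exact ⟨g' ≫ φ', by rw [Category.assoc, Category.assoc, h2], h1.comp h3⟩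

lemma of_comp_incl [Fibration p] [Fibration p'] [KanComplex F] {g : F ⟶ E}
    (w : g ≫ p = SSet.const b) {φ : E ⟶ E'}
    (hφ : IsEquivOntoFibre (Fib.incl p b ≫ φ) p' b') (h : IsEquivOntoFibre (g ≫ φ) p' b') :
    IsEquivOntoFibre g p b := by
  obtain ⟨φ', h2, h3⟩ := hφ
  obtain ⟨k, h4, h5⟩ := h
  refine ⟨Fib.lift g w, rfl, h3.of_comp_right ?_⟩
  have : Fib.lift g w ≫ φ' = k := Fib.hom_ext (by rw [Category.assoc, h2, h4]; rfl)
  rwa [this]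

lemma precomp [Fibration p] [KanComplex F] [KanComplex F'] {g : F ⟶ E}
    (h : IsEquivOntoFibre g p b) {θ : F' ⟶ F} (hθ : IsHomotopyEquiv θ) :
    IsEquivOntoFibre (θ ≫ g) p b := by
  obtain ⟨g', rfl, h1⟩ := h
  exact ⟨θ ≫ g', by rw [Category.assoc], hθ.comp h1⟩

lemma incl_of_eqvOver {p' : E' ⟶ B} {φ : E ⟶ E'} (h : EqvOver p p' φ) (b : B _⦋0⦌) :
    IsEquivOntoFibre (Fib.incl p b ≫ φ) p' b :=
  ⟨fibMap φ h.1 b, rfl, h.fibMap b⟩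

end IsEquivOntoFibre

lemma eqvOver_of_fibres {B E E' : SSet.{u}} {p : E ⟶ B} {p' : E' ⟶ B} [Fibration p]
    [Fibration p'] (φ : E ⟶ E') (hφ : φ ≫ p' = p)
    (h : ∀ b, IsEquivOntoFibre (Fib.incl p b ≫ φ) p' b) : EqvOver p p' φ := by
  refine eqvOver_of_fibMap φ hφ fun b ↦ ?_
  obtain ⟨g, h1, h2⟩ := h b
  have : fibMap φ hφ b = g := Fib.hom_ext h1.symm
  rwa [this]

/-! ### Transport along edges -/

/-- Lifting the edge backwards, starting from the inclusion of the far fibre, gives a transport map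
`ρ` to the near fibre. Followed by the inverse `r` of the given equivalence it is an inverse at the
far end: both homotopies come from `homotopic_ends`, since lifts of the same edge with homotopic
starts have homotopic ends. -/
lemma isEquivOntoFibre_cyl {F E B : SSet.{u}} [KanComplex F] (p : E ⟶ B) [Fibration p]
    (β : Δ[1] ⟶ B) (H : F ⊗ Δ[1] ⟶ E) (hH : H ≫ p = snd _ _ ≫ β) (ε ε' : Fin 2)
    (h : IsEquivOntoFibre (cyl ε ≫ H) p (β.app _ (stdSimplex.obj₀Equiv.symm ε))) :
    IsEquivOntoFibre (cyl ε' ≫ H) p (β.app _ (stdSimplex.obj₀Equiv.symm ε')) := by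
  have cs : ∀ (δ : Fin 2) (X : SSet.{u}), (cyl δ : X ⟶ _) ≫ snd X Δ[1] ≫ β =
      SSet.const (β.app _ (stdSimplex.obj₀Equiv.symm δ)) := fun δ X ↦ by
    rw [← Category.assoc, lift_snd, const_comp]
  obtain ⟨w0, h⟩ := (isEquivOntoFibre_iff _ _ _).1 h
  rw [← eqvOver_terminal_iff] at h
  obtain ⟨-, r, -, hr1, hr2⟩ := h
  have w1 : (cyl ε' ≫ H) ≫ p = SSet.const (β.app _ (stdSimplex.obj₀Equiv.symm ε')) := by
    rw [Category.assoc, hH, cs]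
  obtain ⟨R, R1, Rp⟩ := hlp_abs ε' p (Fib.incl p (β.app _ (stdSimplex.obj₀Equiv.symm ε')))
    (snd _ _ ≫ β) (by rw [cs, Fib.incl_comp])
  let ρ : Fib p (β.app _ (stdSimplex.obj₀Equiv.symm ε')) ⟶
      Fib p (β.app _ (stdSimplex.obj₀Equiv.symm ε)) :=
    Fib.lift (cyl ε ≫ R) (by rw [Category.assoc, Rp, cs])
  refine (isEquivOntoFibre_iff _ _ _).2 ⟨w1, ?_⟩
  rw [← eqvOver_terminal_iff]
  refine ⟨Subsingleton.elim _ _, ρ ≫ r, Subsingleton.elim _ _, ?_, ?_⟩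
  · have h1 : HtpyRel ⊥ p (Fib.lift (cyl ε' ≫ H) w1 ≫ cyl ε ≫ R) (cyl ε ≫ H) := by
      have := homotopic_ends ⊥ p ε' ε (fst _ _ ≫ cyl ε' ≫ H) (Fib.lift (cyl ε' ≫ H) w1 ▷ Δ[1] ≫ R)
        H (by rw [cyl_whiskerRight_assoc, R1, Fib.lift_incl, cyl_fst_assoc])
        (by rw [cyl_fst_assoc])
        (by
          simp only [Category.assoc]
          rw [cyl_whiskerRight_assoc, reassoc_of% R1, Fib.lift_incl_assoc, Category.assoc])
        (by rw [Category.assoc, Rp, hH, whiskerRight_snd_assoc])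
        (hom_eq_of_app fun m x ↦ x.1.2.elim) (hom_eq_of_app fun m x ↦ x.1.2.elim)
      simp only at this
      rwa [cyl_whiskerRight_assoc] at this
    have h2 := Fib.htpyRel (f := Fib.lift (cyl ε' ≫ H) w1 ≫ ρ) (g := Fib.lift (cyl ε ≫ H) w0) h1
    have h3 := h2.postcomp r (terminal.from _) (𝟙 _) (Subsingleton.elim _ _)
    rw [Category.assoc] at h3
    exact h3.trans hr1
  · refine Fib.htpyRel ?_
    obtain ⟨K, K0, K1, Kp, -⟩ := Fib.htpyRel_incl (hr2.precomp (A' := ⊥) ρ bot_le)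
    have := homotopic_ends ⊥ p ε ε' K (ρ ▷ Δ[1] ≫ r ▷ Δ[1] ≫ H) R
      (by
        rw [cyl_whiskerRight_assoc, cyl_whiskerRight_assoc, K0]
        simp only [Category.assoc, Fib.lift_incl])
      (by rw [K1, Category.comp_id, Fib.lift_incl])
      (by
        simp only [Category.assoc] at Kp ⊢
        rw [Kp, cyl_whiskerRight_assoc, cyl_whiskerRight_assoc]
        simp only [Fib.lift_incl_assoc, Category.assoc])
      (by rw [Category.assoc, Category.assoc, hH, Rp, whiskerRight_snd_assoc,
        whiskerRight_snd_assoc])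
      (hom_eq_of_app fun m x ↦ x.1.2.elim) (hom_eq_of_app fun m x ↦ x.1.2.elim)
    simp only at this
    rw [R1, cyl_whiskerRight_assoc, cyl_whiskerRight_assoc] at this
    rw [Category.assoc, Category.assoc, Fib.lift_incl, Category.id_comp]
    exact this

end SplitFib

end

noncomputable section

namespace SplitFib

open HomotopicalAlgebra SSet Limits

/-! ### Homotopies between simplices with the same boundary -/

lemma mem_boundary_iff {k : ℕ} {n : SimplexCategoryᵒᵖ} (x : (Δ[k] : SSet.{u}).obj n) :
    x ∈ (boundary k).obj n ↔ ∃ j, ∀ i, stdSimplex.asOrderHom x i ≠ j := by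
  obtain ⟨⟨n⟩⟩ := n
  rw [mem_boundary_iff_notMem_range]
  exact exists_congr fun j ↦ by rw [Set.mem_range, not_exists]; rfl

lemma mem_horn_iff' {k : ℕ} {n : SimplexCategoryᵒᵖ} (x : (Δ[k] : SSet.{u}).obj n)
    (l : Fin (k + 1)) :
    x ∈ (horn k l).obj n ↔ ∃ j, j ≠ l ∧ ∀ i, stdSimplex.asOrderHom x i ≠ j := by
  obtain ⟨⟨n⟩⟩ := n
  rw [mem_horn_iff_notMem_range]
  exact exists_congr fun j ↦ by rw [Set.mem_range, not_exists, exists_prop]; rfl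

lemma mem_range_δ_zero_iff {k : ℕ} {n : SimplexCategoryᵒᵖ} (x : (Δ[k + 1] : SSet.{u}).obj n) :
    x ∈ (Subcomplex.range (stdSimplex.{u}.δ (0 : Fin (k + 2)))).obj n ↔
      ∀ i, stdSimplex.asOrderHom x i ≠ 0 := by
  constructor
  · rintro ⟨y, rfl⟩ i
    exact Fin.succ_ne_zero _
  · intro h
    refine ⟨(stdSimplex.σ (0 : Fin (k + 1))).app n x, asOrderHom_ext fun i ↦ ?_⟩
    change Fin.succAbove 0 (Fin.predAbove 0 (stdSimplex.asOrderHom x i)) = _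
    rw [Fin.succAbove_zero, Fin.predAbove_zero_of_ne_zero (h i), Fin.succ_pred]

lemma δσ_of_mem {k : ℕ} {n : SimplexCategoryᵒᵖ} (x : (Δ[k + 1] : SSet.{u}).obj n)
    (h : ∀ i, stdSimplex.asOrderHom x i ≠ 0) :
    (stdSimplex.δ (0 : Fin (k + 2))).app n ((stdSimplex.σ (0 : Fin (k + 1))).app n x) = x := by
  refine asOrderHom_ext fun i ↦ ?_
  change Fin.succAbove 0 (Fin.predAbove 0 (stdSimplex.asOrderHom x i)) = _
  rw [Fin.succAbove_zero, Fin.predAbove_zero_of_ne_zero (h i), Fin.succ_pred]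

lemma δ_zero_σ_zero (k : ℕ) :
    stdSimplex.{u}.δ (0 : Fin (k + 2)) ≫ stdSimplex.σ (0 : Fin (k + 1)) = 𝟙 _ :=
  hom_eq_of_app fun _ _ ↦ asOrderHom_ext fun _ ↦ rfl

lemma σ_mem_boundary {k : ℕ} {n : SimplexCategoryᵒᵖ} (x : (Δ[k + 1] : SSet.{u}).obj n)
    (h0 : ∀ i, stdSimplex.asOrderHom x i ≠ 0) (h : x ∈ (horn (k + 1) 0).obj n) :
    (stdSimplex.σ (0 : Fin (k + 1))).app n x ∈ (boundary k).obj n := by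
  obtain ⟨j, hj, h⟩ := (mem_horn_iff' _ _).1 h
  refine (mem_boundary_iff _).2 ⟨j.pred hj, fun i hi ↦ h i ?_⟩
  change Fin.predAbove 0 (stdSimplex.asOrderHom x i) = _ at hi
  rw [Fin.predAbove_zero_of_ne_zero (h0 i)] at hi
  exact Fin.pred_inj.1 hi

lemma mem_boundary_succ_iff {k : ℕ} {n : SimplexCategoryᵒᵖ} (x : (Δ[k + 1] : SSet.{u}).obj n) :
    x ∈ (boundary (k + 1)).obj n ↔ (∀ i, stdSimplex.asOrderHom x i ≠ 0) ∨
      x ∈ (horn (k + 1) 0).obj n := by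
  rw [mem_boundary_iff, mem_horn_iff']
  constructor
  · rintro ⟨j, hj⟩
    by_cases h : j = 0
    · exact .inl fun i ↦ h ▸ hj i
    · exact .inr ⟨j, h, hj⟩
  · rintro (h | ⟨j, -, h⟩)
    exacts [⟨0, h⟩, ⟨j, h⟩]

/-- A map from `∂Δ[k + 1]` given by a map on the `0`-th horn and a map on the `0`-th face. -/
lemma exists_boundary_hom {k : ℕ} {E : SSet.{u}} (f : (horn.{u} (k + 1) 0 : SSet) ⟶ E)
    (g : Δ[k] ⟶ E)
    (h : ∀ n (x : (Δ[k + 1] : SSet.{u}).obj n) (hx : x ∈ (horn (k + 1) 0).obj n),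
      (∀ i, stdSimplex.asOrderHom x i ≠ 0) →
      f.app n ⟨x, hx⟩ = g.app n ((stdSimplex.σ (0 : Fin (k + 1))).app n x)) :
    ∃ v : (boundary.{u} (k + 1) : SSet) ⟶ E,
      (∀ n (x : (Δ[k + 1] : SSet.{u}).obj n) (hx : x ∈ (horn (k + 1) 0).obj n)
        (hx' : x ∈ (boundary (k + 1)).obj n), v.app n ⟨x, hx'⟩ = f.app n ⟨x, hx⟩) ∧
      (∀ n (x : (Δ[k + 1] : SSet.{u}).obj n) (_ : ∀ i, stdSimplex.asOrderHom x i ≠ 0)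
        (hx' : x ∈ (boundary (k + 1)).obj n), v.app n ⟨x, hx'⟩ =
          g.app n ((stdSimplex.σ (0 : Fin (k + 1))).app n x)) := by
  let S : Bool → (Δ[k + 1] : SSet.{u}).Subcomplex :=
    fun i ↦ match i with
    | false => horn (k + 1) 0
    | true => Subcomplex.range (stdSimplex.δ 0)
  let F : ∀ i, (S i : SSet) ⟶ E := fun i ↦ match i with
    | false => f
    | true => (S true).ι ≫ stdSimplex.σ 0 ≫ g
  obtain ⟨v, hv⟩ := exists_hom_of_pieces S (boundary (k + 1)) (by
    intro n x hx
    rcases (mem_boundary_succ_iff x).1 hx with h1 | h1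
    exacts [⟨true, (mem_range_δ_zero_iff x).2 h1⟩, ⟨false, h1⟩]) F (by
    rintro (_ | _) (_ | _) n x hi hj
    · rfl
    · exact h n x hi ((mem_range_δ_zero_iff x).1 hj)
    · exact (h n x hj ((mem_range_δ_zero_iff x).1 hi)).symm
    · rfl)
  exact ⟨v, fun n x hx hx' ↦ hv false n x hx hx',
    fun n x hx hx' ↦ hv true n x ((mem_range_δ_zero_iff x).2 hx) hx'⟩

/-- The map `Δ[k] ⊗ Δ[1] ⟶ Δ[k + 1]` which sends `(0, 0)` to `0` and `(i, t)` to `i + 1`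
otherwise. -/
def prism (k : ℕ) : (Δ[k] : SSet.{u}) ⊗ Δ[1] ⟶ Δ[k + 1] :=
  ofMonotone ⟨fun x ↦ if x.1 = 0 ∧ x.2 = 0 then 0 else x.1.succ, by
    rintro ⟨a, s⟩ ⟨b, t⟩ ⟨h1, h2⟩
    dsimp at h1 h2 ⊢
    split_ifs with h3 h4 h4
    · exact le_rfl
    · exact Fin.zero_le _
    · exact (h3 ⟨le_antisymm (h4.1 ▸ h1) (Fin.zero_le _),
        le_antisymm (h4.2 ▸ h2) (Fin.zero_le _)⟩).elim
    · exact Fin.succ_le_succ_iff.2 h1⟩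

lemma prism_σ (k : ℕ) : prism.{u} k ≫ stdSimplex.σ 0 = fst _ _ := by
  refine hom_eq_of_app fun n x ↦ asOrderHom_ext fun i ↦ ?_
  change Fin.predAbove 0 (if stdSimplex.asOrderHom x.1 i = 0 ∧ stdSimplex.asOrderHom x.2 i = 0
    then 0 else (stdSimplex.asOrderHom x.1 i).succ) = stdSimplex.asOrderHom x.1 i
  split_ifs with h
  · rw [h.1]; rfl
  · rw [Fin.predAbove_zero_succ]

lemma cyl_zero_prism (k : ℕ) : cyl 0 ≫ prism.{u} k = stdSimplex.δ 1 := by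
  refine hom_eq_of_app fun n x ↦ asOrderHom_ext fun i ↦ ?_
  change (if stdSimplex.asOrderHom x i = 0 ∧ (0 : Fin 2) = 0
    then 0 else (stdSimplex.asOrderHom x i).succ) = Fin.succAbove 1 (stdSimplex.asOrderHom x i)
  generalize stdSimplex.asOrderHom x i = a
  split_ifs with h
  · obtain ⟨rfl, -⟩ := h
    rfl
  · have : a ≠ 0 := by simpa using h
    rw [Fin.succAbove_of_le_castSucc]
    exact Fin.one_le_of_ne_zero (by simpa using this)

lemma cyl_one_prism (k : ℕ) : cyl 1 ≫ prism.{u} k = stdSimplex.δ 0 := by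
  refine hom_eq_of_app fun n x ↦ asOrderHom_ext fun i ↦ ?_
  change (if stdSimplex.asOrderHom x i = 0 ∧ (1 : Fin 2) = 0
    then 0 else (stdSimplex.asOrderHom x i).succ) = Fin.succ (stdSimplex.asOrderHom x i)
  simp

/-- A simplex of dimension `k + 1` whose `0`-th face is `g` and which is otherwise degenerate gives
a homotopy. -/
lemma htpyRel_of_simplex {k : ℕ} {E B : SSet.{u}} {p : E ⟶ B} {f g : Δ[k] ⟶ E}
    (K : Δ[k + 1] ⟶ E) (hKp : K ≫ p = stdSimplex.σ 0 ≫ f ≫ p)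
    (h0 : stdSimplex.δ 0 ≫ K = g) (hA : (boundary k).ι ≫ f = (boundary k).ι ≫ g)
    (h1 : ∀ n (x : (Δ[k + 1] : SSet.{u}).obj n), x ∈ (horn (k + 1) 0).obj n →
      K.app n x = f.app n ((stdSimplex.σ (0 : Fin (k + 1))).app n x)) :
    HtpyRel (boundary k) p f g := by
  have h2 : ∀ n (x : (Δ[k + 1] : SSet.{u}).obj n), (∀ i, stdSimplex.asOrderHom x i ≠ 0) →
      K.app n x = g.app n ((stdSimplex.σ (0 : Fin (k + 1))).app n x) := fun n x hx ↦ by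
    rw [← h0]
    exact congrArg (K.app n) (δσ_of_mem x hx).symm
  refine ⟨prism k ≫ K, ?_, ?_, ?_, ?_⟩
  · refine hom_eq_of_app fun n x ↦ ?_
    refine (app_eq_of_eq (congrArg (· ≫ K) (cyl_zero_prism.{u} k)) x).trans ((h1 n _ ?_).trans ?_)
    · refine (mem_horn_iff' _ _).2 ⟨1, by simp, fun i ↦ Fin.succAbove_ne _ _⟩
    · refine congrArg (f.app n) (app_eq_of_eq (g := 𝟙 _) (f := stdSimplex.δ 1 ≫ stdSimplex.σ 0) ?_ x)
      rw [← cyl_zero_prism, Category.assoc, prism_σ, cyl_fst]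
  · rw [← Category.assoc, cyl_one_prism, h0]
  · rw [Category.assoc, hKp, ← Category.assoc, prism_σ]
  · refine hom_eq_of_app fun n x ↦ ?_
    obtain ⟨j, hj⟩ := (mem_boundary_iff _).1 x.1.2
    have e : f.app n ((stdSimplex.σ (0 : Fin (k + 1))).app n
        ((prism.{u} k).app n (x.1.1, x.2))) = f.app n x.1.1 :=
      congrArg (f.app n) (app_eq_of_eq (prism_σ.{u} k) _)
    have e' : ∀ i, stdSimplex.asOrderHom ((prism.{u} k).app n (x.1.1, x.2)) i =
      if stdSimplex.asOrderHom x.1.1 i = 0 ∧ stdSimplex.asOrderHom x.2 i = 0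
      then 0 else (stdSimplex.asOrderHom x.1.1 i).succ := fun i ↦ rfl
    by_cases h : j = 0
    · subst h
      have e'' : ∀ i, stdSimplex.asOrderHom ((prism.{u} k).app n (x.1.1, x.2)) i ≠ 0 := fun i ↦ by
        rw [e', if_neg fun h ↦ hj i h.1]
        exact Fin.succ_ne_zero _
      refine (h2 n _ e'').trans (Eq.trans ?_ e)
      have : (stdSimplex.σ (0 : Fin (k + 1))).app n ((prism.{u} k).app n (x.1.1, x.2)) = x.1.1 :=
        app_eq_of_eq (prism_σ.{u} k) _
      rw [this]
      exact (app_eq_of_eq hA x.1).symm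
    · refine (h1 n _ ((mem_horn_iff' _ _).2 ⟨j.succ, Fin.succ_ne_zero _, fun i hi ↦ ?_⟩)).trans e
      have h3 := (e' i).symm.trans hi
      split_ifs at h3 with h4
      · exact Fin.succ_ne_zero _ h3.symm
      · exact hj i (Fin.succ_injective _ h3)

/-- Two simplices of dimension `k` with the same boundary and the same projection are homotopic. -/
def UniqueFillers {E B : SSet.{u}} (p : E ⟶ B) (k : ℕ) : Prop :=
  ∀ f g : Δ[k] ⟶ E, f ≫ p = g ≫ p → (boundary k).ι ≫ f = (boundary k).ι ≫ g →
    HtpyRel (boundary k) p f g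

/-- The simplex `g` is placed on the `0`-th face and the degeneracy of `f` on the other faces; a
filler of this boundary, read through `prism`, is the homotopy. -/
lemma UniqueFillers.of_lifting_succ {E B : SSet.{u}} {p : E ⟶ B} {k : ℕ}
    (hp : HasLiftingProperty (boundary.{u} (k + 1)).ι p) : UniqueFillers p k := by
  intro f g w hA
  obtain ⟨v, hv1, hv2⟩ := exists_boundary_hom ((horn (k + 1) 0).ι ≫ stdSimplex.σ 0 ≫ f) g
    (fun n x hx h0 ↦ app_eq_of_eq hA (⟨_, σ_mem_boundary x h0 hx⟩ : (boundary k : SSet).obj n))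
  have sq : CommSq v (boundary.{u} (k + 1)).ι p (stdSimplex.σ 0 ≫ f ≫ p) := ⟨by
    refine hom_eq_of_app fun n x ↦ ?_
    rcases (mem_boundary_succ_iff x.1).1 x.2 with h | h
    · exact (congrArg (p.app n) (hv2 n x.1 h x.2)).trans (app_eq_of_eq w.symm _)
    · exact congrArg (p.app n) (hv1 n x.1 h x.2)⟩
  refine htpyRel_of_simplex sq.lift sq.fac_right ?_ hA fun n x hx ↦ ?_
  · refine hom_eq_of_app fun n x ↦ ?_
    have h0 : ∀ i, stdSimplex.asOrderHom ((stdSimplex.δ (0 : Fin (k + 2))).app n x) i ≠ 0 :=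
      fun i ↦ Fin.succ_ne_zero _
    have h1 := (mem_boundary_succ_iff ((stdSimplex.δ (0 : Fin (k + 2))).app n x)).2 (.inl h0)
    refine (app_eq_of_eq sq.fac_left (⟨_, h1⟩ : (boundary (k + 1) : SSet).obj n)).trans
      ((hv2 n _ h0 h1).trans ?_)
    exact congrArg (g.app n) (app_eq_of_eq (δ_zero_σ_zero.{u} k) x)
  · have h1 := (mem_boundary_succ_iff x).2 (.inr hx)
    exact (app_eq_of_eq sq.fac_left (⟨_, h1⟩ : (boundary (k + 1) : SSet).obj n)).trans
      (hv1 n _ hx h1)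

/-- The `0`-th face of a simplex can be replaced by a homotopic one. -/
lemma exists_simplex_of_htpyRel_face {E B : SSet.{u}} {p : E ⟶ B} [Fibration p] {k : ℕ}
    (l : Δ[k + 1] ⟶ E) (g : Δ[k] ⟶ E) (h : HtpyRel (boundary k) p (stdSimplex.δ 0 ≫ l) g) :
    ∃ l' : Δ[k + 1] ⟶ E, stdSimplex.δ 0 ≫ l' = g ∧
      (horn.{u} (k + 1) 0).ι ≫ l' = (horn (k + 1) 0).ι ≫ l ∧ l' ≫ p = l ≫ p := by
  obtain ⟨K, K0, K1, Kp, KA⟩ := h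
  have := anodyne_of_llp (anodyneExtensions_unionProd_ι (boundary.{u} (k + 1)) _ (anodyne_vtx 0)) p
  let S : Fin 3 → ((Δ[k + 1] : SSet.{u}) ⊗ Δ[1]).Subcomplex :=
    ![(vtx 0).preimage (snd _ _), (horn (k + 1) 0).preimage (fst _ _),
      (Subcomplex.range (stdSimplex.δ 0)).preimage (fst _ _)]
  have c0 : ∀ n (z : ((Δ[k + 1] : SSet.{u}) ⊗ Δ[1] : SSet).obj n), z.2 ∈ (vtx 0).obj n →
      z.1 ∈ (Subcomplex.range (stdSimplex.δ 0)).obj n →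
      l.app n z.1 = K.app n ((stdSimplex.σ (0 : Fin (k + 1))).app n z.1, z.2) := by
    intro n z h1 h2
    rw [mem_range_δ_zero_iff] at h2
    refine Eq.trans ?_ (congrArg (K.app n) (eq_cyl_of_mem_vtx (z :=
      (((stdSimplex.σ (0 : Fin (k + 1))).app n z.1, z.2) : (_ ⊗ Δ[1] : SSet).obj n)) h1)).symm
    refine Eq.trans ?_ (app_eq_of_eq K0 _).symm
    exact congrArg (l.app n) (δσ_of_mem z.1 h2).symm
  have c1 : ∀ n (z : ((Δ[k + 1] : SSet.{u}) ⊗ Δ[1] : SSet).obj n), z.1 ∈ (horn (k + 1) 0).obj n →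
      z.1 ∈ (Subcomplex.range (stdSimplex.δ 0)).obj n →
      l.app n z.1 = K.app n ((stdSimplex.σ (0 : Fin (k + 1))).app n z.1, z.2) := by
    intro n z h1 h2
    rw [mem_range_δ_zero_iff] at h2
    refine Eq.trans ?_ (app_eq_of_eq KA
      ((⟨_, σ_mem_boundary z.1 h2 h1⟩, z.2) : ((boundary k : SSet) ⊗ Δ[1] : SSet).obj n)).symm
    exact congrArg (l.app n) (δσ_of_mem z.1 h2).symm
  obtain ⟨R, Rp, hR⟩ := exists_lift_of_pieces S _ (by
      intro n z
      refine (mem_unionProd _ _ _).trans ((or_congr_right ((mem_boundary_succ_iff z.1).trans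
        (or_congr_left (mem_range_δ_zero_iff z.1).symm))).trans ?_)
      constructor
      · rintro (h | h | h)
        exacts [⟨0, h⟩, ⟨2, h⟩, ⟨1, h⟩]
      · rintro ⟨i, h⟩
        fin_cases i
        exacts [.inl h, .inr (.inr h), .inr (.inl h)]) p this
    ![fst _ _ ≫ l, fst _ _ ≫ l, stdSimplex.σ 0 ▷ Δ[1] ≫ K] (by
      intro i j n z hi hj
      fin_cases i <;> fin_cases j
      exacts [rfl, rfl, c0 n z hi hj, rfl, rfl, c1 n z hi hj, (c0 n z hj hi).symm,
        (c1 n z hj hi).symm, rfl]) (fst _ _ ≫ l ≫ p) (by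
      intro i n z hi
      fin_cases i
      · rfl
      · rfl
      · refine (app_eq_of_eq Kp _).trans ?_
        exact congrArg (fun y ↦ p.app n (l.app n y))
          (δσ_of_mem z.1 ((mem_range_δ_zero_iff _).1 hi)))
  refine ⟨cyl 1 ≫ R, hom_eq_of_app fun n x ↦ ?_, hom_eq_of_app fun n x ↦ hR 1 n _ x.2,
    by rw [Category.assoc, Rp, cyl_fst_assoc]⟩
  have h0 : ∀ i, stdSimplex.asOrderHom ((stdSimplex.δ (0 : Fin (k + 2))).app n x) i ≠ 0 :=
    fun i ↦ Fin.succ_ne_zero _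
  refine (hR 2 n _ ((mem_range_δ_zero_iff _).2 h0)).trans ?_
  refine (app_eq_of_eq K1 _).trans ?_
  exact congrArg (g.app n) (app_eq_of_eq (δ_zero_σ_zero.{u} k) x)

/-- After reduction to a constant base, the `0`-th horn is filled. The missing face of the filler
has the boundary of the prescribed one, hence is homotopic to it, and
`exists_simplex_of_htpyRel_face` exchanges the two. -/
lemma lifting_succ_of_uniqueFillers {E B : SSet.{u}} {p : E ⟶ B} [Fibration p] {k : ℕ}
    (h : ∀ (b : B _⦋0⦌) (f g : Δ[k] ⟶ E), f ≫ p = SSet.const b → g ≫ p = SSet.const b →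
      (boundary k).ι ≫ f = (boundary k).ι ≫ g → HtpyRel (boundary k) p f g) :
    HasLiftingProperty (boundary.{u} (k + 1)).ι p := by
  refine lifting_boundary_of_const fun b v hv ↦ ?_
  have hhb : horn.{u} (k + 1) 0 ≤ boundary (k + 1) := fun n x hx ↦
    (mem_boundary_succ_iff x).2 (.inr hx)
  have := anodyne_of_llp (anodyneExtensions.horn_ι.{u} (n := k + 1) 0) p
  have sq : CommSq (Subcomplex.homOfLE hhb ≫ v) (horn.{u} (k + 1) 0).ι p (SSet.const b) :=
    ⟨by rw [Category.assoc, hv, comp_const, comp_const]⟩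
  obtain ⟨l, hl1, hl2⟩ : ∃ l : Δ[k + 1] ⟶ E, (horn.{u} (k + 1) 0).ι ≫ l =
    Subcomplex.homOfLE hhb ≫ v ∧ l ≫ p = SSet.const b := ⟨sq.lift, sq.fac_left, sq.fac_right⟩
  have h0 : ∀ n (x : (Δ[k] : SSet.{u}).obj n) (i),
    stdSimplex.asOrderHom ((stdSimplex.δ (0 : Fin (k + 2))).app n x) i ≠ 0 :=
      fun n x i ↦ Fin.succ_ne_zero _
  let d : Δ[k] ⟶ (boundary.{u} (k + 1) : SSet) := Subcomplex.lift (stdSimplex.δ 0) (by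
    rintro n _ ⟨x, rfl⟩
    exact (mem_boundary_succ_iff _).2 (.inl (h0 n x)))
  obtain ⟨l', k1, k2, k3⟩ := exists_simplex_of_htpyRel_face l (d ≫ v)
    (h b (stdSimplex.δ 0 ≫ l) (d ≫ v)
    (by rw [Category.assoc, hl2, comp_const]) (by rw [Category.assoc, hv, comp_const]) (by
      refine hom_eq_of_app fun n x ↦ ?_
      obtain ⟨j, hj⟩ := (mem_boundary_iff _).1 x.2
      have hx : (stdSimplex.δ (0 : Fin (k + 2))).app n x.1 ∈ (horn (k + 1) 0).obj n :=
        (mem_horn_iff' _ _).2 ⟨j.succ, Fin.succ_ne_zero _,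
          fun i hi ↦ hj i (Fin.succ_injective _ hi)⟩
      exact app_eq_of_eq hl1 (⟨_, hx⟩ : (horn (k + 1) 0 : SSet).obj n)))
  refine ⟨l', hom_eq_of_app fun n x ↦ ?_, k3.trans hl2⟩
  rcases (mem_boundary_succ_iff x.1).1 x.2 with h1 | h1
  · refine (congrArg (l'.app n) (δσ_of_mem x.1 h1)).symm.trans ?_
    refine (app_eq_of_eq k1 ((stdSimplex.σ (0 : Fin (k + 1))).app n x.1)).trans ?_
    exact congrArg (v.app n) (Subtype.ext (δσ_of_mem x.1 h1))
  · exact app_eq_of_eq (k2.trans hl1) (⟨x.1, h1⟩ : (horn (k + 1) 0 : SSet).obj n)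

lemma UniqueFillers.lifting_succ {E B : SSet.{u}} {p : E ⟶ B} [Fibration p] {k : ℕ}
    (h : UniqueFillers p k) : HasLiftingProperty (boundary.{u} (k + 1)).ι p :=
  lifting_succ_of_uniqueFillers fun _ f g hf hg ↦ h f g (hf.trans hg.symm)

lemma UniqueFillers.of_lifting {E B : SSet.{u}} {p : E ⟶ B} {k : ℕ}
    (h : HasLiftingProperty ((boundary.{u} k).unionProd (boundary.{u} 1)).ι p) :
    UniqueFillers p k :=
  fun f g w hA ↦ htpyRel_of_lifting _ p h f g w hA

/-- Homotopy lifting from the end `0` gives `H`, correct everywhere except on the end `1`. There it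
differs from the prescribed simplex by a homotopy `K` relative to the boundary, and filling an open
box on `H` with wall `K` corrects it. -/
lemma UniqueFillers.lifting {E B : SSet.{u}} {p : E ⟶ B} [Fibration p] {k : ℕ}
    (h : UniqueFillers p k) :
    HasLiftingProperty ((boundary.{u} k).unionProd (boundary.{u} 1)).ι p := by
  refine ⟨fun {v G} sq ↦ ?_⟩
  let U := (boundary.{u} k).unionProd (boundary.{u} 1)
  have mU : ∀ n (z : (Δ[k] ⊗ Δ[1] : SSet.{u}).obj n), z ∈ U.obj n ↔
      z.2 ∈ (boundary 1).obj n ∨ z.1 ∈ (boundary k).obj n := fun n z ↦ mem_unionProd _ _ z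
  have hc : ∀ ε : Fin 2, Subcomplex.range (cyl ε : Δ[k] ⟶ _) ≤ U := by
    rintro ε n _ ⟨x, rfl⟩
    refine (mU n _).2 (.inl ((mem_boundary_one_iff _).2 ?_))
    obtain rfl | rfl : ε = 0 ∨ ε = 1 := by fin_cases ε <;> simp
    exacts [.inl (mem_vtx_of_cyl 0 x), .inr (mem_vtx_of_cyl 1 x)]
  have hA : Subcomplex.range ((boundary.{u} k).ι ▷ Δ[1]) ≤ U := by
    rintro n _ ⟨x, rfl⟩
    exact (mU n _).2 (.inr x.1.2)
  have hv : ∀ n (z : (Δ[k] ⊗ Δ[1] : SSet.{u}).obj n) (hz : z ∈ U.obj n),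
    p.app n (v.app n ⟨z, hz⟩) = G.app n z := fun n z hz ↦ app_eq_of_eq sq.w ⟨z, hz⟩
  obtain ⟨H, H0, H1, Hp⟩ := hlp 0 (boundary k).ι p (Subcomplex.lift (cyl 0) (hc 0) ≫ v)
    (Subcomplex.lift ((boundary.{u} k).ι ▷ Δ[1]) hA ≫ v) G rfl
    (hom_eq_of_app fun n x ↦ hv _ _ _) (hom_eq_of_app fun n x ↦ hv _ _ _)
  obtain ⟨K, K0, K1, Kp, KA⟩ := h (cyl 1 ≫ H) (Subcomplex.lift (cyl 1) (hc 1) ≫ v)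
    (by
      rw [Category.assoc, Hp]
      exact (hom_eq_of_app fun n x ↦ hv _ _ _).symm)
    (by rw [← cyl_whiskerRight_assoc, H1]; rfl)
  have := anodyne_of_llp (anodyneExtensions_unionProd_ι U _ (anodyne_vtx 0)) p
  let S : Fin 4 → ((Δ[k] ⊗ Δ[1]) ⊗ Δ[1] : SSet.{u}).Subcomplex :=
    ![(vtx 0).preimage (snd _ _), (vtx 0).preimage (fst _ _ ≫ snd _ _),
      (vtx 1).preimage (fst _ _ ≫ snd _ _), (boundary k).preimage (fst _ _ ≫ fst _ _)]
  have c02 : ∀ n (z : ((Δ[k] ⊗ Δ[1]) ⊗ Δ[1] : SSet.{u}).obj n), z.2 ∈ (vtx 0).obj n →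
      z.1.2 ∈ (vtx 1).obj n → H.app n z.1 = K.app n (z.1.1, z.2) := fun n z h1 h2 ↦ by
    rw [eq_cyl_of_mem_vtx h2]
    exact (app_eq_of_eq K0 z.1.1).symm.trans (congrArg (K.app n)
      (eq_cyl_of_mem_vtx (z := ((z.1.1, z.2) : (Δ[k] ⊗ Δ[1] : SSet).obj n)) h1).symm)
  have c23 : ∀ n (z : ((Δ[k] ⊗ Δ[1]) ⊗ Δ[1] : SSet.{u}).obj n), z.1.2 ∈ (vtx 1).obj n →
      z.1.1 ∈ (boundary k).obj n → K.app n (z.1.1, z.2) = H.app n z.1 := fun n z h1 h2 ↦ by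
    rw [eq_cyl_of_mem_vtx h1]
    exact app_eq_of_eq KA ((⟨z.1.1, h2⟩, z.2) : ((boundary k : SSet) ⊗ Δ[1] : SSet).obj n)
  have c1 : ∀ n (z : ((Δ[k] ⊗ Δ[1]) ⊗ Δ[1] : SSet.{u}).obj n), z.1.2 ∈ (vtx 0).obj n →
      H.app n z.1 = H.app n ((cyl 0).app n z.1.1) := fun n z h1 ↦
    congrArg (H.app n) (eq_cyl_of_mem_vtx h1)
  obtain ⟨R, Rp, hR⟩ := exists_lift_of_pieces S _ (by
      intro n z
      refine (mem_unionProd _ _ _).trans ((or_congr_right ((mU _ _).trans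
        (or_congr_left (mem_boundary_one_iff _)))).trans ?_)
      constructor
      · rintro (h | (h | h) | h)
        exacts [⟨0, h⟩, ⟨1, h⟩, ⟨2, h⟩, ⟨3, h⟩]
      · rintro ⟨i, h⟩
        fin_cases i
        exacts [.inl h, .inr (.inl (.inl h)), .inr (.inl (.inr h)), .inr (.inr h)]) p this
    ![fst _ _ ≫ H, fst _ _ ≫ fst _ _ ≫ cyl 0 ≫ H, fst _ _ ▷ Δ[1] ≫ K, fst _ _ ≫ H] (by
      intro i j n z hi hj
      fin_cases i <;> fin_cases j
      exacts [rfl, c1 n z hj, c02 n z hi hj, rfl, (c1 n z hi).symm, rfl,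
        (vtx_disjoint _ hi hj).elim, (c1 n z hi).symm, (c02 n z hj hi).symm,
        (vtx_disjoint _ hj hi).elim, rfl, c23 n z hi hj, rfl, c1 n z hj, (c23 n z hj hi).symm,
        rfl]) (fst _ _ ≫ G) (by
      intro i n z hi
      fin_cases i
      · exact app_eq_of_eq Hp _
      · refine (app_eq_of_eq Hp _).trans (congrArg (G.app n) (eq_cyl_of_mem_vtx hi).symm)
      · refine (app_eq_of_eq Kp _).trans ((app_eq_of_eq Hp _).trans
          (congrArg (G.app n) (eq_cyl_of_mem_vtx hi).symm))
      · exact app_eq_of_eq Hp _)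
  refine ⟨⟨⟨cyl 1 ≫ R, hom_eq_of_app fun n x ↦ ?_, by
    rw [Category.assoc, Rp, cyl_fst_assoc]⟩⟩⟩
  obtain ⟨⟨x, t⟩, hx⟩ := x
  rcases (mU _ _).1 hx with h1 | h1
  · rcases (mem_boundary_one_iff _).1 h1 with h1 | h1
    · refine (hR 1 n _ h1).trans ((app_eq_of_eq H0 x).trans (congrArg (v.app n) (Subtype.ext ?_)))
      exact (eq_cyl_of_mem_vtx (z := ((x, t) : (Δ[k] ⊗ Δ[1] : SSet).obj n)) h1).symm
    · refine (hR 2 n _ h1).trans ((app_eq_of_eq K1 x).trans (congrArg (v.app n) (Subtype.ext ?_)))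
      exact (eq_cyl_of_mem_vtx (z := ((x, t) : (Δ[k] ⊗ Δ[1] : SSet).obj n)) h1).symm
  · exact (hR 3 n _ h1).trans
      (app_eq_of_eq H1 ((⟨x, h1⟩, t) : ((boundary k : SSet) ⊗ Δ[1] : SSet).obj n))

/-! ### Homotopy groups -/

/-- Homotopy classes are the quotient by the equivalence relation generated by homotopy. In a Kan
complex homotopy is already an equivalence relation, so equal classes give an actual homotopy. -/
lemma Pi.htpyRel {k : ℕ} {X : SSet.{u}} [KanComplex X] {x : X _⦋0⦌} {f g : X.PtSimplex k x}
    (h : f.homotopyClass = g.homotopyClass) :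
    HtpyRel (boundary k) (terminal.from X) f.map g.map := by
  have h1 := Quot.eq.1 h
  clear h
  induction h1 with
  | rel f g h =>
    obtain ⟨h⟩ := h
    exact ⟨h.h, h.h₀, h.h₁, Subsingleton.elim _ _, h.rel.trans (by rw [f.comm])⟩
  | refl f => exact .refl _ _ _
  | symm f g _ h => exact h.symm
  | trans f g h _ _ h1 h2 => exact h1.trans h2

lemma Pi.eq_of_htpyRel {k : ℕ} {X : SSet.{u}} {x : X _⦋0⦌} {f g : X.PtSimplex k x}
    (h : HtpyRel (boundary k) (terminal.from X) f.map g.map) :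
    f.homotopyClass = g.homotopyClass := by
  obtain ⟨H, h0, h1, -, h2⟩ := h
  exact Quot.sound ⟨⟨H, h0, h1, h2.trans (by rw [f.comm])⟩⟩

/-- A pointed simplex as a map which is constant on the boundary. -/
def ptSimplex {k : ℕ} {X : SSet.{u}} {x : X _⦋0⦌} (f : Δ[k] ⟶ X)
    (hf : (boundary k).ι ≫ f = SSet.const x) : X.PtSimplex k x where
  map := f
  comm := by rw [hf, Subcomplex.ofSimplex_ι, comp_const]

lemma PtSimplex.comm' {k : ℕ} {X : SSet.{u}} {x : X _⦋0⦌} (f : X.PtSimplex k x) :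
    (boundary k).ι ≫ f.map = SSet.const x := by
  rw [f.comm, Subcomplex.ofSimplex_ι, comp_const]

lemma pi_trivial_iff {k : ℕ} {X : SSet.{u}} [KanComplex X] {x : X _⦋0⦌} :
    (∀ a : Pi k X x, a = Pi.base k X x) ↔
      ∀ f : Δ[k] ⟶ X, (boundary k).ι ≫ f = SSet.const x →
        HtpyRel (boundary k) (terminal.from X) f (SSet.const x) := by
  constructor
  · intro h f hf
    exact Pi.htpyRel (h (ptSimplex f hf).homotopyClass)
  · intro h a
    obtain ⟨f, rfl⟩ := a.eq_homotopyClass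
    exact Pi.eq_of_htpyRel (h f.map (PtSimplex.comm' f))

/-- Both simplices are deformed by the same homotopy on the boundary, namely the contraction of `f`.
This makes `f` constant and turns `g` into a spherical simplex, which is null by hypothesis;
`homotopic_ends` then compares the other ends of the two deformations, which are `g` and `f`. -/
lemma uniqueFillers_of_pi_trivial {k : ℕ} {X : SSet.{u}} [KanComplex X]
    (h : ∀ (x : X _⦋0⦌) (a : Pi (k + 1) X x), a = Pi.base (k + 1) X x) :
    UniqueFillers (terminal.from X) (k + 1) := by
  intro f g _ hA
  obtain ⟨K, K0, K1, -⟩ := hlp 1 (boundary (k + 1)).ι (terminal.from X) g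
    ((boundary (k + 1)).ι ▷ Δ[1] ≫ contract (k + 1) ≫ f) (terminal.from _)
    (by rw [cyl_whiskerRight_assoc, ← Category.assoc (cyl 1), cyl_one_contract, Category.id_comp,
      hA]) (Subsingleton.elim _ _) (Subsingleton.elim _ _)
  have e : cyl 0 ≫ contract (k + 1) ≫ f = SSet.const (f.app _ (stdSimplex.obj₀Equiv.symm 0)) := by
    rw [← Category.assoc, cyl_zero_contract, const_comp]
  have hb : (boundary (k + 1)).ι ≫ cyl 0 ≫ K =
      SSet.const (f.app _ (stdSimplex.obj₀Equiv.symm 0)) := by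
    rw [← cyl_whiskerRight_assoc, K1, cyl_whiskerRight_assoc, e, comp_const]
  obtain ⟨u, u0, u1, -, u3⟩ := pi_trivial_iff.1 (h _) _ hb
  have := homotopic_ends (boundary (k + 1)) (terminal.from X) 0 1 u K (contract (k + 1) ≫ f)
    u0.symm (by rw [u1, e]) (Subsingleton.elim _ _) (Subsingleton.elim _ _) u3 K1
  rw [K0, ← Category.assoc, cyl_one_contract, Category.id_comp] at this
  exact this.symm

lemma lifting_of_isHomotopyEquiv {k : ℕ} {X Y : SSet.{u}} [KanComplex X] [KanComplex Y] (g : X ⟶ Y)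
    (hg : IsHomotopyEquiv g) (h : HasLiftingProperty (boundary.{u} k).ι (terminal.from X)) :
    HasLiftingProperty (boundary.{u} k).ι (terminal.from Y) := by
  rw [← eqvOver_terminal_iff] at hg
  obtain ⟨-, ψ, -, -, H, H0, H1, -, -⟩ := hg
  refine ⟨fun {v w} sq ↦ ?_⟩
  have sq' : CommSq (v ≫ ψ) (boundary.{u} k).ι (terminal.from X) (terminal.from _) :=
    ⟨Subsingleton.elim _ _⟩
  obtain ⟨K, K0, K1, -⟩ := hlp 0 (boundary k).ι (terminal.from Y) (sq'.lift ≫ g)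
    (v ▷ Δ[1] ≫ H) (terminal.from _) (by
      rw [sq'.fac_left_assoc, cyl_whiskerRight_assoc, H0, Category.assoc])
      (Subsingleton.elim _ _) (Subsingleton.elim _ _)
  exact ⟨⟨⟨cyl 1 ≫ K, by rw [← cyl_whiskerRight_assoc, K1, cyl_whiskerRight_assoc, H1,
    Category.comp_id], Subsingleton.elim _ _⟩⟩⟩

end SplitFib

end

noncomputable section

namespace SplitFib

open HomotopicalAlgebra SSet Limits

/-! ### Pullback powers -/

/-- The map `p'` is the pullback-hom of `J.ι` and `p`. By adjunction it trades a pushout-product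
with `J` for a change of fibration, which is what the induction in `lifting_unionProd_ofSimplex`
uses. -/
lemma exists_pullback_power {D : SSet.{u}} (J : D.Subcomplex) {E B : SSet.{u}} (p : E ⟶ B)
    [Fibration p] : ∃ (E' B' : SSet.{u}) (p' : E' ⟶ B'), Fibration p' ∧
      ∀ {X : SSet.{u}} (K : X.Subcomplex),
        HasLiftingProperty K.ι p' ↔ HasLiftingProperty (J.unionProd K).ι p := by
  let sq := Functor.PullbackObjObj.ofHasPullback MonoidalClosed.internalHom J.ι p
  exact ⟨_, _, sq.π, fibration_pullbackObjObjπ sq, fun K ↦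
    (MonoidalClosed.internalHomAdjunction₂.hasLiftingProperty_iff
      (Subcomplex.unionProd.pushoutObjObj J K) sq).symm⟩

lemma lifting_of_iso {X Y : SSet.{u}} (e : X ≅ Y) {S : X.Subcomplex} {T : Y.Subcomplex}
    (h : ∀ n (x : X.obj n), x ∈ S.obj n ↔ e.hom.app n x ∈ T.obj n) {E B : SSet.{u}} {p : E ⟶ B}
    (hS : HasLiftingProperty S.ι p) : HasLiftingProperty T.ι p := by
  refine ⟨fun {v w} sq ↦ ?_⟩
  let θ : (S : SSet) ⟶ T := Subcomplex.lift (S.ι ≫ e.hom) (by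
    rintro n _ ⟨x, rfl⟩
    exact (h n x.1).1 x.2)
  have hv : ∀ n (y : Y.obj n) (hy : y ∈ T.obj n), p.app n (v.app n ⟨y, hy⟩) = w.app n y :=
    fun n y hy ↦ app_eq_of_eq sq.w ⟨y, hy⟩
  have sq' : CommSq (θ ≫ v) S.ι p (e.hom ≫ w) := ⟨hom_eq_of_app fun n x ↦ hv n _ _⟩
  refine ⟨⟨⟨e.inv ≫ sq'.lift, hom_eq_of_app fun n y ↦ ?_, by
    rw [Category.assoc, sq'.fac_right, e.inv_hom_id_assoc]⟩⟩⟩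
  have e1 : e.hom.app n (e.inv.app n y.1) = y.1 := app_eq_of_eq e.inv_hom_id y.1
  have e2 : e.inv.app n y.1 ∈ S.obj n := (h n _).2 (by rw [e1]; exact y.2)
  refine (app_eq_of_eq sq'.fac_left ⟨_, e2⟩).trans (congrArg (v.app n) (Subtype.ext e1))

lemma lifting_unionProd_comm {X Y : SSet.{u}} {S : X.Subcomplex} {T : Y.Subcomplex}
    {E B : SSet.{u}} {p : E ⟶ B} (h : HasLiftingProperty (S.unionProd T).ι p) :
    HasLiftingProperty (T.unionProd S).ι p :=
  lifting_of_iso (β_ X Y) (fun _ x ↦ (mem_unionProd S T x).trans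
    (or_comm.trans (mem_unionProd T S (x.2, x.1)).symm)) h

lemma lifting_unionProd_reverse {X Y Z : SSet.{u}} {S : X.Subcomplex} {T : Y.Subcomplex}
    {U : Z.Subcomplex} {E B : SSet.{u}} {p : E ⟶ B}
    (h : HasLiftingProperty (S.unionProd (T.unionProd U)).ι p) :
    HasLiftingProperty (U.unionProd (T.unionProd S)).ι p := by
  let r : ∀ A B C : SSet.{u}, A ⊗ (B ⊗ C) ⟶ C ⊗ (B ⊗ A) := fun A B C ↦
    lift (snd A (B ⊗ C) ≫ snd B C) (lift (snd A (B ⊗ C) ≫ fst B C) (fst A (B ⊗ C)))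
  refine lifting_of_iso ⟨r X Y Z, r Z Y X, rfl, rfl⟩ (fun n x ↦ ?_) h
  have h1 := (mem_unionProd S (T.unionProd U) x).trans (or_congr_left (mem_unionProd T U x.2))
  have h2 := (mem_unionProd U (T.unionProd S) (x.2.2, (x.2.1, x.1))).trans
    (or_congr_left (mem_unionProd T S (x.2.1, x.1)))
  refine h1.trans (Iff.trans ?_ h2.symm)
  dsimp only
  tauto

lemma fibration_of_isPullback {X Y Z W : SSet.{u}} {f : X ⟶ Y} {g : X ⟶ Z} {p : Y ⟶ W} {h : Z ⟶ W}
    (sq : IsPullback f g p h) [Fibration p] : Fibration g := by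
  rw [modelCategoryQuillen.fibration_iff]
  intro _ _ i hi
  have : HasLiftingProperty i p := (modelCategoryQuillen.fibration_iff p).1 inferInstance _ hi
  exact sq.hasLiftingProperty _

/-! ### Connected spaces -/

/-- A property of vertices which is invariant along edges. -/
lemma forall_vertex_of_isConnected {X : SSet.{u}} (hX : X.IsConnected) {Q : X _⦋0⦌ → Prop}
    (h : ∀ (γ : Δ[1] ⟶ X) (ε ε' : Fin 2), Q (γ.app _ (stdSimplex.obj₀Equiv.symm ε)) →
      Q (γ.app _ (stdSimplex.obj₀Equiv.symm ε'))) {x : X _⦋0⦌} (hx : Q x) (y : X _⦋0⦌) : Q y := by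
  have hxy : Relation.EqvGen π₀Rel x y := (π₀.mk_eq_mk_iff _ _).1 (Subsingleton.elim _ _)
  refine Iff.mp ?_ hx
  clear hx
  induction hxy with
  | refl => rfl
  | symm _ _ _ h => exact h.symm
  | trans _ _ _ _ _ h h' => exact h.trans h'
  | rel x x' hx =>
    obtain ⟨e⟩ := hx
    have h0 : (yonedaEquiv.symm e.edge).app _ (stdSimplex.obj₀Equiv.symm (0 : Fin 2)) = x := by
      have h := stdSimplex.δ_comp_yonedaEquiv_symm e.edge 1
      rw [stdSimplex.δ_one_eq_const, const_comp, e.src_eq, yonedaEquiv_symm_zero] at h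
      simpa only [yonedaEquiv_const] using congrArg yonedaEquiv h
    have h1 : (yonedaEquiv.symm e.edge).app _ (stdSimplex.obj₀Equiv.symm (1 : Fin 2)) = x' := by
      have h := stdSimplex.δ_comp_yonedaEquiv_symm e.edge 0
      rw [stdSimplex.δ_zero_eq_const, const_comp, e.tgt_eq, yonedaEquiv_symm_zero] at h
      simpa only [yonedaEquiv_const] using congrArg yonedaEquiv h
    exact ⟨fun hq ↦ h1 ▸ h (yonedaEquiv.symm e.edge) 0 1 (h0.symm ▸ hq),
      fun hq ↦ h0 ▸ h (yonedaEquiv.symm e.edge) 1 0 (h1.symm ▸ hq)⟩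

lemma exists_lift_edge (ε ε' : Fin 2) {E B : SSet.{u}} (p : E ⟶ B) [Fibration p] (γ : Δ[1] ⟶ B)
    (y : E _⦋0⦌) (hy : p.app _ y = γ.app _ (stdSimplex.obj₀Equiv.symm ε)) :
    ∃ y' : E _⦋0⦌, p.app _ y' = γ.app _ (stdSimplex.obj₀Equiv.symm ε') := by
  have := anodyne_of_llp (anodyne_vtx ε) p
  have sq : CommSq (SSet.const y) (vtx ε).ι p γ := ⟨by
    rw [const_comp, hy, Subcomplex.ofSimplex_ι, const_comp]⟩
  exact ⟨sq.lift.app _ (stdSimplex.obj₀Equiv.symm ε'), app_eq_of_eq sq.fac_right _⟩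

lemma exists_lift_vertex {E B : SSet.{u}} (p : E ⟶ B) [Fibration p] (hB : B.IsConnected)
    (y : E _⦋0⦌) (x : B _⦋0⦌) : ∃ y', p.app _ y' = x := by
  refine forall_vertex_of_isConnected hB (Q := fun x ↦ ∃ y', p.app _ y' = x) (fun γ ε ε' h ↦ ?_)
    ⟨y, rfl⟩ x
  obtain ⟨y, hy⟩ := h
  exact exists_lift_edge ε ε' p γ y hy

/-! ### Lifting for maps to truncated fibrations -/

/-- The lifting problem amounts to a section, prescribed at `e`, of the base change of `p` to `F`.
That base change lifts against `∂Δ[m]` for `m ≥ 1`; its fibre over `e` is nonempty and `F` is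
connected, so vertices lift as well and it is a trivial fibration. -/
lemma lifting_ofSimplex {F : SSet.{u}} (hF : F.IsConnected) (e : F _⦋0⦌) {E B : SSet.{u}}
    (p : E ⟶ B) [Fibration p] (hp : ∀ m, 1 ≤ m → HasLiftingProperty (boundary.{u} m).ι p) :
    HasLiftingProperty (Subcomplex.ofSimplex e).ι p := by
  refine ⟨fun {v w} sq ↦ ?_⟩
  have pb := IsPullback.of_hasPullback p w
  have := fibration_of_isPullback pb
  have ht : TrivFib (pullback.snd p w) := by
    intro k
    by_cases hk : 1 ≤ k
    · have := hp k hk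
      exact pb.hasLiftingProperty _
    · obtain rfl : k = 0 := by omega
      refine lifting_boundary_of_const fun x v' _ ↦ ?_
      obtain ⟨y, rfl⟩ := exists_lift_vertex (pullback.snd p w) hF
        ((pullback.lift v (Subcomplex.ofSimplex e).ι sq.w).app _
          ⟨e, Subcomplex.mem_ofSimplex_obj _⟩) x
      exact ⟨SSet.const y, boundary.hom_ext₀, by rw [const_comp]⟩
  obtain ⟨l, h1, h2⟩ := ht.exists_lift (Subcomplex.ofSimplex e).ι
    (pullback.lift v (Subcomplex.ofSimplex e).ι sq.w) (𝟙 F)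
    ((pullback.lift_snd _ _ _).trans (Category.comp_id _).symm)
  refine ⟨⟨⟨l ≫ pullback.fst p w, ?_, ?_⟩⟩⟩
  · rw [reassoc_of% h1, pullback.lift_fst]
  · rw [Category.assoc, pullback.condition, reassoc_of% h2]

/-- This is the gain of one degree for pointed maps out of a connected complex. In the induction,
the pullback power of `p` by `∂Δ[1]` lowers `N` by one, while `UniqueFillers` exchanges `∂Δ[k + 1]`
for the pushout-product of `∂Δ[k]` and `∂Δ[1]`. The powers by `∂Δ[1]` and by `e` pass these factors
between the complex and the fibration. The bottom case is `lifting_ofSimplex`, where connectedness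
enters. -/
lemma lifting_unionProd_ofSimplex {F : SSet.{u}} (hF : F.IsConnected) (e : F _⦋0⦌) (N : ℕ) :
    ∀ {E B : SSet.{u}} (p : E ⟶ B) [Fibration p]
      (_ : ∀ m, N ≤ m → HasLiftingProperty (boundary.{u} m).ι p) (k : ℕ), N ≤ k + 1 →
      HasLiftingProperty ((boundary.{u} k).unionProd (Subcomplex.ofSimplex e)).ι p := by
  induction N with
  | zero =>
    intro E B p _ hp k _
    exact TrivFib.lifting (fun m ↦ hp m (Nat.zero_le m)) _
  | succ N ih =>
    intro E B p _ hp k hk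
    rcases k with _ | k
    · have := lifting_ofSimplex hF e p (fun m hm ↦ hp m (by omega))
      refine lifting_of_iso (S := Subcomplex.ofSimplex e)
        ⟨lift (SSet.const (stdSimplex.obj₀Equiv.symm (0 : Fin 1))) (𝟙 F), snd Δ[0] F, rfl,
          hom_eq_of_app fun n x ↦ Prod.ext (asOrderHom_ext fun _ ↦ Subsingleton.elim (α := Fin 1) _ _)
            rfl⟩ (fun n x ↦ ?_) this
      refine Iff.trans ?_ (mem_unionProd _ _ _).symm
      refine ⟨.inl, Or.rec id fun h ↦ ?_⟩
      rw [boundary_zero] at h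
      exact h.elim
    · obtain ⟨E₁, B₁, p₁, _, hp₁⟩ := exists_pullback_power (boundary.{u} 1) p
      obtain ⟨E₂, B₂, p₂, _, hp₂⟩ := exists_pullback_power (Subcomplex.ofSimplex e) p
      have h1 : ∀ m, N ≤ m → HasLiftingProperty (boundary.{u} m).ι p₁ := fun m hm ↦ by
        rw [hp₁]
        exact lifting_unionProd_comm
          (UniqueFillers.of_lifting_succ (hp (m + 1) (by omega))).lifting
      have h2 := (hp₁ _).1 (ih p₁ h1 k (by omega))
      have h3 : HasLiftingProperty ((boundary.{u} k).unionProd (boundary.{u} 1)).ι p₂ := by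
        rw [hp₂]
        exact lifting_unionProd_reverse h2
      exact lifting_unionProd_comm ((hp₂ _).1 (UniqueFillers.of_lifting h3).lifting_succ)

end SplitFib

end

noncomputable section

namespace SplitFib

open HomotopicalAlgebra SSet Limits

/-! ### Function complexes -/

/-- The function complex: its `k`-simplices are the maps `Δ[k] ⊗ F ⟶ E`. -/
def mapc (F E : SSet.{u}) : SSet.{u} where
  obj k := SSet.stdSimplex.obj k.unop ⊗ F ⟶ E
  map θ := TypeCat.ofHom fun α ↦ SSet.stdSimplex.map θ.unop ▷ F ≫ α
  map_id k := by
    ext α : 3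
    have h := SSet.stdSimplex.{u}.map_id k.unop
    change SSet.stdSimplex.map (𝟙 k.unop) ▷ F ≫ α = α
    rw [h, id_whiskerRight, Category.id_comp]
  map_comp θ η := by
    ext α : 3
    have h := SSet.stdSimplex.{u}.map_comp η.unop θ.unop
    change SSet.stdSimplex.map (η.unop ≫ θ.unop) ▷ F ≫ α =
      SSet.stdSimplex.map η.unop ▷ F ≫ SSet.stdSimplex.map θ.unop ▷ F ≫ α
    rw [h, comp_whiskerRight, Category.assoc]

namespace mapc

variable {K L F E : SSet.{u}}

/-- The tautological simplex of `Δ[m]`. -/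
abbrev idSimplex (m : SimplexCategoryᵒᵖ) : (SSet.stdSimplex.{u}.obj m.unop).obj m :=
  stdSimplex.objEquiv.symm (𝟙 m.unop)

/-- A simplex of a function complex, as a map. -/
def simplex (φ : K ⟶ mapc F E) {m : SimplexCategoryᵒᵖ} (x : K.obj m) :
    SSet.stdSimplex.obj m.unop ⊗ F ⟶ E := φ.app m x

lemma simplex_map (φ : K ⟶ mapc F E) {m m' : SimplexCategoryᵒᵖ} (θ : m ⟶ m') (x : K.obj m) :
    simplex φ (K.map θ x) = SSet.stdSimplex.map θ.unop ▷ F ≫ simplex φ x :=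
  NatTrans.naturality_apply φ θ x

/-- The map `K ⊗ F ⟶ E` corresponding to `K ⟶ mapc F E`. -/
def flat (φ : K ⟶ mapc F E) : K ⊗ F ⟶ E where
  app m := ↾fun z ↦ (simplex φ z.1).app m
    ((idSimplex m, z.2) : (SSet.stdSimplex.obj m.unop ⊗ F : SSet).obj m)
  naturality m m' θ := by
    ext z
    have h2 := NatTrans.naturality_apply (simplex φ z.1) θ
      ((idSimplex m, z.2) : (SSet.stdSimplex.obj m.unop ⊗ F : SSet).obj m)
    refine Eq.trans ?_ h2
    refine (app_eq_of_eq (simplex_map φ θ z.1) _).trans ?_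
    refine congrArg ((simplex φ z.1).app m') (Prod.ext ?_ rfl)
    change stdSimplex.objEquiv.symm (𝟙 m'.unop ≫ θ.unop) =
      stdSimplex.objEquiv.symm (θ.unop ≫ 𝟙 m.unop)
    rw [Category.id_comp, Category.comp_id]

/-- The map `K ⟶ mapc F E` corresponding to `K ⊗ F ⟶ E`. -/
def sharp (α : K ⊗ F ⟶ E) : K ⟶ mapc F E where
  app m := ↾fun x ↦ (yonedaEquiv.symm x ▷ F ≫ α : SSet.stdSimplex.obj m.unop ⊗ F ⟶ E)
  naturality m m' θ := by
    ext x
    change yonedaEquiv.symm (K.map θ x) ▷ F ≫ α =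
      SSet.stdSimplex.map θ.unop ▷ F ≫ yonedaEquiv.symm x ▷ F ≫ α
    have h := yonedaEquiv_symm_naturality_left θ.unop x
    rw [← Category.assoc, ← comp_whiskerRight, h]
    rfl

lemma flat_sharp (α : K ⊗ F ⟶ E) : flat (sharp α) = α := by
  refine hom_eq_of_app fun m z ↦ ?_
  refine congrArg (α.app m) (Prod.ext ?_ rfl)
  exact Functor.map_id_apply K _ z.1

lemma app_eq (φ : K ⟶ mapc F E) {m : SimplexCategoryᵒᵖ} (x : K.obj m) :
    φ.app m x = (yonedaEquiv.symm x ▷ F ≫ flat φ : SSet.stdSimplex.obj m.unop ⊗ F ⟶ E) := by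
  change simplex φ x = _
  refine hom_eq_of_app fun n z ↦ ?_
  refine Eq.symm ((app_eq_of_eq (simplex_map φ (stdSimplex.objEquiv z.1).op x) _).trans ?_)
  refine congrArg ((simplex φ x).app n) (Prod.ext ?_ rfl)
  change stdSimplex.objEquiv.symm (𝟙 n.unop ≫ stdSimplex.objEquiv z.1) = z.1
  rw [Category.id_comp, Equiv.symm_apply_apply]

lemma sharp_flat (φ : K ⟶ mapc F E) : sharp (flat φ) = φ :=
  hom_eq_of_app fun _ x ↦ (app_eq φ x).symm

lemma hom_ext {φ ψ : K ⟶ mapc F E} (h : flat φ = flat ψ) : φ = ψ := by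
  rw [← sharp_flat φ, h, sharp_flat]

lemma flat_comp (θ : L ⟶ K) (φ : K ⟶ mapc F E) : flat (θ ≫ φ) = θ ▷ F ≫ flat φ := rfl

lemma comp_sharp (θ : L ⟶ K) (α : K ⊗ F ⟶ E) : θ ≫ sharp α = sharp (θ ▷ F ≫ α) :=
  hom_ext (by rw [flat_comp, flat_sharp, flat_sharp])

/-- The evaluation at a vertex of the interval of paths. -/
def ev (E : SSet.{u}) (ε : Fin 2) : mapc Δ[1] E ⟶ E := cyl ε ≫ flat (𝟙 _)

lemma comp_ev (φ : K ⟶ mapc Δ[1] E) (ε : Fin 2) : φ ≫ ev E ε = cyl ε ≫ flat φ := by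
  rw [ev, ← cyl_whiskerRight_assoc, ← flat_comp, Category.comp_id]

end mapc

end SplitFib

end

/-! ### Vanishing homotopy groups and homotopies with prescribed boundary. -/

noncomputable section

namespace SplitFib

open HomotopicalAlgebra SSet Limits

lemma uniqueFillers_of_pi {k : ℕ} {X : SSet.{u}} [KanComplex X]
    (h : ∀ (x : X _⦋0⦌) (a : Pi k X x), a = Pi.base k X x) :
    UniqueFillers (terminal.from X) k := by
  rcases k with _ | k
  · intro f g _ _
    have h1 := fun x ↦ pi_trivial_iff.1 (h x)
    have hx : ∀ x, Nonempty (X _⦋0⦌) → HtpyRel (boundary 0) (terminal.from X) f (SSet.const x) :=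
      fun x _ ↦ h1 x f boundary.hom_ext₀
    have hx' : ∀ x, Nonempty (X _⦋0⦌) → HtpyRel (boundary 0) (terminal.from X) g (SSet.const x) :=
      fun x _ ↦ h1 x g boundary.hom_ext₀
    have x : X _⦋0⦌ := f.app _ (stdSimplex.obj₀Equiv.symm 0)
    exact (hx x ⟨x⟩).trans (hx' x ⟨x⟩).symm
  · exact uniqueFillers_of_pi_trivial h

/-- Homotopies between two given simplices which are prescribed on the boundary. -/
lemma UniqueFillers.exists_homotopy {k : ℕ} {X : SSet.{u}} [KanComplex X]
    (h : UniqueFillers (terminal.from X) k) (f₀ f₁ : Δ[k] ⟶ X)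
    (γ : (boundary.{u} k : SSet) ⊗ Δ[1] ⟶ X) (h₀ : (boundary k).ι ≫ f₀ = cyl 0 ≫ γ)
    (h₁ : (boundary k).ι ≫ f₁ = cyl 1 ≫ γ) :
    ∃ H : Δ[k] ⊗ Δ[1] ⟶ X, cyl 0 ≫ H = f₀ ∧ cyl 1 ≫ H = f₁ ∧ (boundary k).ι ▷ Δ[1] ≫ H = γ := by
  obtain ⟨H, H0, H1, -⟩ := hlp 0 (boundary k).ι (terminal.from X) f₀ γ (terminal.from _) h₀
    (Subsingleton.elim _ _) (Subsingleton.elim _ _)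
  have c0 : ∀ n (z : (Δ[k] ⊗ Δ[1] : SSet.{u}).obj n), z.2 ∈ (vtx 1).obj n →
      z.1 ∈ (boundary k).obj n → f₁.app n z.1 = H.app n z := fun n z h2 h3 ↦ by
    rw [eq_cyl_of_mem_vtx h2]
    refine (app_eq_of_eq h₁ (⟨z.1, h3⟩ : (boundary k : SSet).obj n)).trans ?_
    exact (app_eq_of_eq H1 _).symm
  obtain ⟨K, -, hK⟩ := exists_lift_of_pieces
    ![(vtx 0).preimage (snd _ _), (vtx 1).preimage (snd _ _), (boundary k).preimage (fst _ _)] _ (by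
      intro n z
      refine (mem_unionProd _ _ _).trans ((or_congr_left (mem_boundary_one_iff _)).trans ?_)
      constructor
      · rintro ((h | h) | h)
        exacts [⟨0, h⟩, ⟨1, h⟩, ⟨2, h⟩]
      · rintro ⟨i, h⟩
        fin_cases i
        exacts [.inl (.inl h), .inl (.inr h), .inr h]) (terminal.from X) h.lifting
    ![H, fst _ _ ≫ f₁, H] (by
      intro i j n z hi hj
      fin_cases i <;> fin_cases j
      exacts [rfl, (vtx_disjoint _ hi hj).elim, rfl, (vtx_disjoint _ hj hi).elim, rfl,
        c0 n z hi hj, rfl, (c0 n z hj hi).symm, rfl]) (terminal.from _)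
      (fun i n z _ ↦ app_eq_of_eq (Subsingleton.elim (_ ≫ terminal.from X) (terminal.from _)) z)
  refine ⟨K, ?_, ?_, ?_⟩
  · rw [← H0]
    exact hom_eq_of_app fun n x ↦ hK 0 n _ (mem_vtx_of_cyl 0 x)
  · exact hom_eq_of_app fun n x ↦ hK 1 n _ (mem_vtx_of_cyl 1 x)
  · rw [← H1]
    exact hom_eq_of_app fun n x ↦ hK 2 n _ x.1.2

/-! ### Eilenberg subcomplexes -/

lemma eq_const_of_mem {K X : SSet.{u}} {x : X _⦋0⦌} {f : K ⟶ X}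
    (h : ∀ n (z : K.obj n), f.app n z ∈ (Subcomplex.ofSimplex x).obj n) : f = SSet.const x := by
  have h1 : Subcomplex.lift f (by rintro n _ ⟨z, rfl⟩; exact h n z) ≫
    (Subcomplex.ofSimplex x).ι = f := rfl
  rw [← h1, Subcomplex.ofSimplex_ι, comp_const]

lemma const_app_vertex {K X : SSet.{u}} (x : X _⦋0⦌) (z : K _⦋0⦌) :
    (SSet.const x : K ⟶ X).app _ z = x := by
  change X.map (SimplexCategory.const ⦋0⦌ ⦋0⦌ 0).op x = x
  rw [Subsingleton.elim (SimplexCategory.const ⦋0⦌ ⦋0⦌ 0) (𝟙 _), op_id, Functor.map_id_apply]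

lemma mem_ofSimplex_of_const {X : SSet.{u}} {x : X _⦋0⦌} {K : SSet.{u}} {n : SimplexCategoryᵒᵖ}
    (z : K.obj n) : (SSet.const x : K ⟶ X).app n z ∈ (Subcomplex.ofSimplex x).obj n :=
  ⟨(SimplexCategory.const _ _ 0).op, rfl⟩

/-- The subcomplex of simplices whose faces of dimension `< n` are constant. -/
def eilenberg (n : ℕ) {X : SSet.{u}} (x : X _⦋0⦌) : X.Subcomplex where
  obj m := { z | ∀ k < n, ∀ θ : m ⟶ .op ⦋k⦌, X.map θ z ∈ (Subcomplex.ofSimplex x).obj _ }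
  map θ z hz k hk η := by
    have := hz k hk (θ ≫ η)
    rwa [Functor.map_comp_apply] at this

namespace eilenberg

variable {n : ℕ} {X : SSet.{u}} {x : X _⦋0⦌}

lemma mem_of_low {K : SSet.{u}} (f : K ⟶ X)
    (h : ∀ k < n, ∀ z : K _⦋k⦌, f.app _ z ∈ (Subcomplex.ofSimplex x).obj _) {m} (z : K.obj m) :
    f.app m z ∈ (eilenberg n x).obj m := fun k hk θ ↦ by
  rw [← NatTrans.naturality_apply]
  exact h k hk _

lemma low_of_mem {K : SSet.{u}} (f : K ⟶ X) (h : ∀ m (z : K.obj m), f.app m z ∈ (eilenberg n x).obj m)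
    {k : ℕ} (hk : k < n) (z : K _⦋k⦌) : f.app _ z ∈ (Subcomplex.ofSimplex x).obj _ := by
  have := h _ z k hk (𝟙 _)
  rwa [Functor.map_id_apply] at this

lemma const_mem {K : SSet.{u}} {m} (z : K.obj m) :
    (SSet.const x : K ⟶ X).app m z ∈ (eilenberg n x).obj m :=
  mem_of_low _ (fun _ _ _ ↦ mem_ofSimplex_of_const _) z

lemma eq_const {k : ℕ} (hk : k < n) (f : Δ[k] ⟶ X)
    (h : ∀ m (z : (Δ[k] : SSet.{u}).obj m), f.app m z ∈ (eilenberg n x).obj m) :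
    f = SSet.const x := by
  refine eq_const_of_mem fun m z ↦ ?_
  have h1 := low_of_mem f h hk (stdSimplex.objEquiv.symm (𝟙 _))
  have h2 := (Subcomplex.ofSimplex x).map (stdSimplex.objEquiv z).op h1
  have h3 := NatTrans.naturality_apply f (stdSimplex.objEquiv z).op (stdSimplex.objEquiv.symm (𝟙 _))
  have h4 : (Δ[k] : SSet.{u}).map (stdSimplex.objEquiv z).op (stdSimplex.objEquiv.symm (𝟙 _)) = z := by
    change stdSimplex.objEquiv.symm (stdSimplex.objEquiv z ≫ 𝟙 _) = z
    rw [Category.comp_id, Equiv.symm_apply_apply]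
  rw [h4] at h3
  rw [h3]
  exact h2

lemma eq_const_boundary {k : ℕ} (hk : k ≤ n) (f : (boundary.{u} k : SSet) ⟶ X)
    (h : ∀ m (z : (boundary.{u} k : SSet).obj m), f.app m z ∈ (eilenberg n x).obj m) :
    f = SSet.const x := by
  rcases k with _ | k
  · exact boundary.hom_ext₀
  · refine boundary.hom_ext fun i ↦ ?_
    rw [comp_const]
    exact eq_const hk _ fun m z ↦ h m _

/-- Simplices of `Δ[k]` of dimension `< n ≤ k` lie in `∂Δ[k]`, so the condition sees only the
boundary. -/
lemma mem_of_boundary {k : ℕ} (hk : n ≤ k) (f : Δ[k] ⟶ X)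
    (h : ∀ m (z : (boundary.{u} k : SSet).obj m),
      ((boundary k).ι ≫ f).app m z ∈ (eilenberg n x).obj m)
    {m} (z : (Δ[k] : SSet.{u}).obj m) : f.app m z ∈ (eilenberg n x).obj m := by
  refine mem_of_low f (fun j hj z ↦ ?_) z
  have hz : z ∈ (boundary k).obj _ := by
    rw [boundary_obj_eq_univ _ _ (by omega)]
    trivial
  exact low_of_mem _ h hj ⟨z, hz⟩

end eilenberg

/-- A Kan complex such that `π_k` vanishes for `k < n` deforms to its Eilenberg subcomplex. -/
lemma exists_deformation_eilenberg {n : ℕ} {B : SSet.{u}} [KanComplex B] (hB : ConnectedBelow n B)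
    (b : B _⦋0⦌) : ∃ R : B ⊗ Δ[1] ⟶ B, cyl 0 ≫ R = 𝟙 B ∧
      (∀ m (x : B.obj m), (cyl 1 ≫ R).app m x ∈ (eilenberg n b).obj m) ∧
      (Subcomplex.ofSimplex b).ι ▷ Δ[1] ≫ R = SSet.const b := by
  -- The complex `Q` consists of the paths in `B` that end in the Eilenberg subcomplex, and `q`
  -- takes the starting point. A section of `q` is a deformation as required, so it suffices that
  -- `q` is a trivial fibration.
  let Q := (eilenberg n b).preimage (mapc.ev B 1)
  let q : (Q : SSet) ⟶ B := Q.ι ≫ mapc.ev B 0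
  have hQ : ∀ {K : SSet.{u}} (φ : K ⟶ (Q : SSet)) m (z : K.obj m),
      (cyl 1 ≫ mapc.flat (φ ≫ Q.ι)).app m z ∈ (eilenberg n b).obj m := fun φ m z ↦ by
    rw [← mapc.comp_ev]
    exact (φ.app m z).2
  have hQ' : ∀ {K : SSet.{u}} (γ : K ⊗ Δ[1] ⟶ B),
      (∀ m (z : K.obj m), (cyl 1 ≫ γ).app m z ∈ (eilenberg n b).obj m) →
      ∃ φ : K ⟶ (Q : SSet), φ ≫ Q.ι = mapc.sharp γ := fun γ h ↦
    ⟨Subcomplex.lift (mapc.sharp γ) (by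
      rintro m _ ⟨z, rfl⟩
      have := h m z
      rw [← mapc.flat_sharp γ, ← mapc.comp_ev] at this
      exact this), rfl⟩
  have ht : TrivFib q := by
    refine fun k ↦ ⟨fun {v w} sq ↦ ?_⟩
    let γ := mapc.flat (v ≫ Q.ι)
    have h0 : (boundary k).ι ≫ w = cyl 0 ≫ γ := by
      rw [← mapc.comp_ev, Category.assoc]
      exact sq.w.symm
    obtain ⟨H, H0, H1, H2⟩ : ∃ H : Δ[k] ⊗ Δ[1] ⟶ B, cyl 0 ≫ H = w ∧
        (boundary k).ι ▷ Δ[1] ≫ H = γ ∧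
        ∀ m (z : (Δ[k] : SSet.{u}).obj m), (cyl 1 ≫ H).app m z ∈ (eilenberg n b).obj m := by
      -- Below dimension `n` the end of the homotopy has to be constant, which is possible because
      -- `π_k` vanishes. From `n` on any extension of the homotopy will do, since membership of its
      -- end is decided on the boundary.
      by_cases hk : k < n
      · have e1 : cyl 1 ≫ γ = SSet.const b :=
          eilenberg.eq_const_boundary hk.le _ (hQ v)
        obtain ⟨H, H0, H1, H2⟩ := (uniqueFillers_of_pi (hB k hk)).exists_homotopy w
          (SSet.const b) γ h0 (by rw [comp_const, e1])
        refine ⟨H, H0, H2, fun m z ↦ ?_⟩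
        rw [H1]
        exact eilenberg.const_mem z
      · obtain ⟨H, H0, H1, -⟩ := hlp 0 (boundary k).ι (terminal.from B) w γ (terminal.from _) h0
          (Subsingleton.elim _ _) (Subsingleton.elim _ _)
        refine ⟨H, H0, H1, fun m z ↦ eilenberg.mem_of_boundary (not_lt.1 hk) _ (fun m z ↦ ?_) z⟩
        rw [← cyl_whiskerRight_assoc, H1]
        exact hQ v m z
    obtain ⟨φ, hφ⟩ := hQ' H H2
    refine ⟨⟨⟨φ, ?_, ?_⟩⟩⟩
    · rw [← cancel_mono Q.ι, Category.assoc, hφ]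
      apply mapc.hom_ext
      rw [mapc.flat_comp, mapc.flat_sharp, H1]
    · rw [← Category.assoc, hφ, mapc.comp_ev, mapc.flat_sharp, H0]
  obtain ⟨φ, hφ⟩ := hQ' (SSet.const b : (Subcomplex.ofSimplex b : SSet) ⊗ Δ[1] ⟶ B)
    (fun m z ↦ by
      rw [comp_const]
      exact eilenberg.const_mem z)
  obtain ⟨s, s1, s2⟩ := ht.exists_lift (Subcomplex.ofSimplex b).ι φ (𝟙 B) (by
    rw [← Category.assoc, hφ, mapc.comp_ev, mapc.flat_sharp, Subcomplex.ofSimplex_ι, comp_const,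
      const_comp]
    rfl)
  refine ⟨mapc.flat (s ≫ Q.ι), ?_, hQ s, ?_⟩
  · rw [← mapc.comp_ev, Category.assoc, s2]
  · rw [← mapc.flat_comp, reassoc_of% s1, hφ, mapc.flat_sharp]

/-- Sections of fibrations with a highly connected base and a truncated fibre. -/
lemma exists_section_of_pointed_lifts {n : ℕ} {Y B : SSet.{u}} [KanComplex B]
    (hB : ConnectedBelow n B) (q : Y ⟶ B) [Fibration q]
    (hq : ∀ k, n < k → HasLiftingProperty (boundary.{u} k).ι q) (b : B _⦋0⦌) (y : Y _⦋0⦌)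
    (hy : q.app _ y = b)
    (h : ∀ x : Δ[n] ⟶ B, (boundary n).ι ≫ x = SSet.const b →
      ∃ z : Δ[n] ⟶ Y, z ≫ q = x ∧ (boundary n).ι ≫ z = SSet.const y) :
    ∃ s : B ⟶ Y, s ≫ q = 𝟙 B ∧ s.app _ b = y := by
  obtain ⟨R, R0, R1, R2⟩ := exists_deformation_eilenberg hB b
  have hle : eilenberg n y ≤ (eilenberg n b).preimage q := fun m z hz k hk θ ↦ by
    rw [← NatTrans.naturality_apply]
    obtain ⟨θ, h⟩ := hz k hk θ
    refine ⟨θ, ?_⟩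
    rw [← h, ← hy]
    exact (NatTrans.naturality_apply q θ y).symm
  -- Between Eilenberg subcomplexes `q` becomes a trivial fibration: below dimension `n` all
  -- simplices are constant, in dimension `n` the boundary is constant and `h` applies, and above
  -- `n` the lifting property of `q` applies and the lift stays in the subcomplex.
  let q₁ : (eilenberg n y : SSet) ⟶ (eilenberg n b : SSet) :=
    Subcomplex.homOfLE hle ≫ (eilenberg n b).fromPreimage q
  have hq₁ : q₁ ≫ (eilenberg n b).ι = (eilenberg n y).ι ≫ q := rfl
  have ht : TrivFib q₁ := by
    refine fun k ↦ ⟨fun {v w} sq ↦ ?_⟩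
    obtain ⟨l, l1, l2, l3⟩ : ∃ l : Δ[k] ⟶ Y, (boundary k).ι ≫ l = v ≫ (eilenberg n y).ι ∧
        l ≫ q = w ≫ (eilenberg n b).ι ∧
        ∀ m (z : (Δ[k] : SSet.{u}).obj m), l.app m z ∈ (eilenberg n y).obj m := by
      have hv : ∀ m z, (v ≫ (eilenberg n y).ι).app m z ∈ (eilenberg n y).obj m :=
        fun m z ↦ (v.app m z).2
      have hw : ∀ m z, (w ≫ (eilenberg n b).ι).app m z ∈ (eilenberg n b).obj m :=
        fun m z ↦ (w.app m z).2
      rcases lt_trichotomy k n with hk | rfl | hk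
      · refine ⟨SSet.const y, ?_, ?_, fun m z ↦ eilenberg.const_mem z⟩
        · rw [eilenberg.eq_const_boundary hk.le _ hv, comp_const]
        · rw [eilenberg.eq_const hk _ hw, const_comp, hy]
      · have e1 := eilenberg.eq_const_boundary le_rfl _ hv
        obtain ⟨z, z1, z2⟩ := h (w ≫ (eilenberg k b).ι) (by
          rw [← reassoc_of% sq.w, hq₁, reassoc_of% e1, const_comp, hy])
        refine ⟨z, by rw [z2, e1], z1, fun m t ↦ eilenberg.mem_of_boundary le_rfl _ ?_ t⟩
        rw [z2]
        exact fun m z ↦ eilenberg.const_mem z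
      · have := hq k hk
        have sq' : CommSq (v ≫ (eilenberg n y).ι) (boundary k).ι q (w ≫ (eilenberg n b).ι) := ⟨by
          rw [Category.assoc, ← hq₁, sq.w_assoc]⟩
        refine ⟨sq'.lift, sq'.fac_left, sq'.fac_right,
          fun m t ↦ eilenberg.mem_of_boundary hk.le _ ?_ t⟩
        rw [sq'.fac_left]
        exact hv
    refine ⟨⟨⟨Subcomplex.lift l (by rintro m _ ⟨z, rfl⟩; exact l3 m z), ?_, ?_⟩⟩⟩
    · rw [← cancel_mono (eilenberg n y).ι, ← l1]
      rfl
    · rw [← cancel_mono (eilenberg n b).ι, ← l2]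
      rfl
  have hb : b ∈ (eilenberg n b).obj _ := fun k hk θ ↦ ⟨θ, rfl⟩
  have hy' : y ∈ (eilenberg n y).obj _ := fun k hk θ ↦ ⟨θ, rfl⟩
  let b₁ : (eilenberg n b : SSet) _⦋0⦌ := ⟨b, hb⟩
  let y₁ : (eilenberg n y : SSet) _⦋0⦌ := ⟨y, hy'⟩
  have hy₁ : q₁.app _ y₁ = b₁ := Subtype.ext hy
  obtain ⟨s, s1, s2⟩ := ht.exists_lift (Subcomplex.ofSimplex b₁).ι (SSet.const y₁) (𝟙 _) (by
    rw [const_comp, hy₁, Subcomplex.ofSimplex_ι, const_comp]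
    rfl)
  have hs : s.app _ b₁ = y₁ := by
    exact (app_eq_of_eq s1 ⟨b₁, Subcomplex.mem_ofSimplex_obj _⟩).trans (const_app_vertex _ _)
  let r : B ⟶ (eilenberg n b : SSet) :=
    Subcomplex.lift (cyl 1 ≫ R) (by rintro m _ ⟨z, rfl⟩; exact R1 m z)
  have hr : r ≫ (eilenberg n b).ι = cyl 1 ≫ R := rfl
  have h1 : (Subcomplex.ofSimplex b).ι ≫ r = SSet.const b₁ := by
    rw [← cancel_mono (eilenberg n b).ι, Category.assoc, hr, ← cyl_whiskerRight_assoc, R2,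
      comp_const, const_comp]
    rfl
  have h2 : (Subcomplex.ofSimplex b).ι ≫ r ≫ s ≫ (eilenberg n y).ι =
      cyl 1 ≫ (SSet.const y : _ ⟶ Y) := by
    rw [reassoc_of% h1, const_comp, comp_const]
    exact congrArg SSet.const (congrArg Subtype.val hs)
  -- The section over the Eilenberg subcomplex, composed with the retraction `r`, lifts the end `1`
  -- of `R`. Lifting `R` backwards from it gives at the end `0` a lift of the identity; keeping `G`
  -- constant over `b` preserves the value `y`.
  obtain ⟨G, G0, G1, G2⟩ := hlp 1 (Subcomplex.ofSimplex b).ι q (r ≫ s ≫ (eilenberg n y).ι)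
    (SSet.const y) R h2 (by
      rw [Category.assoc, Category.assoc, ← hq₁, reassoc_of% s2, hr])
    (by rw [const_comp, hy, R2])
  refine ⟨cyl 0 ≫ G, by rw [Category.assoc, G2, R0], ?_⟩
  exact (app_eq_of_eq (congrArg (cyl 0 ≫ ·) G1) ⟨b, Subcomplex.mem_ofSimplex_obj _⟩).trans
    (const_app_vertex _ _)

end SplitFib

end

noncomputable section

namespace SplitFib

open HomotopicalAlgebra SSet Limits

lemma exists_lift_unionProd {X Y : SSet.{u}} (S : X.Subcomplex) (T : Y.Subcomplex)
    {E B : SSet.{u}} (p : E ⟶ B) (hp : HasLiftingProperty (S.unionProd T).ι p)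
    (u : X ⊗ (T : SSet) ⟶ E) (h : (S : SSet) ⊗ Y ⟶ E) (G : X ⊗ Y ⟶ B)
    (huh : S.ι ▷ (T : SSet) ≫ u = (S : SSet) ◁ T.ι ≫ h)
    (hu : u ≫ p = X ◁ T.ι ≫ G) (hh : h ≫ p = S.ι ▷ Y ≫ G) :
    ∃ H : X ⊗ Y ⟶ E, X ◁ T.ι ≫ H = u ∧ S.ι ▷ Y ≫ H = h ∧ H ≫ p = G := by
  let sq := Subcomplex.unionProd.pushoutObjObj S T
  have hl : sq.inl ≫ sq.ι = X ◁ T.ι := sq.inl_ι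
  have hr : sq.inr ≫ sq.ι = S.ι ▷ Y := sq.inr_ι
  have hil : sq.inl ≫ sq.isPushout.desc u h huh = u := sq.isPushout.inl_desc u h huh
  have hir : sq.inr ≫ sq.isPushout.desc u h huh = h := sq.isPushout.inr_desc u h huh
  have : HasLiftingProperty sq.ι p := hp
  have w : CommSq (sq.isPushout.desc u h huh) sq.ι p G := ⟨by
    apply sq.isPushout.hom_ext
    · rw [reassoc_of% hil, hu, reassoc_of% hl]
    · rw [reassoc_of% hir, hh, reassoc_of% hr]⟩
  refine ⟨w.lift, ?_, ?_, w.fac_right⟩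
  · rw [← hl, Category.assoc, w.fac_left, hil]
  · rw [← hr, Category.assoc, w.fac_left, hir]

/-! ### Families of pointed equivalences -/

/-- Being an equivalence onto the fibre does not depend on the vertex of a connected base. -/
lemma isEquivOntoFibre_of_isConnected {F E B X : SSet.{u}} [KanComplex F] (p : E ⟶ B) [Fibration p]
    (hX : X.IsConnected) (β : X ⟶ B) (α : X ⊗ F ⟶ E) (hα : α ≫ p = fst _ _ ≫ β) {v : X _⦋0⦌}
    (hv : IsEquivOntoFibre (lift (SSet.const v) (𝟙 F) ≫ α) p (β.app _ v)) (v' : X _⦋0⦌) :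
    IsEquivOntoFibre (lift (SSet.const v') (𝟙 F) ≫ α) p (β.app _ v') := by
  refine forall_vertex_of_isConnected hX
    (Q := fun v ↦ IsEquivOntoFibre (lift (SSet.const v) (𝟙 F) ≫ α) p (β.app _ v))
    (fun γ ε ε' h ↦ ?_) hv v'
  have e : ∀ δ : Fin 2, cyl δ ≫ lift (snd F Δ[1] ≫ γ) (fst F Δ[1]) ≫ α =
      lift (SSet.const (γ.app _ (stdSimplex.obj₀Equiv.symm δ))) (𝟙 F) ≫ α := fun δ ↦ by
    rw [← Category.assoc]
    refine congrArg (· ≫ α) (CartesianMonoidalCategory.hom_ext _ _ ?_ rfl)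
    rw [Category.assoc, lift_fst, ← Category.assoc, lift_snd, const_comp, lift_fst]
  have := isEquivOntoFibre_cyl p (γ ≫ β) (lift (snd F Δ[1] ≫ γ) (fst F Δ[1]) ≫ α)
    (by rw [Category.assoc, hα, lift_fst_assoc, Category.assoc]) ε ε'
  rw [e, e] at this
  exact this h

namespace principal

variable {B F : SSet.{u}} {e : F _⦋0⦌} {P : SecFib B} {K : SSet.{u}}

variable (F e P) in
/-- The inclusion of the associated principal fibration in a function complex. -/
def toMapc : principal F e P ⟶ mapc F P.total where
  app _ := ↾fun α ↦ α.1
  naturality _ _ _ := rfl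

lemma hom_ext {φ ψ : K ⟶ principal F e P} (h : φ ≫ toMapc F e P = ψ ≫ toMapc F e P) : φ = ψ :=
  hom_eq_of_app fun _ x ↦ Subtype.ext (app_eq_of_eq h x)

variable (F e P) in
/-- The projection of the associated principal fibration. -/
def π : principal F e P ⟶ B :=
  lift (𝟙 _) (SSet.const e) ≫ mapc.flat (toMapc F e P) ≫ P.proj

/-- The universal family. -/
lemma isEquivFamily : IsEquivFamily e P (π F e P) (mapc.flat (toMapc F e P)) where
  proj := by
    refine hom_eq_of_app fun m z ↦ ?_
    obtain ⟨β, h⟩ := z.1.2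
    refine (app_eq_of_eq h.proj _).trans (app_eq_of_eq h.proj
      ((mapc.idSimplex m, (SSet.const e : Δ[0] ⟶ F).app m (stdSimplex.const 0 0 m)) :
        (SSet.stdSimplex.obj m.unop ⊗ F : SSet).obj m)).symm
  sec := by
    refine hom_eq_of_app fun m z ↦ ?_
    obtain ⟨β, h⟩ := z.2
    have h1 := app_eq_of_eq h.sec (mapc.idSimplex m)
    refine h1.trans (congrArg (P.sec.app m) ?_)
    exact (app_eq_of_eq h.proj
      ((mapc.idSimplex m, (SSet.const e : Δ[0] ⟶ F).app m (stdSimplex.const 0 0 m)) :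
        (SSet.stdSimplex.obj m.unop ⊗ F : SSet).obj m)).symm
  equiv v := by
    obtain ⟨β, h⟩ := v.2
    have h1 : lift (SSet.const v) (𝟙 F) ≫ mapc.flat (toMapc F e P) =
        lift (SSet.const (stdSimplex.obj₀Equiv.symm (0 : Fin 1))) (𝟙 F) ≫ v.1 := by
      refine hom_eq_of_app fun m y ↦ ?_
      refine (app_eq_of_eq (mapc.simplex_map (toMapc F e P) (SimplexCategory.const m.unop ⦋0⦌ 0).op v)
        ((mapc.idSimplex m, y) : (SSet.stdSimplex.obj m.unop ⊗ F : SSet).obj m)).trans ?_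
      exact congrArg (v.1.app m) (Prod.ext
        (asOrderHom_ext fun _ ↦ Subsingleton.elim (α := Fin 1) _ _) rfl)
    have h2 := h.equiv (stdSimplex.obj₀Equiv.symm (0 : Fin 1))
    have h3 : (π F e P).app _ v = β.app _ (stdSimplex.obj₀Equiv.symm (0 : Fin 1)) := by
      refine (app_eq_of_eq h.proj _).trans (congrArg (β.app _) ?_)
      exact asOrderHom_ext fun _ ↦ Subsingleton.elim (α := Fin 1) _ _
    rw [h1, h3]
    exact h2

/-- The family corresponding to a map to the associated principal fibration. -/
lemma isEquivFamily_comp (φ : K ⟶ principal F e P) :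
    IsEquivFamily e P (φ ≫ π F e P) (mapc.flat (φ ≫ toMapc F e P)) :=
  isEquivFamily.precomp φ

/-- The simplex of the associated principal fibration given by a simplex of the base of a family. -/
def ofFamily {β : K ⟶ B} {α : K ⊗ F ⟶ P.total} (h : IsEquivFamily e P β α) {m : SimplexCategoryᵒᵖ}
    (x : K.obj m) : (principal F e P).obj m :=
  Subtype.mk ((yonedaEquiv.symm x : SSet.stdSimplex.obj m.unop ⟶ K) ▷ F ≫ α)
    ⟨(yonedaEquiv.symm x : SSet.stdSimplex.obj m.unop ⟶ K) ≫ β, h.precomp _⟩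

/-- The map to the associated principal fibration corresponding to a family. -/
lemma exists_hom {β : K ⟶ B} {α : K ⊗ F ⟶ P.total} (h : IsEquivFamily e P β α) :
    ∃ φ : K ⟶ principal F e P, mapc.flat (φ ≫ toMapc F e P) = α ∧ φ ≫ π F e P = β := by
  let φ : K ⟶ principal F e P :=
    { app m := ↾fun x ↦ ofFamily h x
      naturality m m' θ := by
        ext x
        have h1 := NatTrans.naturality_apply (mapc.sharp α) θ x
        apply Subtype.ext
        exact h1 }
  have h0 : φ ≫ toMapc F e P = mapc.sharp α := rfl
  have h1 : mapc.flat (φ ≫ toMapc F e P) = α := by rw [h0, mapc.flat_sharp]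
  refine ⟨φ, h1, ?_⟩
  have h2 := (isEquivFamily_comp φ).proj
  rw [h1, h.proj] at h2
  have h3 := congrArg (lift (𝟙 K) (SSet.const e) ≫ ·) h2
  simpa using h3.symm

variable [KanComplex F]

instance (P : SecFib B) : Fibration P.proj := P.fibration

/-- Extending a family from `S` to `X` means extending a map from `S ⊗ F`, with the values on `X ⊗
{e}` dictated by the section; this is the pushout-product in `hS`. The equivalence condition holds
at a vertex of `S`, hence at all vertices of the connected `X`. -/
lemma lifting {X : SSet.{u}} (hX : X.IsConnected) (S : X.Subcomplex) (v : (S : SSet) _⦋0⦌)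
    (hS : HasLiftingProperty (S.unionProd (Subcomplex.ofSimplex e)).ι P.proj) :
    HasLiftingProperty S.ι (π F e P) := by
  refine ⟨fun {φ w} sq ↦ ?_⟩
  have h := isEquivFamily_comp φ
  rw [sq.w] at h
  have e1 : ∀ Z : SSet.{u}, Z ◁ (Subcomplex.ofSimplex e).ι =
      fst Z _ ≫ lift (𝟙 Z) (SSet.const e) := fun Z ↦ by
    rw [Subcomplex.ofSimplex_ι]
    ext : 1 <;> simp
  obtain ⟨α, h1, h2, h3⟩ := exists_lift_unionProd S (Subcomplex.ofSimplex e) P.proj hS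
    (fst _ _ ≫ w ≫ P.sec) (mapc.flat (φ ≫ toMapc F e P)) (fst _ _ ≫ w)
    (by rw [e1, Category.assoc, h.sec, whiskerRight_fst_assoc, Category.assoc])
    (by rw [Category.assoc, Category.assoc, P.sec_proj, Category.comp_id, whiskerLeft_fst_assoc])
    (by rw [h.proj, whiskerRight_fst_assoc])
  have hα : IsEquivFamily e P w α :=
    { proj := h3
      sec := by
        have := congrArg (lift (𝟙 X) (SSet.const (⟨e, Subcomplex.mem_ofSimplex_obj _⟩ :
          (Subcomplex.ofSimplex e : SSet) _⦋0⦌)) ≫ ·) h1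
        rw [lift_fst_assoc, Category.id_comp] at this
        rw [← this, ← Category.assoc]
        rfl
      equiv v' := by
        refine isEquivOntoFibre_of_isConnected P.proj hX w α h3 (v := v.1) ?_ v'
        have := h.equiv v
        rw [← h2, ← Category.assoc] at this
        exact this }
  obtain ⟨ψ, hψ1, hψ2⟩ := exists_hom hα
  refine ⟨⟨⟨ψ, hom_ext (mapc.hom_ext ?_), hψ2⟩⟩⟩
  rw [Category.assoc, mapc.flat_comp, hψ1, h2]

end principal

end SplitFib

end

/-! ### The principal fibration is a Kan fibration and is truncated. -/

noncomputable section

namespace SplitFib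

open HomotopicalAlgebra SSet Limits

lemma isConnected_stdSimplex (n : ℕ) : (Δ[n] : SSet.{u}).IsConnected := by
  have h : ∀ x : (Δ[n] : SSet.{u}) _⦋0⦌, π₀.mk (stdSimplex.obj₀Equiv.symm 0) = π₀.mk x := fun x ↦ by
    refine π₀.sound (Edge.mk (stdSimplex.edge n 0 (stdSimplex.obj₀Equiv x) (Fin.zero_le _)) ?_ ?_)
    · ext i
      fin_cases i
      rfl
    · ext i
      fin_cases i
      rfl
  have : (Δ[n] : SSet.{u}).IsPreconnected := ⟨fun a b ↦ by
    obtain ⟨a, rfl⟩ := π₀.mk_surjective a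
    obtain ⟨b, rfl⟩ := π₀.mk_surjective b
    rw [← h a, ← h b]⟩
  exact { nonempty := ⟨stdSimplex.obj₀Equiv.symm 0⟩ }

namespace principal

variable {B F : SSet.{u}} {e : F _⦋0⦌} {P : SecFib B} [KanComplex F]

/-- The pushout-product of a horn inclusion with the inclusion of `e` is anodyne. -/
instance : Fibration (π F e P) := by
  rw [modelCategoryQuillen.fibration_iff]
  intro _ _ _ h
  simp only [modelCategoryQuillen.J, MorphismProperty.iSup_iff] at h
  obtain ⟨m, ⟨k⟩⟩ := h
  refine lifting (isConnected_stdSimplex _) _ ⟨stdSimplex.obj₀Equiv.symm k, ?_⟩ ?_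
  · rw [mem_horn_iff']
    obtain ⟨j, hj⟩ := exists_ne k
    exact ⟨j, hj, fun i hi ↦ hj hi.symm⟩
  · exact anodyne_of_llp (anodyneExtensions_unionProd_ι' _ _ (.horn_ι _)) _

/-- This expresses that `aut_*(F)` has no homotopy in degrees `≥ n`. The projection of `P` lifts
against `∂Δ[m]` only from `m = n + 2` on; connectedness of `F` improves this to `n + 1`. -/
lemma lifting_boundary (hF : F.IsConnected) {n : ℕ}
    (hP : ∀ k, n < k → HasLiftingProperty (boundary.{u} (k + 1)).ι P.proj) (k : ℕ) (hk : n < k) :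
    HasLiftingProperty (boundary.{u} k).ι (π F e P) := by
  obtain ⟨k, rfl⟩ : ∃ l, k = l + 1 := ⟨k - 1, by omega⟩
  refine lifting (isConnected_stdSimplex _) _ ⟨stdSimplex.obj₀Equiv.symm 0, ?_⟩ ?_
  · rw [mem_boundary_iff]
    obtain ⟨j, hj⟩ := exists_ne (0 : Fin (k + 2))
    exact ⟨j, fun i hi ↦ hj hi.symm⟩
  · refine lifting_unionProd_ofSimplex hF e (n + 2) _ (fun m hm ↦ ?_) _ (by omega)
    obtain ⟨m, rfl⟩ : ∃ l, m = l + 1 := ⟨m - 1, by omega⟩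
    exact hP m (by omega)

end principal

/-! ### Universal fibrations -/

namespace BAutPt

variable {F : SSet.{u}} {e : F _⦋0⦌} (W : BAutPt F e)

lemma trivFib : TrivFib (terminal.from (principal F e W.univ)) := fun k ↦ ⟨fun {v _} _ ↦ by
  obtain ⟨g, hg⟩ := W.contractible k v
  exact ⟨⟨⟨g, hg, Subsingleton.elim _ _⟩⟩⟩⟩

/-- Families with values in a universal fibration extend along monomorphisms. -/
lemma exists_extension {A X : SSet.{u}} (i : A ⟶ X) [Mono i] {β : A ⟶ W.space}
    {α : A ⊗ F ⟶ W.univ.total} (h : IsEquivFamily e W.univ β α) :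
    ∃ (β' : X ⟶ W.space) (α' : X ⊗ F ⟶ W.univ.total), IsEquivFamily e W.univ β' α' ∧
      i ≫ β' = β ∧ i ▷ F ≫ α' = α := by
  obtain ⟨φ, h1, h2⟩ := principal.exists_hom h
  obtain ⟨ψ, h3, -⟩ := W.trivFib.exists_lift i φ (terminal.from X) (Subsingleton.elim _ _)
  refine ⟨_, _, principal.isEquivFamily_comp ψ, ?_, ?_⟩
  · rw [reassoc_of% h3, h2]
  · rw [← mapc.flat_comp, reassoc_of% h3, h1]

/-- There is a pointed equivalence from `F` to each fibre of a universal fibration. -/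
lemma exists_vertex [KanComplex F] (w : W.space _⦋0⦌) :
    ∃ v : (principal F e W.univ) _⦋0⦌, (principal.π F e W.univ).app _ v = w := by
  obtain ⟨g, -⟩ := W.trivFib.exists_lift (Subcomplex.ι (⊥ : (Δ[0] : SSet.{u}).Subcomplex))
    (Subcomplex.isInitialBot.to _) (terminal.from _) (Subsingleton.elim _ _)
  exact exists_lift_vertex _ W.connected (g.app _ (stdSimplex.obj₀Equiv.symm 0)) w

/-- Every fibre of the universal fibration is equivalent to `F`, so the vanishing of `π_k F` passes
to it as uniqueness of fillers. -/
lemma lifting_proj [KanComplex F] {n : ℕ} (hF : Truncated n F) (k : ℕ) (hk : n < k) :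
    HasLiftingProperty (boundary.{u} (k + 1)).ι W.univ.proj := by
  refine lifting_succ_of_uniqueFillers fun w f g hf hg hfg ↦ ?_
  obtain ⟨v, rfl⟩ := W.exists_vertex w
  obtain ⟨g', -, h⟩ := principal.isEquivFamily.equiv v
  have h1 : HasLiftingProperty (boundary.{u} (k + 1)).ι (terminal.from F) :=
    (uniqueFillers_of_pi (hF k hk)).lifting_succ
  exact Fib.htpyRel_incl (UniqueFillers.of_lifting_succ (lifting_of_isHomotopyEquiv g' h h1)
    (Fib.lift f hf) (Fib.lift g hg) (Subsingleton.elim _ _) (Fib.hom_ext hfg))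

lemma lifting_π [KanComplex F] (hF : F.IsConnected) {n : ℕ} (hF' : Truncated n F) (k : ℕ)
    (hk : n < k) : HasLiftingProperty (boundary.{u} k).ι (principal.π F e W.univ) :=
  principal.lifting_boundary hF (W.lifting_proj hF') k hk

end BAutPt

end SplitFib

end

/-! ### Pointed splittings correspond to lifts of the classifying map. -/

noncomputable section

namespace SplitFib

open HomotopicalAlgebra SSet Limits

/-- A lift of `f` is a section of the base change of `q` along `f`, and the base change inherits the
hypotheses of `exists_section_of_pointed_lifts`. -/
lemma exists_lift_of_pointed_lifts {n : ℕ} {Y B W : SSet.{u}} [KanComplex B]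
    (hB : ConnectedBelow n B) (q : Y ⟶ W) [Fibration q]
    (hq : ∀ k, n < k → HasLiftingProperty (boundary.{u} k).ι q) (f : B ⟶ W) (b : B _⦋0⦌)
    (y : Y _⦋0⦌) (hy : q.app _ y = f.app _ b)
    (h : ∀ x : Δ[n] ⟶ B, (boundary n).ι ≫ x = SSet.const b →
      ∃ z : Δ[n] ⟶ Y, z ≫ q = x ≫ f ∧ (boundary n).ι ≫ z = SSet.const y) :
    ∃ g : B ⟶ Y, g ≫ q = f := by
  have pb := IsPullback.of_hasPullback q f
  have := fibration_of_isPullback pb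
  have w : (SSet.const y : Δ[0] ⟶ Y) ≫ q = SSet.const b ≫ f := by
    rw [const_comp, const_comp, hy]
  let y' := (pullback.lift (SSet.const y : Δ[0] ⟶ Y) (SSet.const b) w).app _
    (stdSimplex.obj₀Equiv.symm 0)
  have hy1 : (pullback.fst q f).app _ y' = y :=
    (app_eq_of_eq (pullback.lift_fst _ _ w) _).trans (const_app_vertex _ _)
  have hy2 : (pullback.snd q f).app _ y' = b :=
    (app_eq_of_eq (pullback.lift_snd _ _ w) _).trans (const_app_vertex _ _)
  obtain ⟨s, hs, -⟩ := exists_section_of_pointed_lifts hB (pullback.snd q f) (fun k hk ↦ by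
    have := hq k hk
    exact pb.hasLiftingProperty _) b y' hy2 (fun x hx ↦ by
    obtain ⟨z, z1, z2⟩ := h x hx
    refine ⟨pullback.lift z x z1, pullback.lift_snd _ _ _, ?_⟩
    apply pullback.hom_ext
    · rw [Category.assoc, pullback.lift_fst, z2, const_comp, hy1]
    · rw [Category.assoc, pullback.lift_snd, hx, const_comp, hy2])
  exact ⟨s ≫ pullback.fst q f, by rw [Category.assoc, pullback.condition, reassoc_of% hs]⟩

/-- Homotopy extension moves `φ` within its homotopy class over `B` to a map with prescribed
restriction. It makes equivalences compatible with sections strictly, and not only up to homotopy.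
-/
lemma EqvOver.exists_rel {A B E E' : SSet.{u}} {p : E ⟶ B} {p' : E' ⟶ B} [Fibration p]
    [Fibration p'] {φ : E ⟶ E'} (h : EqvOver p p' φ) (i : A ⟶ E) [Mono i] {k : A ⟶ E'}
    (hk : HtpyRel ⊥ p' (i ≫ φ) k) : ∃ φ' : E ⟶ E', i ≫ φ' = k ∧ EqvOver p p' φ' := by
  obtain ⟨H, H0, H1, H2, -⟩ := hk
  obtain ⟨K, K0, K1, K2⟩ := hlp 0 i p' φ H (fst _ _ ≫ φ ≫ p') H0.symm (by rw [cyl_fst_assoc])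
    (by rw [H2, whiskerRight_fst_assoc, Category.assoc])
  refine ⟨cyl 1 ≫ K, by rw [← cyl_whiskerRight_assoc, K1, H1], h.of_htpy ?_⟩
  exact ⟨K, K0, rfl, K2, hom_eq_of_app fun m x ↦ x.1.2.elim⟩

instance fibration_fst (B F : SSet.{u}) [KanComplex F] : Fibration (fst B F) := by
  rw [modelCategoryQuillen.fibration_iff]
  intro _ _ i hi
  refine ⟨fun {v w} sq ↦ ?_⟩
  have : HasLiftingProperty i (terminal.from F) :=
    (modelCategoryQuillen.fibration_iff (terminal.from F)).1 inferInstance _ hi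
  have sq' : CommSq (v ≫ snd B F) i (terminal.from F) (terminal.from _) := ⟨Subsingleton.elim _ _⟩
  refine ⟨⟨⟨lift w sq'.lift, ?_, by rw [lift_fst]⟩⟩⟩
  apply CartesianMonoidalCategory.hom_ext
  · rw [Category.assoc, lift_fst, sq.w]
  · rw [Category.assoc, lift_snd, sq'.fac_left]

lemma incl_fst (B F : SSet.{u}) (b : B _⦋0⦌) : Fib.incl (fst B F) b =
    (Fib.incl (fst B F) b ≫ snd B F) ≫ lift (SSet.const b) (𝟙 F) := by
  apply CartesianMonoidalCategory.hom_ext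
  · rw [Fib.incl_comp, Category.assoc, lift_fst, comp_const]
  · rw [Category.assoc, Category.assoc, lift_snd, Category.comp_id]

lemma lift_const_fst (B F : SSet.{u}) (b : B _⦋0⦌) :
    lift (SSet.const b) (𝟙 F) ≫ fst B F = SSet.const b := lift_fst _ _

/-- The fibre of a product is the other factor. -/
def fibFstIso (B F : SSet.{u}) (b : B _⦋0⦌) : F ≅ Fib (fst B F) b where
  hom := Fib.lift (lift (SSet.const b) (𝟙 F)) (lift_const_fst B F b)
  inv := Fib.incl (fst B F) b ≫ snd B F
  hom_inv_id := by rw [Fib.lift_incl_assoc, lift_snd]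
  inv_hom_id := Fib.hom_ext (by
    rw [Category.assoc, Fib.lift_incl, ← incl_fst, Category.id_comp])

lemma isEquivOntoFibre_lift_const (B F : SSet.{u}) [KanComplex F] (b : B _⦋0⦌) :
    IsEquivOntoFibre (lift (SSet.const b) (𝟙 F)) (fst B F) b :=
  ⟨(fibFstIso B F b).hom, Fib.lift_incl _ (lift_const_fst B F b), .of_iso _⟩

/-- The fibres of a base change. -/
lemma isEquivOntoFibre_of_isPullback {Y Y' B B' : SSet.{u}} {t : Y' ⟶ Y} {p' : Y' ⟶ B'}
    {p : Y ⟶ B} {f : B' ⟶ B} (sq : IsPullback t p' p f) (b : B' _⦋0⦌) :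
    IsEquivOntoFibre (Fib.incl p' b ≫ t) p (f.app _ b) := by
  have h1 : (Fib.incl p' b ≫ t) ≫ p = SSet.const (f.app _ b) := by
    rw [Category.assoc, sq.w, ← Category.assoc, Fib.incl_comp, const_comp]
  have h2 : Fib.incl p (f.app _ b) ≫ p = SSet.const b ≫ f := by rw [Fib.incl_comp, const_comp]
  let e : Fib p' b ≅ Fib p (f.app _ b) :=
    { hom := Fib.lift (Fib.incl _ _ ≫ t) h1
      inv := Fib.lift (sq.lift (Fib.incl p _) (SSet.const b) h2) (sq.lift_snd _ _ _)
      hom_inv_id := Fib.hom_ext (by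
        apply sq.hom_ext
        · rw [Category.assoc, Category.assoc, Fib.lift_incl_assoc, sq.lift_fst, Fib.lift_incl,
            Category.id_comp]
        · rw [Category.assoc, Category.assoc, Fib.lift_incl_assoc, sq.lift_snd,
            Category.id_comp, Fib.incl_comp, comp_const])
      inv_hom_id := Fib.hom_ext (by
        rw [Category.assoc, Fib.lift_incl, Fib.lift_incl_assoc, sq.lift_fst, Category.id_comp]) }
  exact ⟨e.hom, Fib.lift_incl _ h1, .of_iso _⟩

lemma pi_map_trivial_iff {n : ℕ} {X Y : SSet.{u}} [KanComplex Y] (f : X ⟶ Y) (x : X _⦋0⦌) :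
    (∀ a : Pi n X x, Pi.map n f x a = Pi.base n Y (f.app _ x)) ↔
      ∀ z : Δ[n] ⟶ X, (boundary n).ι ≫ z = SSet.const x →
        HtpyRel (boundary n) (terminal.from Y) (z ≫ f) (SSet.const (f.app _ x)) := by
  constructor
  · intro h z hz
    exact Pi.htpyRel (h (ptSimplex z hz).homotopyClass)
  · intro h a
    obtain ⟨z, rfl⟩ := a.eq_homotopyClass
    exact Pi.eq_of_htpyRel (h z.map (PtSimplex.comm' z))

instance (W : BAutPt F e) : KanComplex W.space := W.kan

namespace SecFib

variable {B : SSet.{u}} (P : SecFib B) (b : B _⦋0⦌) [KanComplex (Fib P.proj b)]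
  (W : BAutPt (Fib P.proj b) (P.pt b)) (f : B ⟶ W.space)

lemma mono_const (F : SSet.{u}) (e : F _⦋0⦌) : Mono (lift (𝟙 B) (SSet.const e)) :=
  mono_of_mono_fac (lift_fst (𝟙 B) (SSet.const e))

/-- Both the given fibration and the product are equivalent over `B` to the base change `V` of the
universal fibration along `f`, by the fibrewise criterion. One equivalence followed by an inverse of
the other respects the sections up to homotopy, and `EqvOver.exists_rel` makes this strict. -/
lemma splits_of_family (hf : Classifies P W f) {α : B ⊗ Fib P.proj b ⟶ W.univ.total}
    (hα : IsEquivFamily (P.pt b) W.univ f α) : P.Splits b := by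
  obtain ⟨Φ, h1, h2, h3⟩ := hf
  let V := pullback W.univ.proj f
  let pV : V ⟶ B := pullback.snd W.univ.proj f
  have : Fibration pV := fibration_of_isPullback (IsPullback.of_hasPullback _ _)
  let Φ' : P.total ⟶ V := pullback.lift Φ P.proj h1
  let α' : B ⊗ Fib P.proj b ⟶ V := pullback.lift α (fst _ _) hα.proj
  have hΦ1 : Φ' ≫ pullback.fst _ _ = Φ := pullback.lift_fst _ _ _
  have hα1 : α' ≫ pullback.fst _ _ = α := pullback.lift_fst _ _ _
  have hΦ2 : Φ' ≫ pV = P.proj := pullback.lift_snd _ _ _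
  have hα2 : α' ≫ pV = fst _ _ := pullback.lift_snd _ _ _
  have hΦ : EqvOver P.proj pV Φ' := eqvOver_of_fibres Φ' hΦ2 fun v ↦ by
    refine IsEquivOntoFibre.of_comp_incl ?_ (isEquivOntoFibre_of_isPullback
      (IsPullback.of_hasPullback W.univ.proj f) v) ?_
    · rw [Category.assoc, hΦ2, Fib.incl_comp]
    · rw [Category.assoc, hΦ1]
      exact h3 v
  have hα' : EqvOver (fst _ _) pV α' := eqvOver_of_fibres α' hα2 fun v ↦ by
    rw [incl_fst, Category.assoc]
    refine IsEquivOntoFibre.precomp ?_ (.of_iso (fibFstIso B (Fib P.proj b) v).symm)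
    refine IsEquivOntoFibre.of_comp_incl ?_ (isEquivOntoFibre_of_isPullback
      (IsPullback.of_hasPullback W.univ.proj f) v) ?_
    · rw [Category.assoc, hα2, lift_fst]
    · rw [Category.assoc, hα1]
      exact hα.equiv v
  obtain ⟨ψ, hψ, hψ1, hψ2⟩ := hα'.inverse
  have hsec : P.sec ≫ Φ' = lift (𝟙 B) (SSet.const (P.pt b)) ≫ α' := by
    apply pullback.hom_ext
    · rw [Category.assoc, Category.assoc, hΦ1, hα1, h2, hα.sec]
    · refine (Category.assoc _ _ _).trans (.trans ?_ (Category.assoc _ _ _).symm)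
      change P.sec ≫ Φ' ≫ pV = lift (𝟙 B) (SSet.const (P.pt b)) ≫ α' ≫ pV
      rw [hΦ2, hα2, P.sec_proj, lift_fst]
  have : Mono P.sec := mono_of_mono_fac P.sec_proj
  obtain ⟨φ, hφ1, hφ2⟩ := (hΦ.comp hψ).exists_rel P.sec (k := lift (𝟙 B) (SSet.const (P.pt b))) (by
    have := hψ1.precomp (A' := ⊥) (lift (𝟙 B) (SSet.const (P.pt b))) bot_le
    rwa [Category.comp_id, ← Category.assoc, ← hsec, Category.assoc] at this)
  exact ⟨φ, (eqvOver_iff _ _ _).1 hφ2, hφ1⟩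

/-- The family is an inverse of the splitting, adjusted so as to send the constant section to
`P.sec`, followed by the classifying map of fibrations. -/
lemma exists_family_of_splits (hf : Classifies P W f) (h : P.Splits b) :
    ∃ α : B ⊗ Fib P.proj b ⟶ W.univ.total, IsEquivFamily (P.pt b) W.univ f α := by
  obtain ⟨Φ, h1, h2, h3⟩ := hf
  obtain ⟨φ, hφ, hφs⟩ := h
  obtain ⟨ψ, hψ, hψ1, hψ2⟩ := ((eqvOver_iff _ _ _).2 hφ).inverse
  have := mono_const (B := B) (Fib P.proj b) (P.pt b)
  obtain ⟨ψ', hψ1', hψ2'⟩ := hψ.exists_rel (lift (𝟙 B) (SSet.const (P.pt b))) (k := P.sec) (by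
    have := hψ1.precomp (A' := ⊥) P.sec bot_le
    rwa [Category.comp_id, ← Category.assoc, hφs] at this)
  refine ⟨ψ' ≫ Φ, ?_, ?_, fun v ↦ ?_⟩
  · rw [Category.assoc, h1, reassoc_of% hψ2'.1]
  · rw [reassoc_of% hψ1', h2]
  · rw [← Category.assoc]
    exact ((isEquivOntoFibre_lift_const B _ v).comp_incl
      (IsEquivOntoFibre.incl_of_eqvOver hψ2' v)).comp_incl (h3 v)

/-- The fibration splits if and only if the classifying map is trivial on `π_n`. -/
lemma splits_iff [KanComplex B] (hFc : (Fib P.proj b).IsConnected) {n : ℕ}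
    (hF : Truncated n (Fib P.proj b)) (hB : ConnectedBelow n B) (hf : Classifies P W f) :
    P.Splits b ↔ ∀ x : Pi n B b, Pi.map n f b x = Pi.base n W.space (f.app _ b) := by
  rw [pi_map_trivial_iff]
  constructor
  · intro h x hx
    obtain ⟨α, hα⟩ := exists_family_of_splits P b W f hf h
    obtain ⟨g, -, hg⟩ := principal.exists_hom hα
    -- The family makes `f` factor through the contractible principal fibration, where every
    -- spherical simplex is null relative to its boundary.
    have := W.trivFib.htpyRel (boundary n) (x ≫ g) (SSet.const (g.app _ b))
      (Subsingleton.elim _ _) (by rw [reassoc_of% hx, const_comp, comp_const])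
    have := this.postcomp (principal.π _ _ _) (terminal.from _) (terminal.from _)
      (Subsingleton.elim _ _)
    have e1 : (principal.π (Fib P.proj b) (P.pt b) W.univ).app _ (g.app _ b) = f.app _ b :=
      app_eq_of_eq hg b
    rwa [Category.assoc, hg, const_comp, e1] at this
  · intro h
    obtain ⟨y, hy⟩ := W.exists_vertex (f.app _ b)
    obtain ⟨g, hg⟩ := exists_lift_of_pointed_lifts hB (principal.π _ _ W.univ)
      (W.lifting_π hFc hF) f b y hy (fun x hx ↦ by
        obtain ⟨H, H0, H1, -, H2⟩ := h x hx
        -- The null homotopy `H` of `x ≫ f` is lifted backwards from the constant simplex at `y`,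
        -- staying constant on `∂Δ[n]`; its start is the required lift of `x ≫ f`.
        obtain ⟨K, K0, K1, K2⟩ := hlp 1 (boundary n).ι (principal.π _ _ W.univ) (SSet.const y)
          (SSet.const y) H (by rw [comp_const, comp_const]) (by rw [const_comp, hy, H1])
          (by rw [const_comp, hy, H2, reassoc_of% hx, const_comp, comp_const])
        refine ⟨cyl 0 ≫ K, by rw [Category.assoc, K2, H0], ?_⟩
        rw [← cyl_whiskerRight_assoc, K1, comp_const])
    have hα := principal.isEquivFamily_comp g
    rw [hg] at hα
    exact splits_of_family P b W f hf hα

end SecFib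

end SplitFib

end

noncomputable section

namespace SplitFib

open HomotopicalAlgebra SSet Limits

/-! ### Pullbacks of simplicial sets -/

section

variable {X Y Z W : SSet.{u}} {f : X ⟶ Y} {g : X ⟶ Z} {p : Y ⟶ W} {h : Z ⟶ W}

lemma isPullback_of_app (w : f ≫ p = g ≫ h)
    (inj : ∀ m (x x' : X.obj m), f.app m x = f.app m x' → g.app m x = g.app m x' → x = x')
    (surj : ∀ m (y : Y.obj m) (z : Z.obj m), p.app m y = h.app m z →
      ∃ x, f.app m x = y ∧ g.app m x = z) : IsPullback f g p h := by
  refine IsPullback.of_forall_isPullback_app fun m ↦ ?_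
  rw [Types.isPullback_iff]
  exact ⟨congr_app w m, fun x x' hx ↦ inj m x x' hx.1 hx.2, surj m⟩

lemma exists_of_isPullback (sq : IsPullback f g p h) {m : SimplexCategoryᵒᵖ} (y : Y.obj m)
    (z : Z.obj m) (w : p.app m y = h.app m z) : ∃ x, f.app m x = y ∧ g.app m x = z :=
  ((Types.isPullback_iff _ _ _ _).1 (sq.map ((CategoryTheory.evaluation _ _).obj m))).2.2 y z w

lemma eq_of_isPullback (sq : IsPullback f g p h) {m : SimplexCategoryᵒᵖ} {x x' : X.obj m}
    (h1 : f.app m x = f.app m x') (h2 : g.app m x = g.app m x') : x = x' :=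
  ((Types.isPullback_iff _ _ _ _).1 (sq.map ((CategoryTheory.evaluation _ _).obj m))).2.1 x x'
    ⟨h1, h2⟩

lemma trivFib_of_isPullback (sq : IsPullback f g p h) (hp : TrivFib p) : TrivFib g := fun k ↦ by
  have := hp k
  exact sq.hasLiftingProperty _

lemma injective_of_mono {X Y : SSet.{u}} (f : X ⟶ Y) [Mono f] {m : SimplexCategoryᵒᵖ}
    {x x' : X.obj m} (h : f.app m x = f.app m x') : x = x' :=
  (mono_iff_injective _).1 (inferInstanceAs (Mono (f.app m))) h

lemma mono_of_injective {X Y : SSet.{u}} (f : X ⟶ Y)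
    (h : ∀ m (x x' : X.obj m), f.app m x = f.app m x' → x = x') : Mono f := by
  have : ∀ m, Mono (f.app m) := fun m ↦ (mono_iff_injective _).2 fun x x' ↦ h m x x'
  exact NatTrans.mono_of_mono_app f

end

/-! ### Cofree simplicial sets -/

/-- The simplicial set such that the maps `K ⟶ cofree S` correspond to the labellings of the
simplices of `K` by elements of `S`. -/
def cofree (S : Type u) : SSet.{u} where
  obj m := ∀ j : SimplexCategoryᵒᵖ, (m ⟶ j) → S
  map θ := ↾fun l j ρ ↦ l j (θ ≫ ρ)
  map_id m := by
    ext l j ρ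
    exact congrArg (l j) (Category.id_comp ρ)
  map_comp θ η := by
    ext l j ρ
    exact congrArg (l j) (Category.assoc θ η ρ)

namespace cofree

variable {S : Type u} {K : SSet.{u}}

/-- The map given by a labelling. -/
def hom (l : ∀ m, K.obj m → S) : K ⟶ cofree S where
  app m := ↾fun x j ρ ↦ l j (K.map ρ x)
  naturality m m' θ := by
    ext x
    refine funext fun j ↦ funext fun ρ ↦ ?_
    exact congrArg (l j) (Functor.map_comp_apply K θ ρ x).symm

/-- The label of a simplex. -/
def label (f : K ⟶ cofree S) {m : SimplexCategoryᵒᵖ} (x : K.obj m) : S :=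
  (show ∀ j : SimplexCategoryᵒᵖ, (m ⟶ j) → S from f.app m x) m (𝟙 m)

lemma label_hom (l : ∀ m, K.obj m → S) {m : SimplexCategoryᵒᵖ} (x : K.obj m) :
    label (hom l) x = l m x :=
  congrArg (l m) (Functor.map_id_apply K m x)

lemma hom_label (f : K ⟶ cofree S) : hom (fun _ x ↦ label f x) = f := by
  refine hom_eq_of_app fun m x ↦ ?_
  funext j ρ
  have h1 := NatTrans.naturality_apply f ρ x
  refine (congrFun (congrFun h1 j) (𝟙 j)).trans ?_
  exact congrArg ((show ∀ j : SimplexCategoryᵒᵖ, (m ⟶ j) → S from f.app m x) j)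
    (Category.comp_id ρ)

lemma hom_ext {f g : K ⟶ cofree S} (h : ∀ m (x : K.obj m), label f x = label g x) : f = g := by
  rw [← hom_label f, ← hom_label g]
  exact congrArg hom (funext fun m ↦ funext fun x ↦ h m x)

lemma label_comp {K' : SSet.{u}} (θ : K' ⟶ K) (f : K ⟶ cofree S) {m : SimplexCategoryᵒᵖ}
    (x : K'.obj m) : label (θ ≫ f) x = label f (θ.app m x) := rfl

/-- Maps to `cofree S` are unconstrained labellings, so simplices outside the image of `i` receive
an arbitrary label. -/
lemma lifting [Nonempty S] {A X : SSet.{u}} (i : A ⟶ X) [Mono i] :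
    HasLiftingProperty i (terminal.from (cofree S)) := ⟨fun {u _} _ ↦ by
  classical
  let l : ∀ m, X.obj m → S := fun m x ↦
    if h : ∃ a, i.app m a = x then label u h.choose else Classical.arbitrary S
  refine ⟨⟨⟨hom l, hom_ext fun m a ↦ ?_, Subsingleton.elim _ _⟩⟩⟩
  rw [label_comp, label_hom]
  have h : ∃ a', i.app m a' = i.app m a := ⟨a, rfl⟩
  exact (dif_pos h).trans (congrArg (label u) (injective_of_mono i h.choose_spec))⟩

end cofree

/-! ### Largest extensions of subcomplexes -/

/-- The largest subcomplex of `Z` which, over `A`, is contained in `C`. -/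
def relMax {Y Z : SSet.{u}} (A : Y.Subcomplex) (g : Z ⟶ Y) (C : Z.Subcomplex) :
    Z.Subcomplex where
  obj m := {z | ∀ (m' : SimplexCategoryᵒᵖ) (θ : m ⟶ m'),
    g.app m' (Z.map θ z) ∈ A.obj m' → Z.map θ z ∈ C.obj m'}
  map θ z hz m' η h := by
    rw [← Functor.map_comp_apply] at h ⊢
    exact hz m' (θ ≫ η) h

section relMax

variable {Y Z : SSet.{u}} {A : Y.Subcomplex} {g : Z ⟶ Y} {C : Z.Subcomplex}

lemma mem_of_mem_relMax {m : SimplexCategoryᵒᵖ} {z : Z.obj m} (hz : z ∈ (relMax A g C).obj m)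
    (h : g.app m z ∈ A.obj m) : z ∈ C.obj m := by
  have := hz m (𝟙 m)
  rw [Functor.map_id_apply] at this
  exact this h

lemma le_relMax : C ≤ relMax A g C := fun _ _ hz _ θ _ ↦ C.map θ hz

lemma relMax_mono {C' : Z.Subcomplex} (h : C ≤ C') : relMax A g C ≤ relMax A g C' :=
  fun _ _ hz m' θ h' ↦ h m' (hz m' θ h')

lemma range_le_relMax {K : SSet.{u}} (f : K ⟶ Z) (h : ∀ m (x : K.obj m),
    g.app m (f.app m x) ∈ A.obj m → f.app m x ∈ C.obj m) : Subcomplex.range f ≤ relMax A g C := by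
  rintro m _ ⟨x, rfl⟩ m' θ h'
  rw [← NatTrans.naturality_apply] at h' ⊢
  exact h m' _ h'

/-- Extends a trivial fibration over `A` strictly to `Y`. The part of a lifting problem over `A` is
solved in `C` by `h`; elsewhere membership imposes nothing, and the labels extend because `cofree S`
is injective. -/
lemma trivFib_relMax {S : Type u} [Nonempty S] {A : Y.Subcomplex} {C : (Y ⊗ cofree S).Subcomplex}
    (q : (C : SSet) ⟶ A) (hq : q ≫ A.ι = C.ι ≫ fst _ _) (h : TrivFib q) :
    TrivFib ((relMax A (fst _ _) C).ι ≫ fst Y (cofree S)) := fun k ↦ ⟨fun {v w} sq ↦ by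
  let T : (Δ[k] : SSet.{u}).Subcomplex := A.preimage w
  have hv : ∀ m (x : (Δ[k] : SSet.{u}).obj m) (hx : x ∈ (boundary k).obj m),
      (v.app m ⟨x, hx⟩).1.1 = w.app m x := fun m x hx ↦ app_eq_of_eq sq.w ⟨x, hx⟩
  let T' : (T : SSet).Subcomplex := (boundary k).preimage T.ι
  let v' : (T' : SSet) ⟶ C := Subcomplex.lift
    (Subcomplex.lift (T'.ι ≫ T.ι) (by rintro m _ ⟨x, rfl⟩; exact x.2) ≫ v ≫ Subcomplex.ι _) (by
      rintro m _ ⟨x, rfl⟩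
      refine mem_of_mem_relMax (v.app m ⟨x.1.1, x.2⟩).2 ?_
      have h1 : w.app m x.1.1 ∈ A.obj m := x.1.2
      rw [← hv m x.1.1 x.2] at h1
      exact h1)
  let w' : (T : SSet) ⟶ A := Subcomplex.lift (T.ι ≫ w) (by rintro m _ ⟨x, rfl⟩; exact x.2)
  obtain ⟨l, hl1, hl2⟩ := h.exists_lift T'.ι v' w' (hom_eq_of_app fun m x ↦ Subtype.ext
    ((app_eq_of_eq hq (v'.app m x)).trans (hv m x.1.1 x.2)))
  have hl3 : ∀ m (x : (T : SSet).obj m), (l.app m x).1.1 = w.app m x.1 := fun m x ↦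
    (app_eq_of_eq hq (l.app m x)).symm.trans (congrArg Subtype.val (app_eq_of_eq hl2 x))
  have hl4 : ∀ m (x : (Δ[k] : SSet.{u}).obj m) (hx : x ∈ (boundary k).obj m) (hT : x ∈ T.obj m),
      (v.app m ⟨x, hx⟩).1 = (l.app m ⟨x, hT⟩).1 := fun m x hx hT ↦
    (congrArg Subtype.val (app_eq_of_eq hl1 ⟨⟨x, hT⟩, hx⟩)).symm
  let R : Bool → (Δ[k] : SSet.{u}).Subcomplex := fun i ↦ bif i then boundary k else T
  let f : ∀ i, (R i : SSet) ⟶ cofree S := fun i ↦ match i with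
    | true => v ≫ Subcomplex.ι _ ≫ snd _ _
    | false => l ≫ C.ι ≫ snd _ _
  obtain ⟨d, -, hd⟩ := exists_lift_of_partial R (⨆ i, R i) (by simp) (terminal.from (cofree S))
    (cofree.lifting _) f (by
      rintro (_ | _) (_ | _) m x hi hj
      · rfl
      · exact congrArg Prod.snd (hl4 m x hj hi).symm
      · exact congrArg Prod.snd (hl4 m x hi hj)
      · rfl) (terminal.from _) (fun _ ↦ Subsingleton.elim _ _)
  have hd1 : ∀ m (x : (Δ[k] : SSet.{u}).obj m) (hx : x ∈ (boundary k).obj m),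
      d.app m x = (v.app m ⟨x, hx⟩).1.2 := fun m x hx ↦ app_eq_of_eq (hd true) ⟨x, hx⟩
  have hd2 : ∀ m (x : (Δ[k] : SSet.{u}).obj m) (hx : x ∈ T.obj m),
      d.app m x = (l.app m ⟨x, hx⟩).1.2 := fun m x hx ↦ app_eq_of_eq (hd false) ⟨x, hx⟩
  refine ⟨⟨⟨Subcomplex.lift (lift w d) (range_le_relMax _ fun m x hx ↦ ?_), ?_, rfl⟩⟩⟩
  · have h1 : (l.app m ⟨x, hx⟩).1 = (lift w d).app m x :=
      Prod.ext (hl3 m ⟨x, hx⟩) (hd2 m x hx).symm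
    rw [← h1]
    exact (l.app m ⟨x, hx⟩).2
  · refine hom_eq_of_app fun m x ↦ Subtype.ext (Prod.ext ?_ ?_)
    · exact (hv m x.1 x.2).symm
    · exact hd1 m x.1 x.2⟩

end relMax

end SplitFib

end

noncomputable section

namespace SplitFib

open HomotopicalAlgebra SSet Limits

/-! ### Paths -/

lemma mapc.trivFib_ev (F : SSet.{u}) [KanComplex F] (ε : Fin 2) : TrivFib (mapc.ev F ε) :=
  fun k ↦ ⟨fun {u v} sq ↦ by
  have w := sq.w
  rw [comp_ev] at w
  obtain ⟨H, h1, h2, -⟩ := hlp ε (boundary k).ι (terminal.from F) v (flat u) (terminal.from _)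
    w.symm (Subsingleton.elim _ _) (Subsingleton.elim _ _)
  exact ⟨⟨⟨sharp H, by rw [comp_sharp, h2, sharp_flat], by rw [comp_ev, flat_sharp, h1]⟩⟩⟩⟩

/-- Transposed, a lift is a homotopy on `X` with both ends and the restriction to `S` prescribed. -/
lemma mapc.lifting_ev {F X : SSet.{u}} (S : X.Subcomplex)
    (hS : HasLiftingProperty (S.unionProd (boundary.{u} 1)).ι (terminal.from F)) :
    HasLiftingProperty S.ι (lift (mapc.ev F 0) (mapc.ev F 1)) := ⟨fun {u v} sq ↦ by
  have w0 : cyl 0 ≫ flat u = S.ι ≫ v ≫ fst _ _ := by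
    rw [← comp_ev, ← sq.w_assoc, lift_fst]
  have w1 : cyl 1 ≫ flat u = S.ι ≫ v ≫ snd _ _ := by
    rw [← comp_ev, ← sq.w_assoc, lift_snd]
  let R : Fin 3 → (X ⊗ Δ[1] : SSet.{u}).Subcomplex :=
    ![(vtx 0).preimage (snd _ _), (vtx 1).preimage (snd _ _), S.preimage (fst _ _)]
  let g : (R 2 : SSet) ⟶ (S : SSet) ⊗ Δ[1] :=
    lift (Subcomplex.lift ((R 2).ι ≫ fst _ _) (by rintro m _ ⟨x, rfl⟩; exact x.2))
      ((R 2).ι ≫ snd _ _)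
  let f : ∀ i, (R i : SSet) ⟶ F := fun i ↦ match i with
    | 0 => (R 0).ι ≫ fst _ _ ≫ v ≫ fst _ _
    | 1 => (R 1).ι ≫ fst _ _ ≫ v ≫ snd _ _
    | 2 => g ≫ flat u
  have e0 : ∀ m (z : (X ⊗ Δ[1] : SSet.{u}).obj m) (h0 : z ∈ (R 0).obj m) (h2 : z ∈ (R 2).obj m),
      (f 0).app m ⟨z, h0⟩ = (f 2).app m ⟨z, h2⟩ := fun m z h0 h2 ↦ by
    have h : z.2 = _ := (mem_vtx_iff _ _).1 h0
    refine (app_eq_of_eq w0 ⟨z.1, h2⟩).symm.trans (congrArg ((flat u).app m) ?_)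
    exact Prod.ext rfl h.symm
  have e1 : ∀ m (z : (X ⊗ Δ[1] : SSet.{u}).obj m) (h0 : z ∈ (R 1).obj m) (h2 : z ∈ (R 2).obj m),
      (f 1).app m ⟨z, h0⟩ = (f 2).app m ⟨z, h2⟩ := fun m z h0 h2 ↦ by
    have h : z.2 = _ := (mem_vtx_iff _ _).1 h0
    refine (app_eq_of_eq w1 ⟨z.1, h2⟩).symm.trans (congrArg ((flat u).app m) ?_)
    exact Prod.ext rfl h.symm
  obtain ⟨k, -, hk⟩ := exists_lift_of_partial R _ (by
      intro m z
      refine (mem_unionProd _ _ _).trans ((or_congr_left (mem_boundary_one_iff _)).trans ?_)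
      constructor
      · rintro ((h | h) | h)
        exacts [⟨0, h⟩, ⟨1, h⟩, ⟨2, h⟩]
      · rintro ⟨i, h⟩
        fin_cases i
        exacts [.inl (.inl h), .inl (.inr h), .inr h]) (terminal.from F) hS f (by
      intro i j m z hi hj
      fin_cases i <;> fin_cases j
      exacts [rfl, (vtx_disjoint _ hi hj).elim, e0 m z hi hj, (vtx_disjoint _ hj hi).elim, rfl,
        e1 m z hi hj, (e0 m z hj hi).symm, (e1 m z hj hi).symm, rfl])
    (terminal.from _) (fun _ ↦ Subsingleton.elim _ _)
  refine ⟨⟨⟨sharp k, ?_, ?_⟩⟩⟩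
  · rw [comp_sharp, ← sharp_flat u]
    exact congrArg sharp (hom_eq_of_app fun m x ↦ app_eq_of_eq (hk 2) ⟨(x.1.1, x.2), x.1.2⟩)
  · apply CartesianMonoidalCategory.hom_ext
    · rw [Category.assoc, lift_fst, comp_ev, flat_sharp]
      exact hom_eq_of_app fun m x ↦ app_eq_of_eq (hk 0) ⟨_, mem_vtx_of_cyl 0 x⟩
    · rw [Category.assoc, lift_snd, comp_ev, flat_sharp]
      exact hom_eq_of_app fun m x ↦ app_eq_of_eq (hk 1) ⟨_, mem_vtx_of_cyl 1 x⟩⟩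

instance (F : SSet.{u}) [KanComplex F] : Fibration (lift (mapc.ev F 0) (mapc.ev F 1)) := by
  rw [modelCategoryQuillen.fibration_iff]
  intro _ _ _ h
  simp only [modelCategoryQuillen.J, MorphismProperty.iSup_iff] at h
  obtain ⟨m, ⟨k⟩⟩ := h
  exact mapc.lifting_ev _ (anodyne_of_llp (anodyneExtensions_unionProd_ι' _ _ (.horn_ι _)) _)

/-- The mapping path factorization of an equivalence over `A` with values in `A ⊗ F`. -/
lemma exists_path_factorization {A E F : SSet.{u}} [KanComplex F] (p : E ⟶ A) [Fibration p]
    (w : E ⟶ A ⊗ F) (hw : EqvOver p (fst A F) w) :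
    ∃ (M : SSet.{u}) (r : M ⟶ E) (c : E ⟶ M) (q : M ⟶ A ⊗ F) (y : M ⟶ mapc Δ[1] F),
      c ≫ r = 𝟙 E ∧ TrivFib r ∧ TrivFib q ∧ c ≫ q = w ∧ q ≫ fst A F = r ≫ p ∧
        Mono (lift r y) := by
  have hc : w ≫ snd A F = (w ≫ snd A F ≫ mapc.sharp (fst F Δ[1])) ≫ mapc.ev F 0 := by
    rw [Category.assoc, Category.assoc, mapc.comp_ev, mapc.flat_sharp, cyl_fst, Category.comp_id]
  -- A point of the pullback is a point `x` of `E` with a path in `F` that starts at the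
  -- `F`-coordinate of `w x`. The map `q` keeps the image of `x` in `A` and takes the end of the
  -- path; `c` adds constant paths.
  let r := pullback.fst (w ≫ snd A F) (mapc.ev F 0)
  let y := pullback.snd (w ≫ snd A F) (mapc.ev F 0)
  have hry : r ≫ w ≫ snd A F = y ≫ mapc.ev F 0 := pullback.condition
  let c : E ⟶ pullback (w ≫ snd A F) (mapc.ev F 0) :=
    pullback.lift (𝟙 E) (w ≫ snd A F ≫ mapc.sharp (fst F Δ[1])) (by rw [Category.id_comp]; exact hc)
  have hcr : c ≫ r = 𝟙 E := pullback.lift_fst _ _ _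
  have hcy : c ≫ y = w ≫ snd A F ≫ mapc.sharp (fst F Δ[1]) := pullback.lift_snd _ _ _
  let q := lift (r ≫ p) (y ≫ mapc.ev F 1)
  have hq : q ≫ fst A F = r ≫ p := lift_fst _ _
  have hcq : c ≫ q = w := by
    apply CartesianMonoidalCategory.hom_ext
    · rw [Category.assoc, hq, reassoc_of% hcr, hw.1]
    · rw [Category.assoc, lift_snd, reassoc_of% hcy, mapc.comp_ev, mapc.flat_sharp, cyl_fst,
        Category.comp_id]
  have hr : TrivFib r := trivFib_of_isPullback (IsPullback.of_hasPullback _ _).flip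
    (mapc.trivFib_ev F 0)
  have := hr.fibration
  have hqf : Fibration q := by
    rw [modelCategoryQuillen.fibration_iff]
    intro K L i hi
    refine ⟨fun {u v} sq ↦ ?_⟩
    have h1 := (modelCategoryQuillen.fibration_iff p).1 inferInstance _ hi
    have h2 := (modelCategoryQuillen.fibration_iff
      (lift (mapc.ev F 0) (mapc.ev F 1))).1 inferInstance _ hi
    -- The lift is built in two stages: first the point of `E`, then a path in `F` whose two ends
    -- are prescribed.
    have sq1 : CommSq (u ≫ r) i p (v ≫ fst _ _) :=
      ⟨by rw [Category.assoc, ← hq, sq.w_assoc]⟩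
    have sq2 : CommSq (u ≫ y) i (lift (mapc.ev F 0) (mapc.ev F 1))
        (lift (sq1.lift ≫ w ≫ snd _ _) (v ≫ snd _ _)) := ⟨by
      apply CartesianMonoidalCategory.hom_ext
      · rw [Category.assoc, Category.assoc, Category.assoc, lift_fst, lift_fst, sq1.fac_left_assoc,
          Category.assoc, hry]
      · rw [Category.assoc, Category.assoc, Category.assoc, lift_snd, lift_snd, ← sq.w_assoc,
          lift_snd]⟩
    have h3 := sq2.fac_right
    have h4 : sq2.lift ≫ mapc.ev F 0 = sq1.lift ≫ w ≫ snd _ _ := by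
      have := congrArg (· ≫ fst _ _) h3
      simpa only [Category.assoc, lift_fst] using this
    have h5 : sq2.lift ≫ mapc.ev F 1 = v ≫ snd _ _ := by
      have := congrArg (· ≫ snd _ _) h3
      simpa only [Category.assoc, lift_snd] using this
    let l := pullback.lift sq1.lift sq2.lift h4.symm
    have hl1 : l ≫ r = sq1.lift := pullback.lift_fst _ _ _
    have hl2 : l ≫ y = sq2.lift := pullback.lift_snd _ _ _
    refine ⟨⟨⟨l, pullback.hom_ext ?_ ?_, CartesianMonoidalCategory.hom_ext _ _ ?_ ?_⟩⟩⟩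
    · exact (Category.assoc _ _ _).trans ((congrArg (i ≫ ·) hl1).trans sq1.fac_left)
    · exact (Category.assoc _ _ _).trans ((congrArg (i ≫ ·) hl2).trans sq2.fac_left)
    · rw [Category.assoc, hq, reassoc_of% hl1, sq1.fac_right]
    · rw [Category.assoc, lift_snd, reassoc_of% hl2, h5]
  have hre : EqvOver (r ≫ p) p r := hr.eqvOver p
  have hce : EqvOver p (r ≫ p) c :=
    hre.of_comp_right (by rw [hcr]; exact .id p)
  have hqe : EqvOver (r ≫ p) (fst A F) q := hce.of_comp_left (by rw [hcq]; exact hw) hq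
  refine ⟨_, r, c, q, y, hcr, hr, trivFib_of_fibMap q hq fun b ↦ hqe.fibMap b, hcq, hq, ?_⟩
  refine ⟨fun f g h ↦ pullback.hom_ext ?_ ?_⟩
  · simpa using congrArg (· ≫ fst _ _) h
  · simpa using congrArg (· ≫ snd _ _) h

end SplitFib

end

noncomputable section

namespace SplitFib

open HomotopicalAlgebra SSet Limits

/-! ### Extension of equivalences -/

lemma TrivFib.of_iso_comp {X Y Z W : SSet.{u}} {p : Y ⟶ Z} (hp : TrivFib p) (f : X ⟶ Y) [IsIso f]
    (g : Z ⟶ W) [IsIso g] : TrivFib (f ≫ p ≫ g) := fun k ↦ by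
  have := hp k
  infer_instance

lemma trivFib_relMax_range {Y A M : SSet.{u}} {S : Type u} [Nonempty S] (a : A ⟶ Y) [Mono a]
    (m : M ⟶ Y ⊗ cofree S) [Mono m] (q : M ⟶ A) (hq : q ≫ a = m ≫ fst _ _) (h : TrivFib q) :
    TrivFib ((relMax (Subcomplex.range a) (fst _ _) (Subcomplex.range m)).ι ≫
      fst Y (cofree S)) := by
  refine trivFib_relMax (inv (Subcomplex.toRange m) ≫ q ≫ Subcomplex.toRange a) ?_
    (h.of_iso_comp _ _)
  rw [Category.assoc, Category.assoc, Subcomplex.toRange_ι, hq, IsIso.inv_comp_eq,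
    Subcomplex.toRange_ι_assoc]

/-- Extension to `M'` of a deformation of a subobject `M`, relatively to a subcomplex. -/
lemma exists_deformation {X M M' : SSet.{u}} (p : M' ⟶ X) [Fibration p] (t : M ⟶ M') [Mono t]
    (C : M'.Subcomplex) (H : M ⊗ Δ[1] ⟶ M) (H0 : cyl 0 ≫ H = 𝟙 M)
    (Hp : H ≫ t ≫ p = fst _ _ ≫ t ≫ p)
    (HC : ∀ m (x : M.obj m) (s : (Δ[1] : SSet.{u}).obj m), t.app m x ∈ C.obj m →
      H.app m (x, s) = x) :
    ∃ G : M' ⊗ Δ[1] ⟶ M', cyl 0 ≫ G = 𝟙 M' ∧ G ≫ p = fst _ _ ≫ p ∧ t ▷ Δ[1] ≫ G = H ≫ t ∧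
      C.ι ▷ Δ[1] ≫ G = fst _ _ ≫ C.ι := by
  let R : Fin 3 → (M' ⊗ Δ[1] : SSet.{u}).Subcomplex :=
    ![(vtx 0).preimage (snd _ _), C.preimage (fst _ _), (Subcomplex.range t).preimage (fst _ _)]
  let g : (R 2 : SSet) ⟶ M ⊗ Δ[1] :=
    lift (Subcomplex.lift ((R 2).ι ≫ fst _ _) (by rintro m _ ⟨x, rfl⟩; exact x.2) ≫
      inv (Subcomplex.toRange t)) ((R 2).ι ≫ snd _ _)
  have hg : ∀ m (x : M.obj m) (s : (Δ[1] : SSet.{u}).obj m)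
      (h : ((t.app m x, s) : (M' ⊗ Δ[1] : SSet).obj m) ∈ (R 2).obj m),
      g.app m ⟨_, h⟩ = (x, s) := fun m x s h ↦
    Prod.ext (app_eq_of_eq (IsIso.hom_inv_id (Subcomplex.toRange t)) x) rfl
  let f : ∀ i, (R i : SSet) ⟶ M' := fun i ↦ match i with
    | 0 => (R 0).ι ≫ fst _ _
    | 1 => (R 1).ι ≫ fst _ _
    | 2 => g ≫ H ≫ t
  have hf : ∀ m (x : M.obj m) (s : (Δ[1] : SSet.{u}).obj m)
      (h : ((t.app m x, s) : (M' ⊗ Δ[1] : SSet).obj m) ∈ (R 2).obj m),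
      (f 2).app m ⟨_, h⟩ = t.app m (H.app m (x, s)) := fun m x s h ↦
    congrArg (fun z ↦ t.app m (H.app m z)) (hg m x s h)
  have e0 : ∀ m (z : (M' ⊗ Δ[1] : SSet.{u}).obj m) (h0 : z ∈ (R 0).obj m) (h2 : z ∈ (R 2).obj m),
      (f 0).app m ⟨z, h0⟩ = (f 2).app m ⟨z, h2⟩ := by
    rintro m ⟨z, s⟩ h0 h2
    obtain ⟨x, hx⟩ := id h2
    obtain rfl : t.app m x = z := hx
    have h : s = _ := (mem_vtx_iff _ _).1 h0
    refine Eq.trans ?_ (hf m x s h2).symm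
    refine congrArg (t.app m) ((app_eq_of_eq H0 x).symm.trans (congrArg (H.app m) ?_))
    exact Prod.ext rfl h.symm
  have e1 : ∀ m (z : (M' ⊗ Δ[1] : SSet.{u}).obj m) (h0 : z ∈ (R 1).obj m) (h2 : z ∈ (R 2).obj m),
      (f 1).app m ⟨z, h0⟩ = (f 2).app m ⟨z, h2⟩ := by
    rintro m ⟨z, s⟩ h0 h2
    obtain ⟨x, hx⟩ := id h2
    obtain rfl : t.app m x = z := hx
    refine Eq.trans ?_ (hf m x s h2).symm
    exact congrArg (t.app m) (HC m x s h0).symm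
  obtain ⟨G, hG, hk⟩ := exists_lift_of_partial R
    ((C ⊔ Subcomplex.range t).unionProd (vtx.{u} 0)) (by
      intro m z
      refine (mem_unionProd _ _ _).trans ?_
      constructor
      · rintro (h | h | h)
        exacts [⟨0, h⟩, ⟨1, h⟩, ⟨2, h⟩]
      · rintro ⟨i, h⟩
        fin_cases i
        exacts [.inl h, .inr (.inl h), .inr (.inr h)])
    p (anodyne_of_llp (anodyneExtensions_unionProd_ι _ _ (anodyne_vtx 0)) p) f (by
      intro i j m z hi hj
      fin_cases i <;> fin_cases j
      exacts [rfl, rfl, e0 m z hi hj, rfl, rfl, e1 m z hi hj, (e0 m z hj hi).symm,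
        (e1 m z hj hi).symm, rfl])
    (fst _ _ ≫ p) (by
      intro i
      fin_cases i
      · rfl
      · rfl
      · refine hom_eq_of_app ?_
        rintro m ⟨⟨z, s⟩, h2⟩
        obtain ⟨x, hx⟩ := id h2
        obtain rfl : t.app m x = z := hx
        exact (congrArg (p.app m) (hf m x s h2)).trans (app_eq_of_eq Hp (x, s)))
  refine ⟨G, ?_, hG, ?_, ?_⟩
  · exact hom_eq_of_app fun m x ↦ app_eq_of_eq (hk 0) ⟨_, mem_vtx_of_cyl 0 x⟩
  · exact hom_eq_of_app fun m x ↦ (app_eq_of_eq (hk 2) ⟨(t.app m x.1, x.2), ⟨x.1, rfl⟩⟩).trans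
      (hf m x.1 x.2 ⟨x.1, rfl⟩)
  · exact hom_eq_of_app fun m x ↦ app_eq_of_eq (hk 1) ⟨(x.1.1, x.2), x.1.2⟩

/-- A fibrewise equivalence `A ⊗ F ⟶ E` over `A` extends to a fibrewise equivalence over `X`. -/
lemma exists_equivalence_extension {X E F : SSet.{u}} (A : X.Subcomplex) [KanComplex F] {S : Type u}
    [Nonempty S] (p : E ⟶ A) [Fibration p] (α : (A : SSet) ⊗ F ⟶ E)
    (hα : EqvOver (fst _ _) p α) (ℓ : E ⊗ mapc Δ[1] F ⟶ cofree S) [Mono ℓ] :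
    ∃ (E' : ((X ⊗ F) ⊗ cofree S).Subcomplex) (t : E ⟶ E') (α' : X ⊗ F ⟶ E'),
      Fibration (E'.ι ≫ fst _ _ ≫ fst _ _) ∧
      IsPullback t p (E'.ι ≫ fst _ _ ≫ fst _ _) A.ι ∧
      EqvOver (fst X F) (E'.ι ≫ fst _ _ ≫ fst _ _) α' ∧ A.ι ▷ F ≫ α' = α ≫ t := by
  obtain ⟨w, hw, hw1, hw2⟩ := hα.inverse
  obtain ⟨M, r, c, q, y, hcr, hr, hq, hcq, hqr, hry⟩ := exists_path_factorization p w hw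
  let a : (A : SSet) ⊗ F ⟶ X ⊗ F := A.ι ▷ F
  have ha : Mono a := mono_of_injective _ fun m x x' h ↦
    Prod.ext (Subtype.ext (congrArg (fun z ↦ z.1) h)) (congrArg (fun z ↦ z.2) h)
  have ha1 : ∀ m (x : (X ⊗ F : SSet).obj m), x ∈ (Subcomplex.range a).obj m ↔ x.1 ∈ A.obj m := by
    intro m x
    constructor
    · rintro ⟨x, rfl⟩
      exact x.1.2
    · intro h
      exact ⟨(⟨x.1, h⟩, x.2), rfl⟩
  -- The label determines the pair formed by the point of `E` and the path, so `ι` embeds the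
  -- mapping path object over `A ⊗ F` in a product over `X ⊗ F`.
  let ι : M ⟶ (X ⊗ F) ⊗ cofree S := lift (q ≫ a) (lift r y ≫ ℓ)
  have hι1 : ι ≫ fst _ _ = q ≫ a := lift_fst _ _
  have hι : Mono ι := mono_of_mono_fac (lift_snd (q ≫ a) (lift r y ≫ ℓ))
  have hιA : ι ≫ fst _ _ ≫ fst _ _ = r ≫ p ≫ A.ι := by
    rw [reassoc_of% hι1, whiskerRight_fst, reassoc_of% hqr]
  have : Mono c := mono_of_mono_fac hcr
  let M' := relMax (Subcomplex.range a) (fst _ _) (Subcomplex.range ι)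
  -- While `M'` extends the trivial fibration `q` to `X ⊗ F`, the subcomplex `E'` restricts over `A`
  -- to the copy of `E` formed by the constant paths.
  let E' := relMax (Subcomplex.range a) (fst _ _) (Subcomplex.range (c ≫ ι))
  have hE' : E' ≤ M' := relMax_mono (by
    rintro m _ ⟨x, rfl⟩
    exact ⟨c.app m x, rfl⟩)
  let pM : (M' : SSet) ⟶ X := M'.ι ≫ fst _ _ ≫ fst _ _
  let pE : (E' : SSet) ⟶ X := E'.ι ≫ fst _ _ ≫ fst _ _
  have hM : TrivFib (M'.ι ≫ fst _ _) := trivFib_relMax_range a ι q hι1.symm hq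
  have := hM.fibration
  have : Fibration pM := by
    have : Fibration ((M'.ι ≫ fst _ _) ≫ fst X F) := inferInstance
    simpa only [Category.assoc] using this
  let t : M ⟶ M' := Subcomplex.lift ι (le_relMax)
  have ht : t ≫ M'.ι = ι := rfl
  have : Mono t := mono_of_mono_fac ht
  let j : (E' : SSet) ⟶ M' := Subcomplex.homOfLE hE'
  obtain ⟨H, H0, H1, Hr, HC⟩ := hr.htpyRel (Subcomplex.range c) (𝟙 M) (r ≫ c)
    (by rw [Category.id_comp, Category.assoc, hcr, Category.comp_id]) (by
      rw [← cancel_epi (Subcomplex.toRange c), Subcomplex.toRange_ι_assoc,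
        Subcomplex.toRange_ι_assoc, reassoc_of% hcr, Category.comp_id])
  have htE : ∀ m (x : M.obj m), t.app m x ∈ (Subcomplex.range j).obj m →
      x ∈ (Subcomplex.range c).obj m := by
    rintro m x ⟨z, hz⟩
    have h1 : ι.app m x = z.1 := congrArg Subtype.val hz.symm
    obtain ⟨x', hx'⟩ : z.1 ∈ (Subcomplex.range (c ≫ ι)).obj m := mem_of_mem_relMax z.2 (by
      rw [← h1, ha1]
      have h2 : (ι.app m x).1.1 = (p.app m (r.app m x)).1 := app_eq_of_eq hιA x
      change (ι.app m x).1.1 ∈ A.obj m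
      rw [h2]
      exact (p.app m (r.app m x)).2)
    exact ⟨x', injective_of_mono ι (hx'.trans h1.symm)⟩
  obtain ⟨G, G0, Gp, Gt, Gj⟩ := exists_deformation pM t (Subcomplex.range j) H H0 (by
      change H ≫ ι ≫ fst _ _ ≫ fst _ _ = fst _ _ ≫ ι ≫ fst _ _ ≫ fst _ _
      rw [hιA, reassoc_of% Hr]) (fun m x s hx ↦
        app_eq_of_eq HC (⟨x, htE m x hx⟩, s))
  have Gt1 : t ≫ cyl 1 ≫ G = r ≫ c ≫ t := by
    rw [← cyl_whiskerRight_assoc, Gt, reassoc_of% H1]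
  -- Over `A` the deformation `G` contracts `M` onto the constant paths, so its end takes values in
  -- `E'`, and it fixes `E'` throughout. Hence `E'` is a retract of `M'` over `X`, which makes `pE`
  -- a fibration, and `G` makes it equivalent to `pM`.
  let ρ : (M' : SSet) ⟶ E' := Subcomplex.lift ((cyl 1 ≫ G) ≫ M'.ι)
    (range_le_relMax _ fun m x hx ↦ by
      have h1 : ((cyl 1 ≫ G) ≫ pM).app m x = pM.app m x := by
        rw [Category.assoc, Gp, cyl_fst_assoc]
      have hx' : pM.app m x ∈ A.obj m := h1 ▸ (ha1 _ _).1 hx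
      obtain ⟨z, hz⟩ := mem_of_mem_relMax x.2 ((ha1 _ _).2 hx')
      obtain rfl : t.app m z = x := Subtype.ext hz
      refine ⟨r.app m z, ?_⟩
      exact (congrArg Subtype.val (app_eq_of_eq Gt1 z)).symm)
  have hρj : ρ ≫ j = cyl 1 ≫ G := rfl
  have hjρ : j ≫ ρ = 𝟙 _ := by
    have : Mono j := mono_of_mono_fac (Subcomplex.homOfLE_ι hE')
    rw [← cancel_mono j, Category.assoc, hρj, Category.id_comp, ← cyl_whiskerRight_assoc]
    refine hom_eq_of_app fun m x ↦ ?_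
    exact app_eq_of_eq Gj (⟨j.app m x, ⟨x, rfl⟩⟩, stdSimplex.const 1 1 m)
  have hρ : ρ ≫ pE = pM := by
    change (cyl 1 ≫ G) ≫ pM = pM
    rw [Category.assoc, Gp, cyl_fst_assoc]
  have hpE : Fibration pE := by
    rw [modelCategoryQuillen.fibration_iff]
    intro _ _ i hi
    have := (modelCategoryQuillen.fibration_iff pM).1 inferInstance _ hi
    refine ⟨fun {u v} sq ↦ ?_⟩
    have sq' : CommSq (u ≫ j) i pM v := ⟨sq.w⟩
    exact ⟨⟨⟨sq'.lift ≫ ρ, by rw [sq'.fac_left_assoc, Category.assoc, hjρ, Category.comp_id],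
      by rw [Category.assoc, hρ, sq'.fac_right]⟩⟩⟩
  have hρe : EqvOver pM pE ρ := by
    refine ⟨hρ, j, rfl, HtpyRel.symm ⟨G, G0, hρj.symm, Gp, hom_eq_of_app fun m x ↦ x.1.2.elim⟩, ?_⟩
    rw [hjρ]
    exact .refl _ _ _
  -- For `α ≫ c ≫ t` to extend along the trivial fibration `M' ⟶ X ⊗ F`, its projection has to
  -- extend, and over `A` this projection is `α ≫ w`, only homotopic to the identity. Extending the
  -- homotopy to `X ⊗ F` gives an equivalence `η` of `X ⊗ F` that restricts to `α ≫ w`.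
  obtain ⟨K, K0, K1, -, -⟩ := ((hw1.postcomp (snd _ F) (terminal.from F) (terminal.from _)
    (Subsingleton.elim _ _))).symm
  rw [Category.id_comp] at K0
  obtain ⟨K', K'0, K'1, -⟩ := hlp 0 a (terminal.from F) (snd X F) K (terminal.from _)
    (by rw [K0, whiskerRight_snd]) (Subsingleton.elim _ _) (Subsingleton.elim _ _)
  have hK' : a ≫ cyl 1 ≫ K' = α ≫ w ≫ snd _ F := by
    rw [← cyl_whiskerRight_assoc, K'1, K1, Category.assoc]
  let η := lift (fst X F) (cyl 1 ≫ K')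
  have hη : EqvOver (fst X F) (fst X F) η := by
    refine (EqvOver.id _).of_htpy ⟨lift (fst _ _ ≫ fst X F) K', ?_, rfl, ?_, ?_⟩
    · exact CartesianMonoidalCategory.hom_ext _ _ rfl (by
        rw [Category.assoc, lift_snd, K'0, Category.id_comp])
    · rw [lift_fst, Category.id_comp]
    · exact hom_eq_of_app fun m x ↦ x.1.2.elim
  have haη : a ≫ η = α ≫ w ≫ a := by
    apply CartesianMonoidalCategory.hom_ext
    · rw [Category.assoc, lift_fst, Category.assoc, Category.assoc, whiskerRight_fst,
        reassoc_of% hw.1, reassoc_of% hα.1]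
    · rw [Category.assoc, lift_snd, Category.assoc, Category.assoc, whiskerRight_snd, hK']
  obtain ⟨α', hα1, hα2⟩ := hM.exists_lift a (α ≫ c ≫ t) η (by
    rw [haη, Category.assoc, Category.assoc]
    change α ≫ c ≫ ι ≫ fst _ _ = _
    rw [hι1, reassoc_of% hcq])
  have hα' : EqvOver (fst X F) pM α' := by
    have h1 := hM.eqvOver (fst X F)
    rw [Category.assoc] at h1
    exact h1.of_comp_right (by rw [hα2]; exact hη)
  let tE : E ⟶ E' := Subcomplex.lift (c ≫ ι) le_relMax
  have htj : c ≫ t = tE ≫ j := rfl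
  refine ⟨E', tE, α' ≫ ρ, hpE, ?_, hα'.comp hρe, ?_⟩
  · refine isPullback_of_app ?_ (fun m x x' h _ ↦ ?_) (fun m z x h ↦ ?_)
    · change c ≫ ι ≫ fst _ _ ≫ fst _ _ = _
      rw [hιA, reassoc_of% hcr]
    · exact injective_of_mono (c ≫ ι) (congrArg Subtype.val h)
    · have hzx : z.1.1.1 = x.1 := h
      obtain ⟨y, hy⟩ : z.1 ∈ (Subcomplex.range (c ≫ ι)).obj m := mem_of_mem_relMax z.2 (by
        rw [ha1]
        exact hzx ▸ x.2)
      refine ⟨y, Subtype.ext hy, Subtype.ext ?_⟩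
      have h2 : c ≫ ι ≫ fst _ _ ≫ fst _ _ = p ≫ A.ι := by rw [hιA, reassoc_of% hcr]
      exact (app_eq_of_eq h2 y).symm.trans ((congrArg (fun z ↦ z.1.1) hy).trans hzx)
  · rw [reassoc_of% hα1, reassoc_of% htj, hjρ, Category.comp_id]

end SplitFib

end

noncomputable section

namespace SplitFib

open HomotopicalAlgebra SSet Limits

/-! ### Large sets of labels -/

/-- A set such that the sequences of its elements can be labelled by its elements. -/
structure IsLarge (S : Type u) : Prop where
  nontrivial : Nontrivial S
  pow : ∃ f : (ℕ → S) → S, Function.Injective f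

namespace IsLarge

/-- Sequences in `T ⊕ Bool` work: a sequence of sequences is a single sequence by the pairing of
`ℕ`, and `Bool` provides two distinct elements. -/
lemma exists_of_type (T : Type u) : ∃ S : Type u, IsLarge S ∧ ∃ f : T → S, Function.Injective f := by
  refine ⟨ℕ → T ⊕ ULift Bool, ⟨?_, fun f n ↦ f n.unpair.1 n.unpair.2, fun f g h ↦ ?_⟩,
    fun t _ ↦ .inl t, fun t t' h ↦ Sum.inl_injective (congrFun h 0)⟩
  · exact ⟨fun _ ↦ .inr ⟨true⟩, fun _ ↦ .inr ⟨false⟩, fun h ↦ by simpa using congrFun h 0⟩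
  · funext a b
    simpa using congrFun h (Nat.pair a b)

variable {S : Type u} (hS : IsLarge S)
include hS

lemma exists_injective_fun (ι : Type*) [Countable ι] :
    ∃ f : (ι → S) → S, Function.Injective f := by
  obtain ⟨e, he⟩ := exists_injective_nat ι
  obtain ⟨f, hf⟩ := hS.pow
  obtain ⟨s, -⟩ := hS.nontrivial
  refine ⟨fun l ↦ f (Function.extend e l fun _ ↦ s), fun l l' h ↦ funext fun i ↦ ?_⟩
  have := congrFun (hf h) (e i)
  rwa [he.extend_apply, he.extend_apply] at this

lemma exists_injective_of_countable (ι : Type*) [Countable ι] :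
    ∃ f : ι → S, Function.Injective f := by
  classical
  obtain ⟨f, hf⟩ := hS.exists_injective_fun ι
  obtain ⟨s, s', h⟩ := hS.nontrivial
  refine ⟨fun i ↦ f fun j ↦ if i = j then s else s', fun i i' hi ↦ ?_⟩
  have := congrFun (hf hi) i
  by_contra hne
  simp [Ne.symm hne, h] at this

lemma exists_injective_prod : ∃ f : S × S → S, Function.Injective f := by
  obtain ⟨f, hf⟩ := hS.exists_injective_fun Bool
  refine ⟨fun x ↦ f fun b ↦ bif b then x.1 else x.2, fun x x' h ↦ ?_⟩
  exact Prod.ext (congrFun (hf h) true) (congrFun (hf h) false)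

end IsLarge

/-- The simplices of `X` can be labelled by the elements of `S`. -/
def FitsIn (S : Type u) (X : SSet.{u}) : Prop :=
  ∀ m, ∃ f : X.obj m → S, Function.Injective f

namespace FitsIn

variable {S : Type u} {X Y : SSet.{u}}

lemma of_mono (hY : FitsIn S Y) (f : X ⟶ Y) [Mono f] : FitsIn S X := fun m ↦ by
  obtain ⟨l, hl⟩ := hY m
  exact ⟨fun x ↦ l (f.app m x), fun x x' h ↦ injective_of_mono f (hl h)⟩

lemma prod (hS : IsLarge S) (hX : FitsIn S X) (hY : FitsIn S Y) : FitsIn S (X ⊗ Y) := fun m ↦ by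
  obtain ⟨l, hl⟩ := hX m
  obtain ⟨l', hl'⟩ := hY m
  obtain ⟨f, hf⟩ := hS.exists_injective_prod
  refine ⟨fun x ↦ f (l x.1, l' x.2), fun x x' h ↦ ?_⟩
  have := Prod.ext_iff.1 (hf h)
  exact Prod.ext (hl this.1) (hl' this.2)

instance : Countable SimplexCategory :=
  Function.Injective.countable (f := SimplexCategory.len) fun a b h ↦ by
    rw [← SimplexCategory.mk_len a, ← SimplexCategory.mk_len b, h]

/-- A simplex of `cofree S` is a labelling of the countably many morphisms out of `m`. This is why
`IsLarge` asks for closure under countable powers. -/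
lemma cofree (hS : IsLarge S) : FitsIn S (cofree S) := fun m ↦ by
  have : ∀ j : SimplexCategoryᵒᵖ, Countable (m ⟶ j) := fun j ↦
    Function.Injective.countable (f := Quiver.Hom.unop) Quiver.Hom.unop_inj
  have : Countable SimplexCategoryᵒᵖ := Opposite.equivToOpposite.symm.injective.countable
  obtain ⟨f, hf⟩ := hS.exists_injective_fun (Σ j : SimplexCategoryᵒᵖ, m ⟶ j)
  refine ⟨fun l ↦ f fun x ↦ l x.1 x.2, fun l l' h ↦ ?_⟩
  exact funext fun j ↦ funext fun ρ ↦ congrFun (hf h) ⟨j, ρ⟩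

lemma stdSimplex (hS : IsLarge S) (n : ℕ) : FitsIn S Δ[n] := fun m ↦ by
  have : Countable ((Δ[n] : SSet.{u}).obj m) := stdSimplex.objEquiv.injective.countable
  exact hS.exists_injective_of_countable _

lemma exists_mono (h : FitsIn S X) : ∃ f : X ⟶ SplitFib.cofree S, Mono f := by
  choose l hl using h
  refine ⟨cofree.hom l, mono_of_injective _ fun m x x' h ↦ hl m ?_⟩
  have := cofree.label_hom l x
  rw [← this, ← cofree.label_hom l x']
  exact congrArg (fun z : (∀ j : SimplexCategoryᵒᵖ, (m ⟶ j) → S) ↦ z m (𝟙 m)) h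

/-- There is a large set of labels for a family of simplicial sets. -/
lemma exists_large {κ : Type} (X : κ → SSet.{u}) : ∃ S : Type u, IsLarge S ∧ ∀ i, FitsIn S (X i) := by
  obtain ⟨S, hS, f, hf⟩ := IsLarge.exists_of_type (Σ (i : κ) (m : SimplexCategoryᵒᵖ), (X i).obj m)
  refine ⟨S, hS, fun i m ↦ ⟨fun x ↦ f ⟨i, m, x⟩, fun x x' h ↦ ?_⟩⟩
  simpa using hf h

end FitsIn

/-! ### Fibrations with a section contained in a product -/

/-- `E ⊆ K ⊗ cofree S` is a fibration over `K` with a section given by `s`, and its fibres are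
pointed homotopy equivalent to `(F, e)`. -/
structure IsGood {F : SSet.{u}} (e : F _⦋0⦌) {S : Type u} {K : SSet.{u}}
    (E : (K ⊗ cofree S).Subcomplex) (s : K ⟶ cofree S) : Prop where
  fibration : Fibration (E.ι ≫ fst _ _)
  sec : Subcomplex.range (lift (𝟙 K) s) ≤ E
  equiv (v : K _⦋0⦌) : ∃ g : F ⟶ E, IsEquivOntoFibre g (E.ι ≫ fst _ _) v ∧
    (g.app _ e).1 = (v, s.app _ v)

lemma isPullback_of_mem_iff {K L Z : SSet.{u}} (θ : L ⟶ K) (E : (K ⊗ Z).Subcomplex)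
    (E' : (L ⊗ Z).Subcomplex) (h : ∀ m z, z ∈ E'.obj m ↔ (θ ▷ Z).app m z ∈ E.obj m) :
    IsPullback (Subcomplex.lift (E'.ι ≫ θ ▷ Z) (by rintro m _ ⟨z, rfl⟩; exact (h m z.1).1 z.2) :
      (E' : SSet) ⟶ E) (E'.ι ≫ fst _ _) (E.ι ≫ fst _ _) θ := by
  refine isPullback_of_app rfl (fun m x x' h1 h2 ↦ ?_) (fun m y z w ↦ ?_)
  · exact Subtype.ext (Prod.ext h2 (congrArg (fun z ↦ z.1.2) h1))
  · have hw : y.1 = (θ ▷ Z).app m (z, y.1.2) := Prod.ext w rfl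
    exact ⟨⟨(z, y.1.2), (h m _).2 (hw ▸ y.2)⟩, Subtype.ext hw.symm, rfl⟩

/-- A pointed equivalence to a fibre of a base change. -/
lemma exists_equiv_of_isPullback {F Y Y' B B' : SSet.{u}} [KanComplex F] {t : Y' ⟶ Y}
    {p' : Y' ⟶ B'} {p : Y ⟶ B} {f : B' ⟶ B} [Fibration p] (sq : IsPullback t p' p f)
    {g : F ⟶ Y} {b : B' _⦋0⦌} (h : IsEquivOntoFibre g p (f.app _ b)) :
    ∃ g' : F ⟶ Y', g' ≫ t = g ∧ IsEquivOntoFibre g' p' b := by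
  have := fibration_of_isPullback sq
  have w : g ≫ p = SSet.const b ≫ f := by rw [h.comp_eq, const_comp]
  refine ⟨sq.lift g (SSet.const b) w, sq.lift_fst _ _ _, ?_⟩
  refine IsEquivOntoFibre.of_comp_incl (sq.lift_snd _ _ _) (isEquivOntoFibre_of_isPullback sq b) ?_
  rwa [sq.lift_fst]

namespace IsGood

variable {F : SSet.{u}} {e : F _⦋0⦌} {S : Type u} {K L : SSet.{u}}
    {E : (K ⊗ cofree S).Subcomplex} {s : K ⟶ cofree S} (h : IsGood e E s)

/-- The associated fibration with a section. -/
def secFib : SecFib K where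
  total := E
  proj := E.ι ≫ fst _ _
  sec := Subcomplex.lift (lift (𝟙 K) s) h.sec
  sec_proj := rfl
  fibration := h.fibration

include h in
lemma of_mem_iff [KanComplex F] (θ : L ⟶ K) (E' : (L ⊗ cofree S).Subcomplex)
    (hE' : ∀ m z, z ∈ E'.obj m ↔ (θ ▷ cofree S).app m z ∈ E.obj m) : IsGood e E' (θ ≫ s) where
  fibration := by
    have := h.fibration
    exact fibration_of_isPullback (isPullback_of_mem_iff θ E E' hE')
  sec := by
    rintro m _ ⟨x, rfl⟩
    exact (hE' m _).2 (h.sec m ⟨θ.app m x, rfl⟩)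
  equiv v := by
    have := h.fibration
    obtain ⟨g, h1, h2⟩ := h.equiv (θ.app _ v)
    obtain ⟨g', h3, h4⟩ := exists_equiv_of_isPullback (isPullback_of_mem_iff θ E E' hE') h1
    refine ⟨g', h4, Prod.ext ?_ ?_⟩
    · exact (app_eq_of_eq h4.comp_eq e).trans (const_app_vertex v e)
    · have := congrArg Subtype.val (app_eq_of_eq h3 e)
      rw [h2] at this
      exact congrArg (fun z ↦ z.2) this

end IsGood

end SplitFib

end

/-! ### Families in a base change, and their extension inside `X ⊗ cofree S`. -/

noncomputable section

namespace SplitFib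

open HomotopicalAlgebra SSet Limits

lemma IsEquivFamily.eqvOver {F B : SSet.{u}} [KanComplex F] {e : F _⦋0⦌} {P : SecFib B}
    {α : B ⊗ F ⟶ P.total} (h : IsEquivFamily e P (𝟙 B) α) : EqvOver (fst B F) P.proj α :=
  eqvOver_of_fibres α (h.proj.trans (Category.comp_id _)) fun v ↦ by
    rw [incl_fst, Category.assoc]
    exact IsEquivOntoFibre.precomp (h.equiv v) (.of_iso (fibFstIso B F v).symm)

/-- Families with values in a base change. -/
lemma isEquivFamily_iff_of_isPullback {F B B' K : SSet.{u}} [KanComplex F] {e : F _⦋0⦌}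
    {P : SecFib B} {P' : SecFib B'} {t : P'.total ⟶ P.total} {f : B' ⟶ B}
    (sq : IsPullback t P'.proj P.proj f) (hs : P'.sec ≫ t = f ≫ P.sec) {β : K ⟶ B'}
    {α : K ⊗ F ⟶ P'.total} (hα : α ≫ P'.proj = fst K F ≫ β) :
    IsEquivFamily e P' β α ↔ IsEquivFamily e P (β ≫ f) (α ≫ t) := by
  constructor
  · intro h
    refine ⟨?_, ?_, fun v ↦ ?_⟩
    · rw [Category.assoc, sq.w, reassoc_of% hα]
    · rw [reassoc_of% h.sec, hs, Category.assoc]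
    · rw [← Category.assoc]
      exact (h.equiv v).comp_incl (isEquivOntoFibre_of_isPullback sq (β.app _ v))
  · intro h
    refine ⟨hα, ?_, fun v ↦ ?_⟩
    · apply sq.hom_ext
      · rw [Category.assoc, h.sec, Category.assoc, Category.assoc, hs]
      · rw [Category.assoc, hα, lift_fst_assoc, Category.id_comp, Category.assoc, P'.sec_proj,
          Category.comp_id]
    · refine IsEquivOntoFibre.of_comp_incl ?_ (isEquivOntoFibre_of_isPullback sq (β.app _ v)) ?_
      · rw [Category.assoc, hα, lift_fst_assoc, const_comp]
      · rw [Category.assoc]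
        exact h.equiv v

namespace IsGood

variable {F : SSet.{u}} [KanComplex F] {e : F _⦋0⦌} {S : Type u} {X : SSet.{u}}

/-- A fibration with a section over `X`, with fibres equivalent to `(F, e)`, can be realized in
`X ⊗ cofree S` if it is mapped there by a monomorphism. -/
lemma of_mono {E : SSet.{u}} (p : E ⟶ X) [Fibration p] (σ : X ⟶ E) (hσ : σ ≫ p = 𝟙 X)
    (l : E ⟶ cofree S) [Mono (lift p l)] (hE : ∀ v : X _⦋0⦌, ∃ g : F ⟶ E, IsEquivOntoFibre g p v ∧
      g.app _ e = σ.app _ v) :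
    IsGood e (Subcomplex.range (lift p l)) (σ ≫ l) := by
  let h := Subcomplex.toRange (lift p l)
  have hp : h ≫ (Subcomplex.range (lift p l)).ι ≫ fst X _ = p := by
    rw [Subcomplex.toRange_ι_assoc, lift_fst]
  have sq : IsPullback (inv h) ((Subcomplex.range (lift p l)).ι ≫ fst X _) p (𝟙 X) :=
    IsPullback.of_horiz_isIso ⟨by rw [Category.comp_id, IsIso.inv_comp_eq, hp]⟩
  have := fibration_of_isPullback sq
  refine ⟨this, ?_, fun v ↦ ?_⟩
  · rintro m _ ⟨x, rfl⟩
    refine ⟨σ.app m x, Prod.ext ?_ rfl⟩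
    exact app_eq_of_eq hσ x
  · obtain ⟨g, h1, h2⟩ := hE v
    obtain ⟨g', h3, h4⟩ := exists_equiv_of_isPullback sq (b := v) h1
    refine ⟨g', h4, ?_⟩
    have h5 : g' = g ≫ h := by rw [← h3, Category.assoc, IsIso.inv_hom_id, Category.comp_id]
    rw [h5]
    change (lift p l).app _ (g.app _ e) = _
    rw [h2]
    exact Prod.ext (app_eq_of_eq hσ v) rfl

open Classical in
/-- Extension of families of equivalences. -/
lemma exists_extension (hS : IsLarge S) (hF : FitsIn S F) (hF' : FitsIn S (mapc Δ[1] F))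
    (hX : FitsIn S X) (A : X.Subcomplex) {E : ((A : SSet) ⊗ cofree S).Subcomplex}
    {s : (A : SSet) ⟶ cofree S} (h : IsGood e E s) (α : (A : SSet) ⊗ F ⟶ E)
    (hα : IsEquivFamily e h.secFib (𝟙 _) α) :
    ∃ (E' : (X ⊗ cofree S).Subcomplex) (s' : X ⟶ cofree S) (h' : IsGood e E' s')
      (α' : X ⊗ F ⟶ E'), IsEquivFamily e h'.secFib (𝟙 _) α' ∧
      (∀ m z, z ∈ E.obj m ↔ (A.ι ▷ cofree S).app m z ∈ E'.obj m) ∧ A.ι ≫ s' = s ∧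
      A.ι ▷ F ≫ α' ≫ E'.ι = α ≫ E.ι ≫ A.ι ▷ cofree S := by
  have : Nonempty S := ⟨hS.nontrivial.exists_pair_ne.choose⟩
  have hE := h.fibration
  have fE : FitsIn S E := (((hX.of_mono A.ι).prod hS (.cofree hS))).of_mono E.ι
  obtain ⟨ℓ, hℓ⟩ := (fE.prod hS hF').exists_mono
  obtain ⟨E₁, t, α₁, h1, h2, h3, h4⟩ := exists_equivalence_extension A (E.ι ≫ fst _ _) α
    hα.eqvOver ℓ
  have fE₁ : FitsIn S E₁ := ((hX.prod hS hF).prod hS (.cofree hS)).of_mono E₁.ι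
  choose inj hinj using fE₁
  let p₁ : (E₁ : SSet) ⟶ X := E₁.ι ≫ fst _ _ ≫ fst _ _
  -- The extension `E₁` lies in `(X ⊗ F) ⊗ cofree S` and is embedded anew in `X ⊗ cofree S`.
  -- Simplices over `A` keep their labels from `E`, so the restriction to `A` is `E` on the nose;
  -- the others are labelled injectively. The projection to `X` separates the two kinds.
  let l : (E₁ : SSet) ⟶ cofree S := cofree.hom fun m z ↦
    if hz : ∃ y, t.app m y = z then cofree.label (E.ι ≫ snd _ _) hz.choose else inj m z
  have ht : ∀ m (y y' : (E : SSet).obj m), t.app m y = t.app m y' → y = y' := fun m y y' hy ↦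
    eq_of_isPullback h2 hy (Subtype.ext ((app_eq_of_eq h2.w y).symm.trans
      ((congrArg (p₁.app m) hy).trans (app_eq_of_eq h2.w y'))))
  have hl1 : t ≫ l = E.ι ≫ snd _ _ := cofree.hom_ext fun m y ↦ by
    rw [cofree.label_comp, cofree.label_hom]
    have hz : ∃ y', t.app m y' = t.app m y := ⟨y, rfl⟩
    rw [dif_pos hz, ht m _ _ hz.choose_spec]
  have hl2 : ∀ m (z : (E₁ : SSet).obj m), (¬ ∃ y, t.app m y = z) → cofree.label l z = inj m z :=
    fun m z hz ↦ by rw [cofree.label_hom, dif_neg hz]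
  have hA : ∀ m (z : (E₁ : SSet).obj m), p₁.app m z ∈ A.obj m → ∃ y, t.app m y = z :=
    fun m z hz ↦ (exists_of_isPullback h2 z ⟨_, hz⟩ rfl).imp fun _ ↦ And.left
  have hA' : ∀ m y, p₁.app m (t.app m y) ∈ A.obj m := fun m y ↦ by
    have := app_eq_of_eq h2.w y
    exact (congrArg (· ∈ A.obj m) this).mpr (Subtype.property _)
  have hmono : Mono (lift p₁ l) := mono_of_injective _ fun m z z' h0 ↦ by
    have e1 : p₁.app m z = p₁.app m z' := congrArg (fun x ↦ x.1) h0
    have e2 : l.app m z = l.app m z' := congrArg (fun x ↦ x.2) h0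
    by_cases hz : ∃ y, t.app m y = z
    · obtain ⟨y, rfl⟩ := hz
      obtain ⟨y', rfl⟩ := hA m z' (e1 ▸ hA' m y)
      have e3 : y.1.2 = y'.1.2 :=
        (app_eq_of_eq hl1 y).symm.trans (e2.trans (app_eq_of_eq hl1 y'))
      have e4 : y.1.1 = y'.1.1 := Subtype.ext ((app_eq_of_eq h2.w y).symm.trans
        (e1.trans (app_eq_of_eq h2.w y')))
      exact congrArg (t.app m) (Subtype.ext (Prod.ext e4 e3))
    · have hz' : ¬ ∃ y, t.app m y = z' := by
        rintro ⟨y, rfl⟩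
        exact hz (hA m z (e1 ▸ hA' m y))
      refine hinj m ?_
      rw [← hl2 m z hz, ← hl2 m z' hz']
      exact congrArg (fun x : (∀ j : SimplexCategoryᵒᵖ, (m ⟶ j) → S) ↦ x m (𝟙 m)) e2
  let σ : X ⟶ E₁ := lift (𝟙 X) (SSet.const e) ≫ α₁
  have hσ : σ ≫ p₁ = 𝟙 X := by rw [Category.assoc, h3.1, lift_fst]
  have heq : ∀ v : X _⦋0⦌, IsEquivOntoFibre (lift (SSet.const v) (𝟙 F) ≫ α₁) p₁ v := fun v ↦
    (isEquivOntoFibre_lift_const X F v).comp_incl (IsEquivOntoFibre.incl_of_eqvOver h3 v)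
  have h' : IsGood e (Subcomplex.range (lift p₁ l)) (σ ≫ l) := of_mono p₁ σ hσ l fun v ↦
    ⟨_, heq v, congrArg (α₁.app _) (Prod.ext (const_app_vertex v e) (const_app_vertex e v).symm)⟩
  have htl : t ≫ lift p₁ l = E.ι ≫ A.ι ▷ cofree S := by
    apply CartesianMonoidalCategory.hom_ext
    · rw [Category.assoc, lift_fst, h2.w, Category.assoc, Category.assoc, whiskerRight_fst]
    · rw [Category.assoc, lift_snd, hl1, Category.assoc, whiskerRight_snd]
  have hα₁ : A.ι ▷ F ≫ (α₁ ≫ Subcomplex.toRange (lift p₁ l)) ≫ Subcomplex.ι _ =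
      α ≫ E.ι ≫ A.ι ▷ cofree S := by
    rw [Category.assoc, Subcomplex.toRange_ι, reassoc_of% h4, htl]
  refine ⟨_, _, h', α₁ ≫ Subcomplex.toRange (lift p₁ l), ⟨?_, ?_, fun v ↦ ?_⟩, fun m z ↦ ?_, ?_, hα₁⟩
  · change α₁ ≫ lift p₁ l ≫ fst _ _ = _
    rw [lift_fst, h3.1, Category.comp_id]
  · exact hom_eq_of_app fun m x ↦ Subtype.ext (Prod.ext (app_eq_of_eq hσ x) rfl)
  · have sq : IsPullback (Subcomplex.toRange (lift p₁ l)) p₁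
        ((Subcomplex.range (lift p₁ l)).ι ≫ fst X _) (𝟙 X) :=
      IsPullback.of_horiz_isIso ⟨by rw [Category.comp_id, Subcomplex.toRange_ι_assoc, lift_fst]⟩
    have := h'.fibration
    have e1 := (heq v).comp_incl (isEquivOntoFibre_of_isPullback sq v)
    rw [Category.assoc] at e1
    exact e1
  · constructor
    · intro hz
      exact ⟨t.app m ⟨z, hz⟩, app_eq_of_eq htl ⟨z, hz⟩⟩
    · rintro ⟨z₁, hz₁⟩
      have e1 : p₁.app m z₁ = z.1.1 := congrArg (fun x ↦ x.1) hz₁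
      obtain ⟨y, rfl⟩ := hA m z₁ (e1 ▸ z.1.2)
      have e2 : (A.ι ▷ cofree S).app m y.1 = (A.ι ▷ cofree S).app m z :=
        (app_eq_of_eq htl y).symm.trans hz₁
      have e3 : y.1 = z := Prod.ext (Subtype.ext (congrArg (fun x ↦ x.1) e2))
        (congrArg (fun x ↦ x.2) e2)
      exact e3 ▸ y.2
  · have e1 : A.ι ≫ lift (𝟙 X) (SSet.const e) = lift (𝟙 _) (SSet.const e) ≫ A.ι ▷ F := rfl
    have e2 : A.ι ≫ σ ≫ l = (lift (𝟙 _) (SSet.const e) ≫ α) ≫ t ≫ l := by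
      rw [Category.assoc, reassoc_of% e1, reassoc_of% h4, Category.assoc]
    have e3 : lift (𝟙 (A : SSet)) (SSet.const e) ≫ α = h.secFib.sec := hα.sec
    rw [e2, e3, hl1]
    rfl

end IsGood

end SplitFib

end

/-! ### The complex of fibrations with section inside products, and its tautological fibration. -/

noncomputable section

namespace SplitFib

open HomotopicalAlgebra SSet Limits

variable {F : SSet.{u}} [KanComplex F] (e : F _⦋0⦌) (S : Type u)

/-- The simplicial set which classifies the fibrations with a section contained in a product with
`cofree S`, with fibres equivalent to `(F, e)`. -/
def classifier : SSet.{u} where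
  obj m := { d : (SSet.stdSimplex.obj m.unop ⊗ cofree S).Subcomplex ×
    (SSet.stdSimplex.obj m.unop ⟶ cofree S) // IsGood e d.1 d.2 }
  map θ := ↾fun d ↦ ⟨(d.1.1.preimage (SSet.stdSimplex.map θ.unop ▷ cofree S),
    SSet.stdSimplex.map θ.unop ≫ d.1.2), d.2.of_mem_iff _ _ fun _ _ ↦ Iff.rfl⟩
  map_id m := by
    ext d : 3
    have h := SSet.stdSimplex.{u}.map_id m.unop
    refine Subtype.ext (Prod.ext ?_ ?_)
    · change d.1.1.preimage (SSet.stdSimplex.map (𝟙 m.unop) ▷ cofree S) = d.1.1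
      rw [h, id_whiskerRight]
      rfl
    · change SSet.stdSimplex.map (𝟙 m.unop) ≫ d.1.2 = d.1.2
      rw [h, Category.id_comp]
  map_comp θ η := by
    ext d : 3
    have h := SSet.stdSimplex.{u}.map_comp η.unop θ.unop
    refine Subtype.ext (Prod.ext ?_ ?_)
    · change d.1.1.preimage (SSet.stdSimplex.map (η.unop ≫ θ.unop) ▷ cofree S) =
        (d.1.1.preimage (SSet.stdSimplex.map θ.unop ▷ cofree S)).preimage
          (SSet.stdSimplex.map η.unop ▷ cofree S)
      rw [h, comp_whiskerRight]
      rfl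
    · change SSet.stdSimplex.map (η.unop ≫ θ.unop) ≫ d.1.2 =
        SSet.stdSimplex.map η.unop ≫ SSet.stdSimplex.map θ.unop ≫ d.1.2
      rw [h, Category.assoc]

namespace classifier

open mapc (idSimplex)

/-- The tautological fibration, as a subcomplex. -/
def taut : (classifier e S ⊗ cofree S).Subcomplex where
  obj m := {z | ((idSimplex m, z.2) : (SSet.stdSimplex.obj m.unop ⊗ cofree S : SSet).obj m) ∈
    z.1.1.1.obj m}
  map {m m'} θ z hz := by
    have h := z.1.1.1.map θ hz
    refine (congrArg (· ∈ z.1.1.1.obj m') (Prod.ext ?_ rfl)).mp h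
    change stdSimplex.objEquiv.symm (θ.unop ≫ 𝟙 m.unop) =
      stdSimplex.objEquiv.symm (𝟙 m'.unop ≫ θ.unop)
    rw [Category.id_comp, Category.comp_id]

/-- The tautological section. -/
def tautSec : classifier e S ⟶ cofree S where
  app m := ↾fun d ↦ d.1.2.app m (idSimplex m)
  naturality m m' θ := by
    ext d
    have h := NatTrans.naturality_apply d.1.2 θ (idSimplex m)
    refine Eq.trans (congrArg (d.1.2.app m') ?_) h
    change stdSimplex.objEquiv.symm (𝟙 m'.unop ≫ θ.unop) =
      stdSimplex.objEquiv.symm (θ.unop ≫ 𝟙 m.unop)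
    rw [Category.id_comp, Category.comp_id]

variable {e S} {K : SSet.{u}}

lemma mem_taut_iff (φ : K ⟶ classifier e S) {m m' : SimplexCategoryᵒᵖ} (x : K.obj m)
    (t : (SSet.stdSimplex.obj m.unop : SSet.{u}).obj m') (l : (cofree S).obj m') :
    ((t, l) : (SSet.stdSimplex.obj m.unop ⊗ cofree S : SSet).obj m') ∈
      (show (classifier e S).obj m from φ.app m x).1.1.obj m' ↔
    ((φ.app m' (K.map (stdSimplex.objEquiv t).op x), l) : (classifier e S ⊗ cofree S : SSet).obj m')
      ∈ (taut e S).obj m' := by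
  have h := NatTrans.naturality_apply φ (stdSimplex.objEquiv t).op x
  rw [h]
  refine iff_of_eq (congrArg (· ∈ (show (classifier e S).obj m from φ.app m x).1.1.obj m')
    (Prod.ext ?_ rfl))
  change t = stdSimplex.objEquiv.symm (𝟙 m'.unop ≫ stdSimplex.objEquiv t)
  rw [Category.id_comp, Equiv.symm_apply_apply]

lemma tautSec_app (φ : K ⟶ classifier e S) {m m' : SimplexCategoryᵒᵖ} (x : K.obj m)
    (t : (SSet.stdSimplex.obj m.unop : SSet.{u}).obj m') :
    (show (classifier e S).obj m from φ.app m x).1.2.app m' t =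
      (tautSec e S).app m' (φ.app m' (K.map (stdSimplex.objEquiv t).op x)) := by
  have h := NatTrans.naturality_apply φ (stdSimplex.objEquiv t).op x
  rw [h]
  refine congrArg ((show (classifier e S).obj m from φ.app m x).1.2.app m') ?_
  change t = stdSimplex.objEquiv.symm (𝟙 m'.unop ≫ stdSimplex.objEquiv t)
  rw [Category.id_comp, Equiv.symm_apply_apply]

/-- The value of a map at a simplex is itself a subcomplex with a section, and both are recovered
from the tautological ones by restricting along all faces and degeneracies. This strictness lets
extended fibrations give strictly extended classifying maps. -/
lemma hom_ext {φ ψ : K ⟶ classifier e S}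
    (h1 : ∀ m (x : K.obj m) (l : (cofree S).obj m),
      ((φ.app m x, l) : (classifier e S ⊗ cofree S : SSet).obj m) ∈ (taut e S).obj m ↔
      ((ψ.app m x, l) : (classifier e S ⊗ cofree S : SSet).obj m) ∈ (taut e S).obj m)
    (h2 : φ ≫ tautSec e S = ψ ≫ tautSec e S) : φ = ψ := by
  refine hom_eq_of_app fun m x ↦ Subtype.ext (Prod.ext ?_ ?_)
  · ext m' ⟨t, l⟩
    exact (mem_taut_iff φ x t l).trans ((h1 _ _ _).trans (mem_taut_iff ψ x t l).symm)
  · refine hom_eq_of_app fun m' t ↦ ?_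
    exact (tautSec_app φ x t).trans ((app_eq_of_eq h2 _).trans (tautSec_app ψ x t).symm)

/-- The classifying map of a fibration with a section contained in a product. -/
def classify {E : (K ⊗ cofree S).Subcomplex} {s : K ⟶ cofree S} (h : IsGood e E s) :
    K ⟶ classifier e S where
  app m := ↾fun x ↦ Subtype.mk (p := fun d : (SSet.stdSimplex.obj m.unop ⊗ cofree S).Subcomplex ×
      (SSet.stdSimplex.obj m.unop ⟶ cofree S) ↦ IsGood e d.1 d.2)
    (E.preimage ((yonedaEquiv.symm x : SSet.stdSimplex.obj m.unop ⟶ K) ▷ cofree S),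
      (yonedaEquiv.symm x : SSet.stdSimplex.obj m.unop ⟶ K) ≫ s)
    (h.of_mem_iff _ _ fun _ _ ↦ Iff.rfl)
  naturality m m' θ := by
    ext x
    have h := yonedaEquiv_symm_naturality_left θ.unop x
    refine Subtype.ext (Prod.ext ?_ ?_)
    · change E.preimage (yonedaEquiv.symm (K.map θ x) ▷ cofree S) =
        (E.preimage (yonedaEquiv.symm x ▷ cofree S)).preimage
          (SSet.stdSimplex.map θ.unop ▷ cofree S)
      have h1 : yonedaEquiv.symm (K.map θ x) = SSet.stdSimplex.map θ.unop ≫ yonedaEquiv.symm x :=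
        h.symm
      rw [h1, comp_whiskerRight]
      rfl
    · have h1 : yonedaEquiv.symm (K.map θ x) = SSet.stdSimplex.map θ.unop ≫ yonedaEquiv.symm x :=
        h.symm
      change yonedaEquiv.symm (K.map θ x) ≫ s =
        SSet.stdSimplex.map θ.unop ≫ yonedaEquiv.symm x ≫ s
      rw [h1, Category.assoc]

lemma mem_classify_iff {E : (K ⊗ cofree S).Subcomplex} {s : K ⟶ cofree S} (h : IsGood e E s)
    {m : SimplexCategoryᵒᵖ} (x : K.obj m) (l : (cofree S).obj m) :
    (((classify h).app m x, l) : (classifier e S ⊗ cofree S : SSet).obj m) ∈ (taut e S).obj m ↔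
      ((x, l) : (K ⊗ cofree S : SSet).obj m) ∈ E.obj m := by
  refine iff_of_eq (congrArg (· ∈ E.obj m) (Prod.ext ?_ rfl))
  exact Functor.map_id_apply K _ x

lemma classify_tautSec {E : (K ⊗ cofree S).Subcomplex} {s : K ⟶ cofree S} (h : IsGood e E s) :
    classify h ≫ tautSec e S = s :=
  hom_eq_of_app fun m x ↦ congrArg (s.app m) (Functor.map_id_apply K _ x)

end classifier

/-- The target of a horn inclusion is a simplex, so each lifting problem takes place in a base
change to a simplex. -/
lemma fibration_of_stdSimplex {E B : SSet.{u}} (p : E ⟶ B)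
    (h : ∀ (m : ℕ) (v : Δ[m] ⟶ B), ∃ (E' : SSet.{u}) (t : E' ⟶ E) (p' : E' ⟶ Δ[m]),
      IsPullback t p' p v ∧ Fibration p') : Fibration p := by
  rw [modelCategoryQuillen.fibration_iff]
  intro _ _ i hi
  have hi' := hi
  simp only [modelCategoryQuillen.J, MorphismProperty.iSup_iff] at hi'
  obtain ⟨m, ⟨k⟩⟩ := hi'
  refine ⟨fun {u v} sq ↦ ?_⟩
  obtain ⟨E', t, p', sq', hp'⟩ := h _ v
  have := (modelCategoryQuillen.fibration_iff p').1 hp' _ hi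
  have sq'' : CommSq (sq'.lift u _ sq.w) (horn (m + 1) k).ι p' (𝟙 _) :=
    ⟨by rw [sq'.lift_snd, Category.comp_id]⟩
  refine ⟨⟨⟨sq''.lift ≫ t, by rw [sq''.fac_left_assoc, sq'.lift_fst], ?_⟩⟩⟩
  rw [Category.assoc, sq'.w, sq''.fac_right_assoc, Category.id_comp]

namespace classifier

open mapc (idSimplex)
-- The base change of the tautological subcomplex along a simplex of the classifier is the good
-- subcomplex that this simplex is, so each condition is inherited from the simplices.
lemma isGood : IsGood e (taut e S) (tautSec e S) := by
  have key : ∀ (m : ℕ) (v : Δ[m] ⟶ classifier e S) (n) (z : (Δ[m] ⊗ cofree S : SSet).obj n),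
      z ∈ (yonedaEquiv v).1.1.obj n ↔ (v ▷ cofree S).app n z ∈ (taut e S).obj n := by
    intro m v n z
    refine (mem_taut_iff v (idSimplex (.op ⦋m⦌)) z.1 z.2).trans ?_
    refine iff_of_eq (congrArg (· ∈ (taut e S).obj n) (Prod.ext (congrArg (v.app n) ?_) rfl))
    change stdSimplex.objEquiv.symm (stdSimplex.objEquiv z.1 ≫ 𝟙 _) = z.1
    rw [Category.comp_id, Equiv.symm_apply_apply]
  have fib : Fibration ((taut e S).ι ≫ fst _ _) := fibration_of_stdSimplex _ fun m v ↦
    ⟨_, _, _, isPullback_of_mem_iff v (taut e S) _ (key m v), (yonedaEquiv v).2.fibration⟩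
  refine ⟨fib, ?_, fun w ↦ ?_⟩
  · rintro m _ ⟨d, rfl⟩
    exact d.2.sec m ⟨idSimplex m, rfl⟩
  · obtain ⟨g, h1, h2⟩ := w.2.equiv (idSimplex (.op ⦋0⦌))
    have := w.2.fibration
    let v : Δ[0] ⟶ classifier e S := yonedaEquiv.symm w
    have hv : v.app _ (idSimplex (.op ⦋0⦌)) = w :=
      yonedaEquiv.apply_symm_apply w
    have sq := isPullback_of_mem_iff v (taut e S) w.1.1 (by
      have := key 0 v
      rwa [Equiv.apply_symm_apply] at this)
    have h3 := h1.comp_incl (isEquivOntoFibre_of_isPullback sq (idSimplex (.op ⦋0⦌)))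
    rw [hv] at h3
    refine ⟨_, h3, ?_⟩
    change ((v ▷ cofree S).app _ (g.app _ e).1) = _
    rw [h2]
    exact Prod.ext hv rfl

end classifier

end SplitFib

end

/-! ### The tautological fibration is universal. -/

noncomputable section

namespace SplitFib

open HomotopicalAlgebra SSet Limits

lemma isConnected_of_trivFib {X : SSet.{u}} (h : TrivFib (terminal.from X)) : X.IsConnected := by
  obtain ⟨x, -⟩ := h.exists_lift (Subcomplex.ι (⊥ : (Δ[0] : SSet.{u}).Subcomplex))
    (Subcomplex.isInitialBot.to _) (terminal.from _) (Subsingleton.elim _ _)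
  have h : ∀ x y : X _⦋0⦌, π₀.mk x = π₀.mk y := fun x y ↦ by
    obtain ⟨H, H0, H1, -⟩ := h.htpyRel ⊥ (SSet.const x : Δ[0] ⟶ X) (SSet.const y)
      (Subsingleton.elim _ _) (hom_eq_of_app fun m x ↦ x.2.elim)
    have := isConnected_stdSimplex.{u} 1
    let γ : Δ[1] ⟶ X := lift (SSet.const (stdSimplex.obj₀Equiv.symm 0)) (𝟙 Δ[1]) ≫ H
    have h0 : γ.app _ (stdSimplex.obj₀Equiv.symm 0) = x :=
      (app_eq_of_eq H0 (stdSimplex.obj₀Equiv.symm 0)).trans (const_app_vertex _ _)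
    have h1 : γ.app _ (stdSimplex.obj₀Equiv.symm 1) = y :=
      (app_eq_of_eq H1 (stdSimplex.obj₀Equiv.symm 0)).trans (const_app_vertex _ _)
    rw [← h0, ← h1, ← mapπ₀_mk, ← mapπ₀_mk]
    exact congrArg (mapπ₀ γ) (Subsingleton.elim _ _)
  have : X.IsPreconnected := ⟨fun a b ↦ by
    obtain ⟨a, rfl⟩ := π₀.mk_surjective a
    obtain ⟨b, rfl⟩ := π₀.mk_surjective b
    exact h a b⟩
  exact { nonempty := ⟨x.app _ (stdSimplex.obj₀Equiv.symm 0)⟩ }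

lemma isConnected_of_surjective {X Y : SSet.{u}} (hX : X.IsConnected) (f : X ⟶ Y)
    (hf : ∀ y : Y _⦋0⦌, ∃ x, f.app _ x = y) : Y.IsConnected := by
  have : Y.IsPreconnected := ⟨fun a b ↦ by
    obtain ⟨a, rfl⟩ := π₀.mk_surjective a
    obtain ⟨b, rfl⟩ := π₀.mk_surjective b
    obtain ⟨a, rfl⟩ := hf a
    obtain ⟨b, rfl⟩ := hf b
    rw [← mapπ₀_mk, ← mapπ₀_mk]
    exact congrArg (mapπ₀ f) (Subsingleton.elim _ _)⟩
  exact { nonempty := ⟨f.app _ hX.nonempty.some⟩ }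

/-- Maps from a horn lift along a fibration if a vertex of the image lifts. -/
lemma exists_lift_horn {n : ℕ} (i : Fin (n + 2)) {Y B : SSet.{u}} (q : Y ⟶ B) [Fibration q]
    (β : (horn (n + 1) i : SSet.{u}) ⟶ B)
    (h : ∀ b : B _⦋0⦌, ∃ y, q.app _ y = b) : ∃ σ, σ ≫ q = β := by
  -- The horn is contracted to its vertex `i` by the zigzag `x ≤ max x i ≥ i`. Both homotopies send
  -- a vertex to itself or to `i`, so they preserve the horn, in which only faces opposite to
  -- vertices `j ≠ i` occur. The lift starts at the constant map and follows the zigzag back.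
  let g₁ : Fin (n + 2) × Fin 2 →o Fin (n + 2) :=
    ⟨fun x ↦ if x.2 = 0 then x.1 else max x.1 i, fun x y hxy ↦ by
      have h1 : x.1 ≤ y.1 := hxy.1
      have h2 : x.2 ≤ y.2 := hxy.2
      dsimp only
      split_ifs with h3 h4 h5
      · exact h1
      · exact h1.trans (le_max_left _ _)
      · exact (h3 (le_antisymm (h5 ▸ h2) (Fin.zero_le _))).elim
      · exact max_le_max_right _ h1⟩
  let g₂ : Fin (n + 2) × Fin 2 →o Fin (n + 2) :=
    ⟨fun x ↦ if x.2 = 0 then i else max x.1 i, fun x y hxy ↦ by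
      have h1 : x.1 ≤ y.1 := hxy.1
      have h2 : x.2 ≤ y.2 := hxy.2
      dsimp only
      split_ifs with h3 h4 h5
      · exact le_rfl
      · exact le_max_right _ _
      · exact (h3 (le_antisymm (h5 ▸ h2) (Fin.zero_le _))).elim
      · exact max_le_max_right _ h1⟩
  have hg : ∀ g : Fin (n + 2) × Fin 2 →o Fin (n + 2), (∀ x, g x = x.1 ∨ g x = i) →
      Subcomplex.range ((horn (n + 1) i).ι ▷ Δ[1] ≫ ofMonotone.{u} g) ≤ horn (n + 1) i := by
    rintro g hg m _ ⟨x, rfl⟩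
    obtain ⟨j, hj, hx⟩ := (mem_horn_iff' _ _).1 x.1.2
    refine (mem_horn_iff' _ _).2 ⟨j, hj, fun a ha ↦ ?_⟩
    rcases hg (stdSimplex.asOrderHom x.1.1 a, stdSimplex.asOrderHom x.2 a) with h | h
    · exact hx a (h.symm.trans ha)
    · exact hj (ha.symm.trans h)
  let h₁ : (horn (n + 1) i : SSet.{u}) ⊗ Δ[1] ⟶ horn (n + 1) i :=
    Subcomplex.lift _ (hg g₁ fun x ↦ by
      by_cases hx : x.2 = 0
      · exact .inl (if_pos hx)
      · have hx' : g₁ x = max x.1 i := if_neg hx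
        rw [hx']
        exact max_choice _ _)
  let h₂ : (horn (n + 1) i : SSet.{u}) ⊗ Δ[1] ⟶ horn (n + 1) i :=
    Subcomplex.lift _ (hg g₂ fun x ↦ by
      by_cases hx : x.2 = 0
      · exact .inr (if_pos hx)
      · have hx' : g₂ x = max x.1 i := if_neg hx
        rw [hx']
        exact max_choice _ _)
  have e1 : cyl 0 ≫ h₁ = 𝟙 _ :=
    hom_eq_of_app fun m x ↦ Subtype.ext (asOrderHom_ext fun a ↦ rfl)
  have e2 : cyl 1 ≫ h₁ = cyl 1 ≫ h₂ :=
    hom_eq_of_app fun m x ↦ Subtype.ext (asOrderHom_ext fun a ↦ rfl)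
  have e3 : ∃ v, cyl 0 ≫ h₂ = SSet.const v := by
    obtain ⟨j, hj⟩ := exists_ne i
    exact ⟨⟨stdSimplex.obj₀Equiv.symm i, (mem_horn_iff' _ _).2 ⟨j, hj, fun _ h ↦ hj h.symm⟩⟩,
      hom_eq_of_app fun m x ↦ Subtype.ext (asOrderHom_ext fun a ↦ rfl)⟩
  obtain ⟨v, hv⟩ := e3
  obtain ⟨y, hy⟩ := h (β.app _ v)
  obtain ⟨H₂, a1, a2⟩ := hlp_abs 0 q (SSet.const y) (h₂ ≫ β)
    (by rw [reassoc_of% hv, const_comp, const_comp, hy])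
  obtain ⟨H₁, b1, b2⟩ := hlp_abs 1 q (cyl 1 ≫ H₂) (h₁ ≫ β)
    (by rw [Category.assoc, a2, reassoc_of% e2])
  exact ⟨cyl 0 ≫ H₁, by rw [Category.assoc, b2, reassoc_of% e1]⟩

/-- The vertices of the associated principal fibration. -/
lemma principal.exists_vertex_iff {F B : SSet.{u}} {e : F _⦋0⦌} {P : SecFib B} {w : B _⦋0⦌} :
    (∃ v, (principal.π F e P).app _ v = w) ↔
      ∃ g : F ⟶ P.total, IsEquivOntoFibre g P.proj w ∧ g.app _ e = P.sec.app _ w := by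
  constructor
  · rintro ⟨v, rfl⟩
    have h := principal.isEquivFamily (F := F) (e := e) (P := P)
    refine ⟨_, h.equiv v, ?_⟩
    have e1 : (((SSet.const v : F ⟶ principal F e P).app _ e, e) :
        (principal F e P ⊗ F : SSet).obj (.op ⦋0⦌)) =
          (v, (SSet.const e : principal F e P ⟶ F).app _ v) :=
      Prod.ext (const_app_vertex v e) (const_app_vertex e v).symm
    exact (congrArg ((mapc.flat (principal.toMapc F e P)).app (.op ⦋0⦌)) e1).trans
      (app_eq_of_eq h.sec v)
  · rintro ⟨g, h1, h2⟩
    have : IsEquivFamily e P (SSet.const w : Δ[0] ⟶ _) (snd _ _ ≫ g) := by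
      refine ⟨?_, ?_, fun v ↦ ?_⟩
      · rw [Category.assoc, h1.comp_eq, comp_const, comp_const]
      · rw [lift_snd_assoc, const_comp, const_comp, h2]
      · rw [lift_snd_assoc, Category.id_comp, const_app_vertex]
        exact h1
    obtain ⟨φ, -, hφ⟩ := principal.exists_hom this
    exact ⟨φ.app _ (stdSimplex.obj₀Equiv.symm 0),
      (app_eq_of_eq hφ (stdSimplex.obj₀Equiv.symm 0)).trans (const_app_vertex _ _)⟩

namespace classifier

variable {F : SSet.{u}} [KanComplex F] (e : F _⦋0⦌) {S : Type u}

/-- Families of equivalences with values in the tautological fibration extend. -/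
lemma exists_extension (hS : IsLarge S) (hF : FitsIn S F) (hF' : FitsIn S (mapc Δ[1] F))
    {X : SSet.{u}} (hX : FitsIn S X) (A : X.Subcomplex) (β : (A : SSet) ⟶ classifier e S)
    (α : (A : SSet) ⊗ F ⟶ taut e S) (hα : IsEquivFamily e (isGood e S).secFib β α) :
    ∃ (β' : X ⟶ classifier e S) (α' : X ⊗ F ⟶ taut e S),
      IsEquivFamily e (isGood e S).secFib β' α' ∧ A.ι ≫ β' = β ∧ A.ι ▷ F ≫ α' = α := by
  let E := (taut e S).preimage (β ▷ cofree S)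
  have h : IsGood e E (β ≫ tautSec e S) := (isGood e S).of_mem_iff β E fun _ _ ↦ Iff.rfl
  have sq := isPullback_of_mem_iff β (taut e S) E fun _ _ ↦ Iff.rfl
  have hα0 : α ≫ (taut e S).ι ≫ fst _ _ = fst _ _ ≫ β := hα.proj
  let αE : (A : SSet) ⊗ F ⟶ E := sq.lift α (fst _ _) hα0
  have hαE : IsEquivFamily e h.secFib (𝟙 _) αE := by
    refine (isEquivFamily_iff_of_isPullback (P' := h.secFib) (P := (isGood e S).secFib) sq rfl
      (sq.lift_snd _ _ _)).2 ?_
    rw [Category.id_comp]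
    exact (congrArg (IsEquivFamily e (isGood e S).secFib β)
      (sq.lift_fst α (fst _ _) hα0)).mpr hα
  obtain ⟨E', s', h', α', hα', hE, hs, hαα⟩ := IsGood.exists_extension hS hF hF' hX A h αE hαE
  have hE' : ∀ m z, z ∈ E'.obj m ↔ (classify h' ▷ cofree S).app m z ∈ (taut e S).obj m :=
    fun m z ↦ (mem_classify_iff h' z.1 z.2).symm
  have sq' := isPullback_of_mem_iff (classify h') (taut e S) E' hE'
  have hβ : A.ι ≫ classify h' = β := by
    refine hom_ext (fun m x l ↦ ?_) ?_
    · exact (mem_classify_iff h' x.1 l).trans (hE m (x, l)).symm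
    · rw [Category.assoc, classify_tautSec, hs]
  let t : (E' : SSet) ⟶ taut e S := Subcomplex.lift (E'.ι ≫ classify h' ▷ cofree S) (by
    rintro m _ ⟨z, rfl⟩
    exact (hE' m z.1).1 z.2)
  refine ⟨classify h', α' ≫ t, ?_, hβ, ?_⟩
  · have := (isEquivFamily_iff_of_isPullback (P' := h'.secFib) (P := (isGood e S).secFib) sq'
      (by
        refine hom_eq_of_app fun m x ↦ Subtype.ext (Prod.ext rfl ?_)
        exact (app_eq_of_eq (classify_tautSec h') x).symm) hα'.proj).1 hα'
    rwa [Category.id_comp] at this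
  · refine hom_eq_of_app fun m x ↦ Subtype.ext ?_
    have e1 : A.ι ▷ F ≫ α' ≫ E'.ι ≫ classify h' ▷ cofree S = α ≫ (taut e S).ι := by
      rw [reassoc_of% hαα, ← comp_whiskerRight, hβ]
      have : sq.lift α (fst _ _) hα0 ≫ _ = α := sq.lift_fst _ _ _
      exact congrArg (· ≫ (taut e S).ι) this
    exact app_eq_of_eq e1 x

/-- The tautological fibration is universal. -/
lemma trivFib (hS : IsLarge S) (hF : FitsIn S F) (hF' : FitsIn S (mapc Δ[1] F)) :
    TrivFib (terminal.from (principal F e (isGood e S).secFib)) := fun k ↦ ⟨fun {φ _} _ ↦ by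
  obtain ⟨β, α, hα, h1, h2⟩ := exists_extension e hS hF hF' (.stdSimplex hS k) (boundary k)
    (φ ≫ principal.π _ _ _) _ (principal.isEquivFamily_comp φ)
  obtain ⟨ψ, hψ1, -⟩ := principal.exists_hom hα
  refine ⟨⟨⟨ψ, principal.hom_ext (mapc.hom_ext ?_), Subsingleton.elim _ _⟩⟩⟩
  rw [Category.assoc, mapc.flat_comp, hψ1]
  exact h2⟩

lemma exists_vertex (w : classifier e S _⦋0⦌) :
    ∃ v, (principal.π F e (isGood e S).secFib).app _ v = w := by
  obtain ⟨g, h1, h2⟩ := (isGood e S).equiv w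
  exact principal.exists_vertex_iff.2 ⟨g, h1, Subtype.ext h2⟩

/-- A horn lifts to the principal fibration, because its projection is a Kan fibration and is
surjective on vertices. It is filled in that contractible complex, and the filler is projected back.
-/
lemma kanComplex (hS : IsLarge S) (hF : FitsIn S F) (hF' : FitsIn S (mapc Δ[1] F)) :
    KanComplex (classifier e S) := by
  have : Fibration (terminal.from (classifier e S)) := by
    rw [modelCategoryQuillen.fibration_iff]
    intro _ _ _ h
    simp only [modelCategoryQuillen.J, MorphismProperty.iSup_iff] at h
    obtain ⟨m, ⟨k⟩⟩ := h
    refine ⟨fun {β _} _ ↦ ?_⟩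
    obtain ⟨φ, hφ⟩ := exists_lift_horn k (principal.π F e (isGood e S).secFib) β (exists_vertex e)
    obtain ⟨ψ, hψ, -⟩ := (trivFib e hS hF hF').exists_lift (horn (m + 1) k).ι φ (terminal.from _)
      (Subsingleton.elim _ _)
    exact ⟨⟨⟨ψ ≫ principal.π _ _ _, by rw [reassoc_of% hψ, hφ], Subsingleton.elim _ _⟩⟩⟩
  have h := (isFibrant_iff (classifier e S)).2 this
  exact h

/-- The classifying space of the pointed self-equivalences. -/
def bAutPt (hS : IsLarge S) (hF : FitsIn S F) (hF' : FitsIn S (mapc Δ[1] F)) : BAutPt F e where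
  space := classifier e S
  kan := kanComplex e hS hF hF'
  connected := isConnected_of_surjective (isConnected_of_trivFib (trivFib e hS hF hF'))
    (principal.π F e (isGood e S).secFib) (exists_vertex e)
  univ := (isGood e S).secFib
  contractible n f := by
    obtain ⟨g, h, -⟩ := (trivFib e hS hF hF').exists_lift (boundary n).ι f (terminal.from _)
      (Subsingleton.elim _ _)
    exact ⟨g, h⟩

end classifier

end SplitFib

end

/-! ### Comparison of universal fibrations and existence of classifying maps. -/

noncomputable section

namespace SplitFib

open HomotopicalAlgebra SSet Limits

/-- A fibration with a section is a base change of the tautological one. -/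
lemma classifier.exists_isPullback {F : SSet.{u}} [KanComplex F] {e : F _⦋0⦌} {S : Type u}
    {K : SSet.{u}} (P : SecFib K) (hP : FitsIn S P.total)
    (h : ∀ w : K _⦋0⦌, ∃ v, (principal.π F e P).app _ v = w) :
    ∃ (f : K ⟶ classifier e S) (t : P.total ⟶ (isGood e S).secFib.total),
      IsPullback t P.proj (isGood e S).secFib.proj f ∧
        P.sec ≫ t = f ≫ (isGood e S).secFib.sec := by
  obtain ⟨l, hl⟩ := hP.exists_mono
  have : Mono (lift P.proj l) := mono_of_mono_fac (lift_snd P.proj l)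
  have hE := IsGood.of_mono P.proj P.sec P.sec_proj l fun w ↦ principal.exists_vertex_iff.1 (h w)
  have sq : IsPullback (Subcomplex.toRange (lift P.proj l)) P.proj
      ((Subcomplex.range (lift P.proj l)).ι ≫ fst K _) (𝟙 K) :=
    IsPullback.of_horiz_isIso ⟨by rw [Category.comp_id, Subcomplex.toRange_ι_assoc, lift_fst]⟩
  have sq' := isPullback_of_mem_iff (classify hE) (taut e S) _
    (fun m z ↦ (mem_classify_iff hE z.1 z.2).symm)
  have sq'' := sq.paste_horiz sq'
  rw [Category.id_comp] at sq''
  refine ⟨classify hE, _, sq'', hom_eq_of_app fun m x ↦ Subtype.ext (Prod.ext ?_ ?_)⟩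
  · exact congrArg ((classify hE).app m) (app_eq_of_eq P.sec_proj x)
  · exact (app_eq_of_eq (classify_tautSec hE) x).symm

lemma exists_lift_stdSimplex {n : ℕ} {Y B : SSet.{u}} (q : Y ⟶ B) [Fibration q] (β : Δ[n] ⟶ B)
    (h : ∀ b : B _⦋0⦌, ∃ y, q.app _ y = b) : ∃ σ, σ ≫ q = β := by
  obtain ⟨y, hy⟩ := h (β.app _ (stdSimplex.obj₀Equiv.symm 0))
  obtain ⟨H, -, hH⟩ := hlp_abs 0 q (SSet.const y : Δ[n] ⟶ Y) (contract n ≫ β) (by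
    rw [← Category.assoc, cyl_zero_contract, const_comp, const_comp, hy])
  exact ⟨cyl 1 ≫ H, by rw [Category.assoc, hH, ← Category.assoc, cyl_one_contract,
    Category.id_comp]⟩

namespace BAutPt

variable {F : SSet.{u}} {e : F _⦋0⦌} (W W' : BAutPt F e)

/-- Transport of a classifying map along a homotopy. -/
lemma classifies_of_homotopy {j : W.space ⟶ W'.space} {t : W.univ.total ⟶ W'.univ.total}
    (sq : IsPullback t W.univ.proj W'.univ.proj j) (hs : W.univ.sec ≫ t = j ≫ W'.univ.sec)
    {B : SSet.{u}} (P : SecFib B) {f' : B ⟶ W'.space} {t' : P.total ⟶ W'.univ.total}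
    (sq' : IsPullback t' P.proj W'.univ.proj f') (hs' : P.sec ≫ t' = f' ≫ W'.univ.sec)
    (f : B ⟶ W.space) (H : B ⊗ Δ[1] ⟶ W'.space) (H0 : cyl 0 ≫ H = f ≫ j) (H1 : cyl 1 ≫ H = f') :
    Classifies P W f := by
  have : Mono P.sec := mono_of_mono_fac P.sec_proj
  -- The homotopy of classifying maps is covered by a homotopy of total spaces that ends at `t'` and
  -- follows the universal section; its start factors through `W.univ` by the pullback property.
  obtain ⟨K, K1, K2, K3⟩ := hlp 1 P.sec W'.univ.proj t' (H ≫ W'.univ.sec) (P.proj ▷ Δ[1] ≫ H)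
    (by rw [hs', reassoc_of% H1]) (by rw [sq'.w, cyl_whiskerRight_assoc, H1])
    (by rw [Category.assoc, W'.univ.sec_proj, Category.comp_id, ← Category.assoc,
      ← comp_whiskerRight, P.sec_proj, id_whiskerRight, Category.id_comp])
  have hK0 : (cyl 0 ≫ K) ≫ W'.univ.proj = (P.proj ≫ f) ≫ j := by
    rw [Category.assoc, K3, cyl_whiskerRight_assoc, H0, Category.assoc]
  let Φ := sq.lift (cyl 0 ≫ K) (P.proj ≫ f) hK0
  have hΦ1 : Φ ≫ t = cyl 0 ≫ K := sq.lift_fst _ _ _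
  have hΦ2 : Φ ≫ W.univ.proj = P.proj ≫ f := sq.lift_snd _ _ _
  refine ⟨Φ, hΦ2, sq.hom_ext ?_ ?_, fun b ↦ ?_⟩
  · rw [Category.assoc, hΦ1, ← cyl_whiskerRight_assoc, K2, reassoc_of% H0, Category.assoc, hs]
  · rw [Category.assoc, hΦ2, ← Category.assoc, P.sec_proj, Category.id_comp, Category.assoc,
      W.univ.sec_proj, Category.comp_id]
  · refine IsEquivOntoFibre.of_comp_incl ?_ (isEquivOntoFibre_of_isPullback sq (f.app _ b)) ?_
    · rw [Category.assoc, hΦ2, ← Category.assoc, Fib.incl_comp, const_comp]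
    · let β : Δ[1] ⟶ W'.space := lift (SSet.const b) (𝟙 _) ≫ H
      have hβ0 : β.app _ (stdSimplex.obj₀Equiv.symm 0) = j.app _ (f.app _ b) := by
        refine Eq.trans (congrArg (H.app _) ?_) (app_eq_of_eq H0 b)
        exact Prod.ext (const_app_vertex b (stdSimplex.obj₀Equiv.symm (0 : Fin 2)))
          (const_app_vertex _ _).symm
      have hβ1 : β.app _ (stdSimplex.obj₀Equiv.symm 1) = f'.app _ b := by
        refine Eq.trans (congrArg (H.app _) ?_) (app_eq_of_eq H1 b)
        exact Prod.ext (const_app_vertex b (stdSimplex.obj₀Equiv.symm (1 : Fin 2)))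
          (const_app_vertex _ _).symm
      -- At the end `1` the map on the fibre is an equivalence because `sq'` is a pullback.
      -- Transport along the edge traced by `b` carries this to the end `0`.
      have h := isEquivOntoFibre_cyl W'.univ.proj β (Fib.incl P.proj b ▷ Δ[1] ≫ K) (by
        rw [Category.assoc, K3, ← Category.assoc, ← comp_whiskerRight, Fib.incl_comp,
          ← Category.assoc]
        rfl) 1 0
      rw [hβ0, hβ1, cyl_whiskerRight_assoc, cyl_whiskerRight_assoc, K1] at h
      rw [Category.assoc, hΦ1]
      exact h (isEquivOntoFibre_of_isPullback sq' b)

variable [KanComplex F]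

/-- A base change between universal fibrations is an equivalence of the bases. -/
lemma trivFib_of_isPullback {j : W.space ⟶ W'.space} {t : W.univ.total ⟶ W'.univ.total}
    (sq : IsPullback t W.univ.proj W'.univ.proj j) (hs : W.univ.sec ≫ t = j ≫ W'.univ.sec) :
    TrivFib (pullback.snd j (mapc.ev W'.space 0) ≫ mapc.ev W'.space 1) := fun k ↦ ⟨fun {u v} sq₁ ↦ by
  let π' := principal.π F e W'.univ
  let u₁ := u ≫ pullback.fst _ _
  let u₂ := u ≫ pullback.snd _ _
  have hu0 : cyl 0 ≫ mapc.flat u₂ = u₁ ≫ j := by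
    rw [← mapc.comp_ev, Category.assoc, ← pullback.condition, Category.assoc]
  have hu1 : cyl 1 ≫ mapc.flat u₂ = (boundary k).ι ≫ v := by
    rw [← mapc.comp_ev, ← sq₁.w, Category.assoc]
  -- The lifting problem is a path `u₂` on `∂Δ[k]` from `u₁ ≫ j` to the boundary of `v`. The simplex
  -- `v` is lifted to the principal fibration, and the path is lifted backwards from the boundary of
  -- that lift, which puts a family over `u₁ ≫ j`.
  obtain ⟨φ, hφ⟩ := exists_lift_stdSimplex π' v W'.exists_vertex
  obtain ⟨Ψ, hΨ1, hΨ⟩ := hlp_abs 1 π' ((boundary k).ι ≫ φ) (mapc.flat u₂)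
    (by rw [Category.assoc, hφ, hu1])
  have hα := principal.isEquivFamily_comp (cyl 0 ≫ Ψ)
  have hα0 : (cyl 0 ≫ Ψ) ≫ π' = u₁ ≫ j := by rw [Category.assoc, hΨ, hu0]
  rw [hα0] at hα
  let α := sq.lift _ (fst _ _ ≫ u₁) (hα.proj.trans (Category.assoc _ _ _).symm)
  have hα1 : α ≫ t = mapc.flat ((cyl 0 ≫ Ψ) ≫ principal.toMapc F e W'.univ) := sq.lift_fst _ _ _
  have hαW : IsEquivFamily e W.univ u₁ α := by
    refine (isEquivFamily_iff_of_isPullback sq hs (sq.lift_snd _ _ _)).2 ?_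
    rw [hα1]
    exact hα
  -- Since `W.univ` is a base change, the family over `u₁ ≫ j` is one over `u₁`, and contractibility
  -- for `W` extends it, together with `u₁`, to `Δ[k]`.
  obtain ⟨γ, α', hα', hγ, hαα⟩ := W.exists_extension (boundary k).ι hαW
  obtain ⟨φ', hφ'1, hφ'2⟩ := principal.exists_hom
    ((isEquivFamily_iff_of_isPullback sq hs hα'.proj).1 hα')
  have hφ' : (boundary k).ι ≫ φ' = cyl 0 ≫ Ψ := by
    refine principal.hom_ext (mapc.hom_ext ?_)
    rw [Category.assoc, mapc.flat_comp, hφ'1, ← Category.assoc, hαα, hα1]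
  -- Contractibility for `W'` joins the two lifts `φ'` and `φ` by a homotopy `Θ` extending `Ψ`. Its
  -- projection is the path from `γ ≫ j` to `v` that extends `u₂`.
  have := mapc.lifting_ev (boundary k) (W'.trivFib.lifting _)
  have sq₂ : CommSq (mapc.sharp Ψ) (boundary k).ι
      (lift (mapc.ev (principal F e W'.univ) 0) (mapc.ev (principal F e W'.univ) 1))
      (lift φ' φ) := ⟨by
    apply CartesianMonoidalCategory.hom_ext
    · rw [Category.assoc, Category.assoc, lift_fst, lift_fst, mapc.comp_ev, mapc.flat_sharp, hφ']
    · rw [Category.assoc, Category.assoc, lift_snd, lift_snd, mapc.comp_ev, mapc.flat_sharp, hΨ1]⟩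
  let Θ := mapc.flat sq₂.lift
  have hΘ : mapc.sharp Θ = sq₂.lift := mapc.sharp_flat _
  have hΘ0 : cyl 0 ≫ Θ = φ' := by
    have := congrArg (· ≫ fst _ _) sq₂.fac_right
    simpa only [Category.assoc, lift_fst, mapc.comp_ev] using this
  have hΘ1 : cyl 1 ≫ Θ = φ := by
    have := congrArg (· ≫ snd _ _) sq₂.fac_right
    simpa only [Category.assoc, lift_snd, mapc.comp_ev] using this
  have hΘ2 : (boundary k).ι ▷ Δ[1] ≫ Θ = Ψ := by
    have := congrArg mapc.flat sq₂.fac_left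
    rwa [mapc.flat_comp, mapc.flat_sharp] at this
  have h : γ ≫ j = mapc.sharp (Θ ≫ π') ≫ mapc.ev W'.space 0 := by
    rw [mapc.comp_ev, mapc.flat_sharp, reassoc_of% hΘ0, hφ'2]
  refine ⟨⟨⟨pullback.lift γ (mapc.sharp (Θ ≫ π')) h, pullback.hom_ext ?_ ?_, ?_⟩⟩⟩
  · rw [Category.assoc, pullback.lift_fst, hγ]
  · rw [Category.assoc, pullback.lift_snd, mapc.comp_sharp, reassoc_of% hΘ2, hΨ, mapc.sharp_flat]
  · rw [pullback.lift_snd_assoc, mapc.comp_ev, mapc.flat_sharp, reassoc_of% hΘ1, hφ]⟩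

/-- A lift of `f'` to the mapping path object of `j` is a map to `W.space` with a homotopy from its
composite with `j` to `f'`, along which the classification is transported. -/
lemma exists_classifies_of_isPullback {j : W.space ⟶ W'.space} {t : W.univ.total ⟶ W'.univ.total}
    (sq : IsPullback t W.univ.proj W'.univ.proj j) (hs : W.univ.sec ≫ t = j ≫ W'.univ.sec)
    {B : SSet.{u}} (P : SecFib B) {f' : B ⟶ W'.space} {t' : P.total ⟶ W'.univ.total}
    (sq' : IsPullback t' P.proj W'.univ.proj f') (hs' : P.sec ≫ t' = f' ≫ W'.univ.sec) :
    ∃ f : B ⟶ W.space, Classifies P W f := by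
  obtain ⟨N, -, hN⟩ := (W.trivFib_of_isPullback W' sq hs).exists_lift
    (Subcomplex.ι (⊥ : B.Subcomplex)) (Subcomplex.isInitialBot.to _) f' (Subsingleton.elim _ _)
  refine ⟨N ≫ pullback.fst _ _, W.classifies_of_homotopy W' sq hs P sq' hs' _
    (mapc.flat (N ≫ pullback.snd _ _)) ?_ ?_⟩
  · rw [← mapc.comp_ev, Category.assoc, Category.assoc, pullback.condition]
  · rw [← mapc.comp_ev, Category.assoc, hN]

end BAutPt

/-- The vertices of the associated principal fibration of a fibration over a connected base. -/
lemma SecFib.exists_vertex {B : SSet.{u}} (P : SecFib B) (hB : B.IsConnected) (b w : B _⦋0⦌) :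
    ∃ v, (principal.π (Fib P.proj b) (P.pt b) P).app _ v = w := by
  obtain ⟨v, -⟩ := principal.exists_vertex_iff (P := P) (F := Fib P.proj b) (e := P.pt b) (w := b).2
    ⟨Fib.incl P.proj b, ⟨𝟙 _, Category.id_comp _, .of_iso (Iso.refl _)⟩, rfl⟩
  exact exists_lift_vertex _ hB v w

lemma nonempty_bAutPt (F : SSet.{u}) [KanComplex F] (e : F _⦋0⦌) : Nonempty (BAutPt F e) := by
  obtain ⟨S, hS, h⟩ := FitsIn.exists_large ![F, mapc Δ[1] F]
  exact ⟨classifier.bAutPt e hS (h 0) (h 1)⟩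

/-- Every fibration with a section over a connected base is classified by a map. -/
lemma exists_classifies {B : SSet.{u}} (P : SecFib B) (hB : B.IsConnected) (b : B _⦋0⦌)
    -- A single set of labels, large enough for `W.univ.total` and `P.total` as well, makes both
    -- fibrations base changes of the same tautological one.
    (W : BAutPt (Fib P.proj b) (P.pt b)) : ∃ f : B ⟶ W.space, Classifies P W f := by
  obtain ⟨S, hS, h⟩ := FitsIn.exists_large
    ![Fib P.proj b, mapc Δ[1] (Fib P.proj b), W.univ.total, P.total]
  let W' := classifier.bAutPt (P.pt b) hS (h 0) (h 1)
  obtain ⟨j, t, sq, hs⟩ := classifier.exists_isPullback W.univ (h 2) W.exists_vertex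
  obtain ⟨f', t', sq', hs'⟩ := classifier.exists_isPullback P (h 3) (P.exists_vertex hB b)
  exact W.exists_classifies_of_isPullback W' sq hs P sq' hs'

end SplitFib

end

noncomputable section

namespace SplitFib

open HomotopicalAlgebra SSet Limits

/-! ### The connecting morphism -/

lemma horn_ι_comp_eq_const_iff {n : ℕ} {E : SSet.{u}} (σ : Δ[n + 1] ⟶ E) (e : E _⦋0⦌) :
    (horn.{u} (n + 1) 0).ι ≫ σ = SSet.const e ↔
      ∀ i : Fin (n + 2), i ≠ 0 → stdSimplex.δ i ≫ σ = SSet.const e := by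
  constructor
  · intro h i hi
    rw [← horn.ι_ι _ _ hi, Category.assoc, h, comp_const]
  · intro h
    refine horn.hom_ext' fun i hi ↦ ?_
    rw [horn.ι_ι_assoc _ _ hi, h i hi, comp_const]

lemma boundary_ι_comp_eq_const {n : ℕ} {E : SSet.{u}} {σ : Δ[n + 1] ⟶ E} {e : E _⦋0⦌}
    (h : (horn.{u} (n + 1) 0).ι ≫ σ = SSet.const e) (h₀ : stdSimplex.δ 0 ≫ σ = SSet.const e) :
    (boundary (n + 1)).ι ≫ σ = SSet.const e := by
  refine boundary.hom_ext fun i ↦ ?_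
  rw [boundary.ι_ι_assoc, comp_const]
  by_cases hi : i = 0
  · rw [hi, h₀]
  · exact (horn_ι_comp_eq_const_iff σ e).1 h i hi

lemma boundary_ι_comp_δ_zero {n : ℕ} {E : SSet.{u}} {σ : Δ[n + 1] ⟶ E} {e : E _⦋0⦌}
    (h : (horn.{u} (n + 1) 0).ι ≫ σ = SSet.const e) :
    (boundary n).ι ≫ stdSimplex.δ 0 ≫ σ = SSet.const e := by
  refine hom_eq_of_app fun m x ↦ ?_
  obtain ⟨j, hj⟩ := (mem_boundary_iff _).1 x.2
  have hx : (stdSimplex.δ (0 : Fin (n + 2))).app m x.1 ∈ (horn (n + 1) 0).obj m :=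
    (mem_horn_iff' _ _).2 ⟨j.succ, Fin.succ_ne_zero _, fun i hi ↦ hj i (Fin.succ_injective _ hi)⟩
  exact app_eq_of_eq h (⟨_, hx⟩ : (horn (n + 1) 0 : SSet).obj m)

section

variable {E B : SSet.{u}} (p : E ⟶ B) [Fibration p] (b : B _⦋0⦌)

/-- Equivalences from the fibre over `b` are carried along edges by homotopy lifting, and edges
connect all vertices of `B`. -/
lemma exists_isEquivOntoFibre (hB : B.IsConnected) (w : B _⦋0⦌) :
    ∃ g : Fib p b ⟶ E, IsEquivOntoFibre g p w := by
  refine forall_vertex_of_isConnected hB (Q := fun w ↦ ∃ g : Fib p b ⟶ E, IsEquivOntoFibre g p w)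
    (fun γ ε ε' ↦ ?_) (x := b) ⟨Fib.incl p b, 𝟙 _, Category.id_comp _, .of_iso (Iso.refl _)⟩ w
  rintro ⟨g, hg⟩
  obtain ⟨H, H0, H1⟩ := hlp_abs ε p g (snd _ _ ≫ γ) (by
    rw [hg.comp_eq, ← Category.assoc, lift_snd, const_comp])
  exact ⟨cyl ε' ≫ H, isEquivOntoFibre_cyl p γ H H1 ε ε' (by rwa [H0])⟩

lemma lifting_of_truncated_fib (hB : B.IsConnected) {n : ℕ} (hF : Truncated n (Fib p b)) (k : ℕ)
    (hk : n < k) : HasLiftingProperty (boundary.{u} (k + 1)).ι p := by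
  refine lifting_succ_of_uniqueFillers fun w f g hf hg hfg ↦ ?_
  obtain ⟨_, g', -, h⟩ := exists_isEquivOntoFibre p b hB w
  have h1 : HasLiftingProperty (boundary.{u} (k + 1)).ι (terminal.from (Fib p b)) :=
    (uniqueFillers_of_pi (hF k hk)).lifting_succ
  exact Fib.htpyRel_incl (UniqueFillers.of_lifting_succ (lifting_of_isHomotopyEquiv g' h h1)
    (Fib.lift f hf) (Fib.lift g hg) (Subsingleton.elim _ _) (Fib.hom_ext hfg))

variable {p b} {e : (Fib p b) _⦋0⦌} {n : ℕ}

/-- Lifting `γ` with constant value on the `0`-th horn gives a simplex whose `0`-th face represents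
the image of `γ` under the connecting morphism. This face is null by hypothesis, so it can be
exchanged for a constant one. -/
lemma exists_pointed_lift
    (h : ∀ (x : Pi (n + 1) B b) (y : Pi n (Fib p b) e),
      IsConnecting p b e n x y → y = Pi.base n (Fib p b) e)
    (γ : Δ[n + 1] ⟶ B) (hγ : (boundary (n + 1)).ι ≫ γ = SSet.const b) :
    ∃ z : Δ[n + 1] ⟶ E, z ≫ p = γ ∧
      (boundary (n + 1)).ι ≫ z = SSet.const ((Fib.incl p b).app _ e) := by
  have hhb : horn.{u} (n + 1) 0 ≤ boundary (n + 1) := fun n x hx ↦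
    (mem_boundary_succ_iff x).2 (.inr hx)
  have hpe : p.app _ ((Fib.incl p b).app _ e) = b :=
    (app_eq_of_eq (Fib.incl_comp p b) e).trans (const_app_vertex _ _)
  have hγ' : (horn.{u} (n + 1) 0).ι ≫ γ = SSet.const b := by
    rw [← Subcomplex.homOfLE_ι hhb, Category.assoc, hγ, comp_const]
  have := anodyne_of_llp (anodyneExtensions.horn_ι.{u} (n := n + 1) 0) p
  have sq : CommSq (SSet.const ((Fib.incl p b).app _ e)) (horn.{u} (n + 1) 0).ι p γ :=
    ⟨by rw [hγ', const_comp, hpe]⟩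
  obtain ⟨σ, hσ, hσp⟩ : ∃ σ : Δ[n + 1] ⟶ E, (horn.{u} (n + 1) 0).ι ≫ σ =
    SSet.const ((Fib.incl p b).app _ e) ∧ σ ≫ p = γ := ⟨sq.lift, sq.fac_left, sq.fac_right⟩
  have hδ : (stdSimplex.δ 0 ≫ σ) ≫ p = SSet.const b := by
    rw [Category.assoc, hσp, ← boundary.ι_ι, Category.assoc, hγ, comp_const]
  have hδ' : (boundary n).ι ≫ Fib.lift _ hδ = SSet.const e := Fib.hom_ext (by
    rw [Category.assoc, Fib.lift_incl, boundary_ι_comp_δ_zero hσ, const_comp])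
  have h0 := h (ptSimplex γ hγ).homotopyClass (ptSimplex _ hδ').homotopyClass
    ⟨_, _, σ, rfl, rfl, hσp, rfl, (horn_ι_comp_eq_const_iff _ _).1 hσ⟩
  have h1 : HtpyRel (boundary n) p (stdSimplex.δ 0 ≫ σ) (SSet.const ((Fib.incl p b).app _ e)) :=
    Fib.htpyRel_incl (Pi.htpyRel h0)
  obtain ⟨z, z0, z1, z2⟩ := exists_simplex_of_htpyRel_face σ _ h1
  exact ⟨z, z2.trans hσp, boundary_ι_comp_eq_const (z1.trans hσ) z0⟩

/-- The simplex `σ` shows that `δ` bounds in `E`. Pushing it to the fibre by `r` and an inverse `ψ`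
of `Fib.incl p b ≫ r` gives a filler of the boundary `v` up to homotopy; correcting along that
homotopy yields a filler of `v` itself, which is a null homotopy of `δ`. -/
lemma eq_base_of_isConnecting {r : E ⟶ Fib p b} (hr : IsHomotopyEquiv (Fib.incl p b ≫ r))
    {x : Pi (n + 1) B b} {y : Pi n (Fib p b) e} (h : IsConnecting p b e n x y) :
    y = Pi.base n (Fib p b) e := by
  obtain ⟨γ, δ, σ, -, rfl, -, h0, h1⟩ := h
  rw [← horn_ι_comp_eq_const_iff] at h1
  rw [← eqvOver_terminal_iff] at hr
  obtain ⟨-, ψ, -, ⟨H, H0, H1, -, -⟩, -⟩ := hr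
  obtain ⟨v, hv, hv'⟩ := exists_boundary_hom (SSet.const e) δ.map (fun m x hx hx0 ↦
    (app_eq_of_eq (PtSimplex.comm' δ) (⟨_, σ_mem_boundary x hx0 hx⟩ :
      (boundary n : SSet).obj m)).symm)
  have hvσ : v ≫ Fib.incl p b = (boundary (n + 1)).ι ≫ σ := hom_eq_of_app fun m x ↦ by
    rcases (mem_boundary_succ_iff x.1).1 x.2 with h | h
    · refine (congrArg ((Fib.incl p b).app m) (hv' m x.1 h x.2)).trans ?_
      refine (app_eq_of_eq h0 _).symm.trans ?_
      exact congrArg (σ.app m) (δσ_of_mem x.1 h)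
    · refine (congrArg ((Fib.incl p b).app m) (hv m x.1 h x.2)).trans ?_
      refine Eq.trans ?_ (app_eq_of_eq h1 (⟨x.1, h⟩ : (horn (n + 1) 0 : SSet).obj m)).symm
      exact app_eq_of_eq (const_comp (X := (horn (n + 1) 0 : SSet)) e (Fib.incl p b)) ⟨x.1, h⟩
  obtain ⟨K, K0, K1, -⟩ := hlp 0 (boundary (n + 1)).ι (terminal.from (Fib p b)) (σ ≫ r ≫ ψ)
    (v ▷ Δ[1] ≫ H) (terminal.from _) (by
      rw [cyl_whiskerRight_assoc, H0, ← reassoc_of% hvσ, Category.assoc])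
      (Subsingleton.elim _ _) (Subsingleton.elim _ _)
  have hτ : (boundary (n + 1)).ι ≫ cyl 1 ≫ K = v := by
    rw [← cyl_whiskerRight_assoc, K1, cyl_whiskerRight_assoc, H1, Category.comp_id]
  refine (Pi.eq_of_htpyRel ?_).symm
  refine htpyRel_of_simplex (cyl 1 ≫ K) (Subsingleton.elim _ _) ?_ ?_ fun m x hx ↦ ?_
  · refine hom_eq_of_app fun m x ↦ ?_
    have hx : ∀ i, stdSimplex.asOrderHom ((stdSimplex.δ (0 : Fin (n + 2))).app m x) i ≠ 0 :=
      fun i ↦ Fin.succ_ne_zero _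
    have hx' := (mem_boundary_succ_iff ((stdSimplex.δ (0 : Fin (n + 2))).app m x)).2 (.inl hx)
    refine (app_eq_of_eq hτ (⟨_, hx'⟩ : (boundary (n + 1) : SSet).obj m)).trans
      ((hv' m _ hx hx').trans ?_)
    exact congrArg (δ.map.app m) (app_eq_of_eq (δ_zero_σ_zero.{u} n) x)
  · exact (comp_const _ _).trans (PtSimplex.comm' δ).symm
  · have hx' := (mem_boundary_succ_iff x).2 (.inr hx)
    exact (app_eq_of_eq hτ (⟨_, hx'⟩ : (boundary (n + 1) : SSet).obj m)).trans (hv m x hx hx')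

lemma Splits.exists_retraction [KanComplex B] (h : Splits p b) :
    ∃ r : E ⟶ Fib p b, IsHomotopyEquiv (Fib.incl p b ≫ r) := by
  obtain ⟨φ, hφ⟩ := h
  obtain ⟨g, hg, hg'⟩ := IsEquivOntoFibre.incl_of_eqvOver ((eqvOver_iff _ _ _).2 hφ) b
  refine ⟨φ ≫ snd _ _, ?_⟩
  rw [← Category.assoc, ← hg, Category.assoc]
  exact hg'.comp (.of_iso (fibFstIso B (Fib p b) b).symm)

/-- Trivial connecting morphism gives a section, by the section lemma in degree `n + 1`. The
fibration with this section is then classified by some `f`, and `SecFib.splits_iff` applies because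
`π_n(B)` is trivial. -/
lemma splits_of_isConnecting [KanComplex B] (hB : B.IsConnected) (hFc : (Fib p b).IsConnected)
    (hF : Truncated n (Fib p b)) (hBn : ConnectedBelow (n + 1) B)
    (h : ∀ (x : Pi (n + 1) B b) (y : Pi n (Fib p b) e),
      IsConnecting p b e n x y → y = Pi.base n (Fib p b) e) : Splits p b := by
  obtain ⟨s, hs, -⟩ := exists_section_of_pointed_lifts hBn p (fun k hk ↦ by
    obtain ⟨k, rfl⟩ : ∃ l, k = l + 1 := ⟨k - 1, by omega⟩
    exact lifting_of_truncated_fib p b hB hF k (by omega)) b ((Fib.incl p b).app _ e)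
    ((app_eq_of_eq (Fib.incl_comp p b) e).trans (const_app_vertex _ _)) (exists_pointed_lift h)
  let P : SecFib B := ⟨E, p, s, hs, inferInstance⟩
  have : KanComplex (Fib P.proj b) := inferInstanceAs (KanComplex (Fib p b))
  obtain ⟨W⟩ := nonempty_bAutPt (Fib P.proj b) (P.pt b)
  obtain ⟨f, hf⟩ := exists_classifies P hB b W
  have hP : P.Splits b := by
    rw [SecFib.splits_iff P b W f hFc hF (fun k hk ↦ hBn k (by omega)) hf, pi_map_trivial_iff]
    intro z hz
    have := (pi_trivial_iff.1 (hBn n (by omega) b) z hz).postcomp f (terminal.from _)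
      (terminal.from _) (Subsingleton.elim _ _)
    rwa [const_comp] at this
  obtain ⟨φ, hφ, -⟩ := hP
  exact ⟨φ, hφ⟩

end

end SplitFib

end

theorem mainTheorem8 {E B : SSet.{u}} (p : E ⟶ B) (hp : HomotopicalAlgebra.Fibration p)
    (hB : SSet.KanComplex B) (hEc : E.IsConnected) (hBc : B.IsConnected)
    (b : B _⦋0⦌) (hFc : (SplitFib.Fib p b).IsConnected)
    (n : ℕ) (hF : SplitFib.Truncated n (SplitFib.Fib p b)) :
    (SplitFib.ConnectedBelow (n + 1) B →
      ∀ e : (SplitFib.Fib p b) _⦋0⦌,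
        (SplitFib.Splits p b ↔
          ∀ (x : SplitFib.Pi (n + 1) B b) (y : SplitFib.Pi n (SplitFib.Fib p b) e),
            SplitFib.IsConnecting p b e n x y → y = SplitFib.Pi.base n (SplitFib.Fib p b) e)) ∧
    (∀ (s : B ⟶ E) (hs : s ≫ p = 𝟙 B), SplitFib.ConnectedBelow n B →
      let P : SplitFib.SecFib B := ⟨E, p, s, hs, hp⟩
      Nonempty (SplitFib.BAutPt (SplitFib.Fib p b) (P.pt b)) ∧
      ∀ W : SplitFib.BAutPt (SplitFib.Fib p b) (P.pt b),
        (∃ f : B ⟶ W.space, SplitFib.Classifies P W f) ∧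
        ∀ f : B ⟶ W.space, SplitFib.Classifies P W f →
          (P.Splits b ↔
            ∀ x : SplitFib.Pi n B b,
              SplitFib.Pi.map n f b x = SplitFib.Pi.base n W.space (f.app _ b))) := by
  refine ⟨fun hBn e ↦ ⟨fun h x y ↦ ?_, ?_⟩, fun s hs hBn ↦ ?_⟩
  · obtain ⟨r, hr⟩ := h.exists_retraction
    exact SplitFib.eq_base_of_isConnecting hr
  · exact SplitFib.splits_of_isConnecting hBc hFc hF hBn
  · intro P
    have : SSet.KanComplex (SplitFib.Fib P.proj b) :=
      inferInstanceAs (SSet.KanComplex (SplitFib.Fib p b))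
    refine ⟨SplitFib.nonempty_bAutPt _ _, fun W ↦ ⟨SplitFib.exists_classifies P hBc b W,
      fun f hf ↦ SplitFib.SecFib.splits_iff P b W f hFc hF hBn hf⟩⟩
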